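/- **Notation.** Let $\varsigma(t)=e^{t/2}-e^{-t/2}$ and $\mathcal S(t)=\varsigma(t)/t$. For a partition $\mu$ let $n=\ell(\mu)$, let $m_i$ be the multiplicity of $i$ in $\mu$, $|\mathrm{Aut}\,\mu|=\prod_i m_i!$, $z_\mu=\prod_i i^{m_i}m_i!$, $p_\mu=\prod_i p_{\mu_i}$. Let $\chi^\nu_\mu$ be the value of the irreducible character of the symmetric group labelled by $\nu$ at cycle type $\mu$, $h_\square$ the hook length of a box, $f_2(\nu)=\frac12\sum_j\big((\nu_j-j+\frac12)^2-(-j+\frac12)^2\big)$, and $s_\nu(\underline p)$ the Schur function as a polynomial in the power sums. The content of the box in row $i$ and column $j$ is $c_\square=i-j$. Given $\hat\psi(\hbar^2,y)=\sum_{k\ge1,m\ge0}c_{k,m}y^k\hbar^{2m}$ and $\hat y(\hbar^2,z)=\sum_{k\ge1}\hat y_k(\hbar^2)z^k=\sum_{k\ge1,m\ge0}s_{k,m}z^k\hbar^{2m}$, the associated *hypergeometric KP tau-function* (Orlov–Scherbin partition function) is $$Z(\underline p)=\sum_{\nu}\exp\Big(\sum_{\square\in\nu}\hat\psi(\hbar^2,-\hbar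 c_\square)\Big)\,s_\nu(\underline p)\,s_\nu\big(\{\hat y_k(\hbar^2)/\hbar\}_k\big).$$ One writes $\psi(y)=\hat\psi(0,y)$, $y(z)=\hat y(0,z)$, $x(z)=\log z-\psi(y(z))$, $X(z)=e^{x(z)}$. The pair $(\hat\psi,\hat y)$ lies in *Family II* if $\hat\psi=\alpha y$ and $\hat y=\frac{R_1(z)}{R_2(z)}+\mathcal S(\hbar z\partial_z)^{-1}\log\frac{R_3(z)}{R_4(z)}$ with $\alpha\in\mathbb C^\times$ and polynomials $R_j$, such that $\psi(y)$ and $y(z)$ are non-zero but vanish at zero, and no singular point of $y$ on $\mathbb P^1$ is mapped by $x$ to a branch point (the value of $x$ at a zero of $dx$). **Lemma.** Let $\beta,w\in\mathbb C^\times$. Let $b$, $\hbar$ be formal variables, and consider formal power series in $p_1,p_2,\dots$ whose coefficients are formal Laurent series in $b$, respectively in $\hbar$. Relabel $$b\to\frac{\hbar}{w},\qquad p_k\to\Big(\frac{\beta w}{\hbar}\Big)^kp_k .$$ 1. The left-hand side of the Mariño–Vafa formula, $$\exp\Big(\sum_{\mu\ne\emptyset}\sum_{g\ge0}\frac{(w+1)^{g+n-1}}{|\mathrm{Aut}\,\mu|}\prod_{i=1}^n\frac{\prod_{j=1}^{\mu_i-1}(\mu_i+jw)}{(\mu_i-1)!}\,I_{g,\mu}\,b^{2g-2+n+|\mu|}p_\mu\Big),$$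 becomes $$\exp\Big(\sum_{\mu\ne\emptyset}\sum_{g\ge0}\frac{(w+1)^{g+n-1}}{|\mathrm{Aut}\,\mu|}\prod_{i=1}^n\frac{\prod_{j=1}^{\mu_i-1}(\mu_i+jw)}{(\mu_i-1)!}\,I_{g,\mu}\,\hbar^{2g-2+n}\beta^{|\mu|}w^{2-2g-n}p_\mu\Big);$$ this holds for every family of complex numbers $I_{g,\mu}$, in particular for the triple Hodge integrals of the Mariño–Vafa formula. 2. The right-hand side of the Mariño–Vafa formula, $$\sum_{m\ge0}\sum_{\mu,\nu\vdash m}\frac{\chi^\nu_\mu}{z_\mu}e^{(1+\frac w2)b f_2(\nu)}\prod_{\square\in\nu}\frac{bw}{\varsigma(bwh_\square)}\,p_\mu ,$$ becomes $$\sum_{m\ge0}\sum_{\mu,\nu\vdash m}\frac{\chi^\nu_\mu}{z_\mu}e^{(\frac1w+\frac12)\hbar f_2(\nu)}\prod_{\square\in\nu}\frac{\beta w}{\varsigma(\hbar h_\square)}\,p_\mu .$$ 3. This relabelled right-hand side equals the hypergeometric KP tau-function $Z(\underline p)$ of the data $$\hat\psi(\hbar^2,y)=\frac yw,\qquad \hat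 y(\hbar^2,z)=\sum_{k\ge1}\frac{(\beta wz)^k}{k\,\mathcal S(\hbar k)},$$ which are series of the required form. For these data, as formal power series in $z$, $X(z)=z(1-\beta wz)^{1/w}$. 4. The pair $(\hat\psi,\hat y)$ lies in Family II. -/

import Mathlib

open Filter Topology
open scoped PowerSeries LaurentSeries OnePoint

noncomputable section

namespace MarinoVafa

/-! ### Partitions, Young diagrams, characters of symmetric groups -/

/-- The Young diagram of a partition; the cell `(i, j)` lies in row `i` and column `j`, both
counted from `0`. -/
def diagram {m : ℕ} (ν : Nat.Partition m) : YoungDiagram :=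
  YoungDiagram.ofRowLens (ν.parts.sort (· ≥ ·)) (Multiset.pairwise_sort ν.parts (· ≥ ·)).sortedGE

/-- `z_μ = ∏ i ^ mᵢ * mᵢ!`, with `mᵢ` the multiplicity of `i` in `μ`. -/
def zNumber (μ : Multiset ℕ) : ℕ :=
  ∏ i ∈ μ.toFinset, i ^ μ.count i * (μ.count i).factorial

/-- The order of the automorphism group of `μ`, which is `∏ mᵢ!`. -/
def autNumber (μ : Multiset ℕ) : ℕ :=
  ∏ i ∈ μ.toFinset, (μ.count i).factorial

/-- The hook length of the cell `c`: arm plus leg plus one. -/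
def hookLength (ν : YoungDiagram) (c : ℕ × ℕ) : ℕ :=
  (ν.rowLen c.1 - c.2 - 1) + (ν.colLen c.2 - c.1 - 1) + 1

/-- `f₂(ν) = ½ ∑ⱼ ((νⱼ - j + ½)² - (-j + ½)²)`, with `j = i + 1`. -/
def f2 (ν : YoungDiagram) : ℂ :=
  (1 / 2) * ∑ i ∈ Finset.range (ν.colLen 0),
    (((ν.rowLen i : ℂ) - (i + 1) + 1 / 2) ^ 2 - (-((i : ℂ) + 1) + 1 / 2) ^ 2)

open Classical in
/-- The Young symmetrizer in the group algebra of the permutations of the cells of `ν`: the sum of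
all row-preserving permutations times the signed sum of all column-preserving ones. -/
def youngSymmetrizer (ν : YoungDiagram) : MonoidAlgebra ℂ (Equiv.Perm ν.cells) :=
  (∑ σ : Equiv.Perm ν.cells with ∀ c, (σ c).1.1 = c.1.1, MonoidAlgebra.single σ 1) *
    ∑ σ : Equiv.Perm ν.cells with ∀ c, (σ c).1.2 = c.1.2,
      MonoidAlgebra.single σ ((Equiv.Perm.sign σ : ℤ) : ℂ)

/-- The irreducible (Specht) module of `ν`: the left ideal generated by the Young symmetrizer. -/
def specht (ν : YoungDiagram) : Ideal (MonoidAlgebra ℂ (Equiv.Perm ν.cells)) :=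
  Ideal.span {youngSymmetrizer ν}

/-- The irreducible character of the symmetric group that belongs to `ν`. -/
def spechtCharacter (ν : YoungDiagram) (σ : Equiv.Perm ν.cells) : ℂ :=
  LinearMap.trace ℂ (specht ν)
    (Algebra.lsmul ℂ ℂ (specht ν) (MonoidAlgebra.of ℂ (Equiv.Perm ν.cells) σ))

/-- `χ^ν_μ`: the value of the character of `ν` at a permutation of cycle type `μ` (fixed points
included as parts `1`). -/
def chi (ν : YoungDiagram) (μ : Multiset ℕ) : ℂ :=
  spechtCharacter ν (Classical.epsilon fun σ : Equiv.Perm ν.cells => σ.partition.parts = μ)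

/-! ### Schur functions in the power sums -/

section Schur

variable {R : Type*} [CommRing R] [Algebra ℂ R]

/-- The complete homogeneous symmetric function `hₙ = ∑_{μ ⊢ n} p_μ / z_μ` as a polynomial in
power sums, evaluated at `p`. It is zero for negative `n`. -/
def completeHomogeneous (p : ℕ → R) : ℤ → R
  | Int.ofNat n => ∑ μ : Nat.Partition n, ((zNumber μ.parts : ℂ)⁻¹) • (μ.parts.map p).prod
  | Int.negSucc _ => 0

/-- The Schur function `s_ν` as a polynomial in power sums (Jacobi-Trudi), evaluated at `p`. -/
def schur (p : ℕ → R) (ν : YoungDiagram) : R :=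
  Matrix.det (Matrix.of fun i j : Fin (ν.colLen 0) =>
    completeHomogeneous p ((ν.rowLen i : ℤ) - (i : ℤ) + (j : ℤ)))

end Schur

/-! ### Formal series -/

/-- Formal power series in `p₁, p₂, …` with coefficients Laurent series in one variable. -/
abbrev Fock : Type := MvPowerSeries ℕ+ ℂ⸨X⸩

/-- The variable `p_k`, for `k ≥ 1`. -/
def pvar (k : ℕ) : Fock := MvPowerSeries.X k.toPNat'

/-- The monomial `p_μ`. -/
def pmon (μ : Multiset ℕ) : Fock := (μ.map pvar).prod

/-- The sum `∑ₘ f m` of a sequence in which every monomial of the `p`'s occurs finitely often. -/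
def formalSum (f : ℕ → Fock) : Fock := fun e => ∑ᶠ m : ℕ, MvPowerSeries.coeff e (f m)

/-- The exponential of a series without constant term. -/
def fockExp (F : Fock) : Fock := PowerSeries.subst F (PowerSeries.exp ℂ⸨X⸩)

/-- `f(c t)` for a Laurent series `f(t)` and a number `c`. -/
def laurentScale (c : ℂ) (f : ℂ⸨X⸩) : ℂ⸨X⸩ where
  coeff n := c ^ n * f.coeff n
  isPWO_support' := f.isPWO_support.mono fun n hn h0 => hn (by simp [h0])

/-- The relabelling of the formal variables: the Laurent variable `b` is replaced by `ħ / w` and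
`p_k` by `(β w / ħ) ^ k p_k`, where `ħ` is the new Laurent variable. -/
def relabel (β w : ℂ) (f : Fock) : Fock := fun e =>
  (HahnSeries.single (-1 : ℤ) (β * w)) ^ (e.sum fun k m => (k : ℕ) * m) *
    laurentScale w⁻¹ (MvPowerSeries.coeff e f)

/-- `exp (c t)`. -/
def expSeries (c : ℂ) : ℂ⟦X⟧ := PowerSeries.rescale c (PowerSeries.exp ℂ)

/-- `ς(t) = exp (t / 2) - exp (- t / 2)`. -/
def varsigma : ℂ⟦X⟧ := expSeries (1 / 2) - expSeries (-(1 / 2))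

/-- `𝒮(t) = ς(t) / t`. -/
def calS : ℂ⟦X⟧ := PowerSeries.mk fun n => PowerSeries.coeff (n + 1) varsigma

/-! ### The two sides of the formula -/

/-- `(w+1)^(g+n-1) / |Aut μ| * ∏ᵢ ∏_{j=1}^{μᵢ-1} (μᵢ + j w) / (μᵢ - 1)!`, with `n` the length
of `μ`, times the number `I g μ`. -/
def vertexCoeff (w : ℂ) (I : ℕ → Multiset ℕ → ℂ) (g : ℕ) (μ : Multiset ℕ) : ℂ :=
  (w + 1) ^ (g + μ.card - 1) / (autNumber μ : ℂ) *
    (μ.map fun a : ℕ => (∏ j ∈ Finset.Icc 1 (a - 1), ((a : ℂ) + (j : ℂ) * w)) /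
      ((a - 1).factorial : ℂ)).prod * I g μ

/-- `∑_g a_g t ^ (2 g)`. -/
def genusSum (a : ℕ → ℂ) : ℂ⸨X⸩ :=
  HahnSeries.ofPowerSeries ℤ ℂ
    (PowerSeries.mk fun n => if Even n then a (n / 2) else 0)

/-- The exponent of the left-hand side: the sum over `g` and over nonempty `μ` of
`vertexCoeff w I g μ * b ^ (2 g - 2 + n + |μ|) * p_μ`. -/
def exponent (w : ℂ) (I : ℕ → Multiset ℕ → ℂ) : Fock :=
  formalSum fun m => ∑ μ : Nat.Partition (m + 1),
    MvPowerSeries.C (HahnSeries.single ((μ.parts.card : ℤ) - 2 + ((m + 1 : ℕ) : ℤ)) (1 : ℂ) *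
      genusSum fun g => vertexCoeff w I g μ.parts) * pmon μ.parts

/-- The exponent after relabelling: the sum over `g` and over nonempty `μ` of
`vertexCoeff w I g μ * ħ ^ (2 g - 2 + n) * β ^ |μ| * w ^ (2 - 2 g - n) * p_μ`. -/
def relabelledExponent (β w : ℂ) (I : ℕ → Multiset ℕ → ℂ) : Fock :=
  formalSum fun m => ∑ μ : Nat.Partition (m + 1),
    MvPowerSeries.C (HahnSeries.single ((μ.parts.card : ℤ) - 2) (1 : ℂ) *
      genusSum fun g => vertexCoeff w I g μ.parts * β ^ (m + 1) *
        w ^ (2 - 2 * (g : ℤ) - (μ.parts.card : ℤ))) * pmon μ.parts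

/-- The right-hand side of the formula, with Laurent variable `b`:
`∑ₘ ∑_{μ, ν ⊢ m} χ^ν_μ / z_μ * exp ((1 + w / 2) b f₂(ν)) * ∏_{□ ∈ ν} b w / ς(b w h_□) * p_μ`. -/
def rightSide (w : ℂ) : Fock :=
  formalSum fun m => ∑ μ : Nat.Partition m, ∑ ν : Nat.Partition m,
    MvPowerSeries.C (HahnSeries.C (chi (diagram ν) μ.parts / (zNumber μ.parts : ℂ)) *
      HahnSeries.ofPowerSeries ℤ ℂ (expSeries ((1 + w / 2) * f2 (diagram ν))) *
      ∏ c ∈ (diagram ν).cells, HahnSeries.single (1 : ℤ) w /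
        HahnSeries.ofPowerSeries ℤ ℂ
          (PowerSeries.rescale (w * (hookLength (diagram ν) c : ℂ)) varsigma)) *
    pmon μ.parts

/-- The relabelled right-hand side, with Laurent variable `ħ`:
`∑ₘ ∑_{μ, ν ⊢ m} χ^ν_μ / z_μ * exp ((1 / w + 1 / 2) ħ f₂(ν)) * ∏_{□ ∈ ν} β w / ς(ħ h_□) * p_μ`. -/
def relabelledRightSide (β w : ℂ) : Fock :=
  formalSum fun m => ∑ μ : Nat.Partition m, ∑ ν : Nat.Partition m,
    MvPowerSeries.C (HahnSeries.C (chi (diagram ν) μ.parts / (zNumber μ.parts : ℂ)) *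
      HahnSeries.ofPowerSeries ℤ ℂ (expSeries ((1 / w + 1 / 2) * f2 (diagram ν))) *
      ∏ c ∈ (diagram ν).cells, HahnSeries.C (β * w) /
        HahnSeries.ofPowerSeries ℤ ℂ
          (PowerSeries.rescale (hookLength (diagram ν) c : ℂ) varsigma)) *
    pmon μ.parts

/-! ### Hypergeometric tau-functions

A series `f(ħ², y)` is an element of `ℂ⟦ħ⟧⟦y⟧` that is even in the inner variable `ħ`. -/

/-- `f` is of the form `∑_{k ≥ 1, m ≥ 0} c_{k,m} y ^ k ħ ^ (2 m)`. -/
def IsDatum (f : ℂ⟦X⟧⟦X⟧) : Prop :=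
  PowerSeries.constantCoeff f = 0 ∧
    ∀ k n : ℕ, Odd n → PowerSeries.coeff n (PowerSeries.coeff k f) = 0

/-- `f(ħ², a ħ)` as a series in `ħ`. -/
def evalAtHbar (f : ℂ⟦X⟧⟦X⟧) (a : ℂ) : ℂ⟦X⟧ :=
  PowerSeries.mk fun n => ∑ kj ∈ Finset.HasAntidiagonal.antidiagonal n,
    PowerSeries.coeff kj.2 (PowerSeries.coeff kj.1 f) * a ^ kj.1

/-- The content of the cell in row `i` and column `j`, in the convention `c = i - j`. -/
def content (c : ℕ × ℕ) : ℂ := (c.1 : ℂ) - (c.2 : ℂ)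

/-- The hypergeometric (Orlov-Scherbin) tau-function
`∑_ν exp (∑_{□ ∈ ν} ψ(ħ², - ħ c_□)) s_ν(p) s_ν({y_k(ħ²) / ħ})`. -/
def hypergeometricTau (ψ y : ℂ⟦X⟧⟦X⟧) : Fock :=
  formalSum fun m => ∑ ν : Nat.Partition m,
    MvPowerSeries.C (HahnSeries.ofPowerSeries ℤ ℂ
        (PowerSeries.subst (∑ c ∈ (diagram ν).cells, evalAtHbar ψ (-content c))
          (PowerSeries.exp ℂ))) *
      schur pvar (diagram ν) *
      MvPowerSeries.C (schur (fun k => HahnSeries.ofPowerSeries ℤ ℂ (PowerSeries.coeff k y) /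
        HahnSeries.single (1 : ℤ) (1 : ℂ)) (diagram ν))

/-- The restriction of `f(ħ², y)` to `ħ = 0`. -/
def atZero (f : ℂ⟦X⟧⟦X⟧) : ℂ⟦X⟧ := PowerSeries.map PowerSeries.constantCoeff f

/-- `X(z) = exp (log z - ψ(y(z))) = z * exp (- ψ(y(z)))`, where `ψ` and `y` are the restrictions
of the data to `ħ = 0`. -/
def spectralX (ψ y : ℂ⟦X⟧⟦X⟧) : ℂ⟦X⟧ :=
  PowerSeries.X * PowerSeries.subst (-(PowerSeries.subst (atZero y) (atZero ψ)) : ℂ⟦X⟧)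
    (PowerSeries.exp ℂ)

/-! ### Family II -/

/-- `P` is a pole of the rational one-form `f dz` on the Riemann sphere. -/
def IsPole (f : RatFunc ℂ) : OnePoint ℂ → Prop
  | ∞ => f ≠ 0 ∧ -2 < f.intDegree
  | (z : ℂ) => f.denom.IsRoot z

/-- `P` is a zero of the rational one-form `f dz` on the Riemann sphere. -/
def IsZero (f : RatFunc ℂ) : OnePoint ℂ → Prop
  | ∞ => f = 0 ∨ f.intDegree < -2
  | (z : ℂ) => f.num.IsRoot z

/-- Along some path from `P` to `Q`, the (multivalued) primitive `x` of `f dz` takes one and the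
same finite value at both ends (as a limit along the path). -/
def SameValue (f : RatFunc ℂ) (P Q : OnePoint ℂ) : Prop :=
  ∃ (γ x : ℝ → ℂ) (v : ℂ),
    (∀ t ∈ Set.Ioo (0 : ℝ) 1, f.denom.eval (γ t) ≠ 0 ∧
      ∃ γ' : ℂ, HasDerivAt γ γ' t ∧ HasDerivAt x (f.eval (RingHom.id ℂ) (γ t) * γ') t) ∧
    Tendsto (fun t => (γ t : OnePoint ℂ)) (𝓝[>] 0) (𝓝 P) ∧
    Tendsto (fun t => (γ t : OnePoint ℂ)) (𝓝[<] 1) (𝓝 Q) ∧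
    Tendsto x (𝓝[>] 0) (𝓝 v) ∧ Tendsto x (𝓝[<] 1) (𝓝 v)

/-- `𝒮(ħ z ∂_z)⁻¹ L`: the operator multiplies `z ^ k` by `1 / 𝒮(ħ k)`. -/
def invS (L : ℂ⟦X⟧) : ℂ⟦X⟧⟦X⟧ :=
  PowerSeries.mk fun k =>
    PowerSeries.C (PowerSeries.coeff k L) * (PowerSeries.rescale (k : ℂ) calS)⁻¹

/-- `L` is a determination at `z = 0` of `log (P / Q)`, for polynomials `P`, `Q` that do not vanish
at `0`. -/
def IsLogQuotient (P Q : Polynomial ℂ) (L : ℂ⟦X⟧) : Prop :=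
  Complex.exp (PowerSeries.constantCoeff L) * Q.eval 0 = P.eval 0 ∧
    ((P * Q : Polynomial ℂ) : ℂ⟦X⟧) * PowerSeries.derivative ℂ L =
      ((P.derivative * Q - P * Q.derivative : Polynomial ℂ) : ℂ⟦X⟧)

/-- The derivative of `R₁ / R₂ + log (R₃ / R₄)` as a rational function. -/
def rationalDeriv (R₁ R₂ R₃ R₄ : Polynomial ℂ) : RatFunc ℂ :=
  let a : Polynomial ℂ → RatFunc ℂ := algebraMap (Polynomial ℂ) (RatFunc ℂ)
  (a R₁.derivative * a R₂ - a R₁ * a R₂.derivative) / a R₂ ^ 2 +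
    a R₃.derivative / a R₃ - a R₄.derivative / a R₄

/-- Family II: `ψ(ħ², y) = α y` with `α ≠ 0` and
`y(ħ², z) = R₁(z) / R₂(z) + 𝒮(ħ z ∂_z)⁻¹ log (R₃(z) / R₄(z))` for polynomials `Rᵢ`, where
`ψ(y)` and `y(z)` (at `ħ = 0`) are nonzero and vanish at zero, and no singular point of `y` on the
Riemann sphere is mapped by `x = log z - ψ(y(z))` to a branch point, that is, to the value of `x`
at a zero of `dx = (1 / z - α y'(z)) dz`. -/
def IsFamilyII (ψ y : ℂ⟦X⟧⟦X⟧) : Prop :=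
  ∃ (α : ℂ) (R₁ R₂ R₃ R₄ : Polynomial ℂ) (L : ℂ⟦X⟧),
    α ≠ 0 ∧ R₂.eval 0 ≠ 0 ∧ R₃.eval 0 ≠ 0 ∧ R₄.eval 0 ≠ 0 ∧
    IsLogQuotient R₃ R₄ L ∧
    ψ = PowerSeries.C (PowerSeries.C α) * PowerSeries.X ∧
    y = PowerSeries.map PowerSeries.C ((R₁ : ℂ⟦X⟧) * (R₂ : ℂ⟦X⟧)⁻¹) + invS L ∧
    atZero ψ ≠ 0 ∧ PowerSeries.constantCoeff (atZero ψ) = 0 ∧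
    atZero y ≠ 0 ∧ PowerSeries.constantCoeff (atZero y) = 0 ∧
    ∀ P Q : OnePoint ℂ,
      IsZero (1 / RatFunc.X - RatFunc.C α * rationalDeriv R₁ R₂ R₃ R₄) P →
      IsPole (rationalDeriv R₁ R₂ R₃ R₄) Q →
      ¬ SameValue (1 / RatFunc.X - RatFunc.C α * rationalDeriv R₁ R₂ R₃ R₄) P Q

/-! ### The data of the formula -/

/-- `ψ(ħ², y) = y / w`. -/
def psiDatum (w : ℂ) : ℂ⟦X⟧⟦X⟧ := PowerSeries.C (PowerSeries.C (1 / w)) * PowerSeries.X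

/-- `y(ħ², z) = ∑_{k ≥ 1} (β w z) ^ k / (k 𝒮(ħ k))`. -/
def yDatum (β w : ℂ) : ℂ⟦X⟧⟦X⟧ :=
  PowerSeries.mk fun k => if k = 0 then 0 else
    PowerSeries.C ((β * w) ^ k / (k : ℂ)) * (PowerSeries.rescale (k : ℂ) calS)⁻¹

end MarinoVafa

end

open Filter Topology
open scoped PowerSeries LaurentSeries OnePoint

noncomputable section

namespace MarinoVafa

/-! ### Complete homogeneous functions -/

section CompleteHomogeneous

variable {R : Type*} [CommRing R]

lemma prod_map_mul_pow (x : R) (p : ℕ → R) {n : ℕ} (μ : Nat.Partition n) :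
    (μ.parts.map fun k => x ^ k * p k).prod = x ^ n * (μ.parts.map p).prod := by
  rw [Multiset.prod_map_mul]
  congr 1
  have : ∀ s : Multiset ℕ, (s.map fun k => x ^ k).prod = x ^ s.sum := by
    intro s
    induction s using Multiset.induction_on with
    | empty => simp
    | cons a s ih => simp [ih, pow_add]
  rw [this, μ.parts_sum]

variable [Algebra ℂ R]

lemma completeHomogeneous_natCast (p : ℕ → R) (n : ℕ) :
    completeHomogeneous p (n : ℤ) =
      ∑ μ : Nat.Partition n, ((zNumber μ.parts : ℂ)⁻¹) • (μ.parts.map p).prod := rfl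

lemma completeHomogeneous_of_neg (p : ℕ → R) {k : ℤ} (hk : k < 0) :
    completeHomogeneous p k = 0 := by
  cases k with
  | ofNat n => exact absurd hk (by simp)
  | negSucc n => rfl

/-- The generating series of the complete homogeneous functions. -/
def hGen (p : ℕ → R) : R⟦X⟧ := PowerSeries.mk fun n => completeHomogeneous p (n : ℤ)

/-- `exp (a t ^ i / i)`. -/
def powerExp (i : ℕ) (a : R) : R⟦X⟧ :=
  PowerSeries.mk fun n => if i ∣ n then
    (((i : ℂ) ^ (n / i) * ((n / i).factorial : ℂ))⁻¹) • a ^ (n / i) else 0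

lemma powerExp_add {i : ℕ} (hi : i ≠ 0) (a b : R) :
    powerExp i (a + b) = powerExp i a * powerExp i b := by
  let _ : Algebra ℚ R := Algebra.compHom R (algebraMap ℚ ℂ)
  have key : ∀ c : R, powerExp i c = PowerSeries.subst (PowerSeries.X ^ i : R⟦X⟧)
      (PowerSeries.rescale ((((i : ℂ)⁻¹) • c)) (PowerSeries.exp R)) := by
    intro c
    ext n
    rw [PowerSeries.coeff_subst_X_pow hi]
    simp only [powerExp, PowerSeries.coeff_mk]
    split_ifs with h
    · rw [PowerSeries.coeff_rescale, PowerSeries.coeff_exp]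
      have : algebraMap ℚ R (1 / (n / i).factorial) =
          algebraMap ℂ R (((n / i).factorial : ℂ)⁻¹) := by
        change algebraMap ℂ R (algebraMap ℚ ℂ _) = _
        simp
      simp only [Algebra.algebraMap_self, RingHom.id_apply]
      rw [this, smul_pow, ← Algebra.commutes, ← Algebra.smul_def, smul_smul, mul_inv,
        inv_pow, mul_comm]
    · rfl
  rw [key, key, key, smul_add, ← PowerSeries.exp_mul_exp_eq_exp_add,
    PowerSeries.subst_mul (PowerSeries.HasSubst.X_pow hi)]

lemma zNumber_smul_prod (p : ℕ → R) (m : Multiset ℕ) :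
    ((zNumber m : ℂ)⁻¹) • (m.map p).prod =
      m.toFinsupp.prod fun i j => (((i : ℂ) ^ j * (j.factorial : ℂ))⁻¹) • p i ^ j := by
  rw [Finset.prod_multiset_map_count, zNumber, Finsupp.prod, Multiset.toFinsupp_support,
    Finset.prod_smul]
  rw [Finset.prod_inv_distrib]
  simp

lemma hGen_eq_genFun (p : ℕ → R) :
    hGen p = Nat.Partition.genFun fun i j =>
      (((i : ℂ) ^ j * (j.factorial : ℂ))⁻¹) • p i ^ j := by
  ext n
  simp only [hGen, PowerSeries.coeff_mk, Nat.Partition.coeff_genFun, completeHomogeneous_natCast,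
    zNumber_smul_prod]

open scoped PowerSeries.WithPiTopology in
lemma hasProd_hGen [TopologicalSpace R] [DiscreteTopology R] (p : ℕ → R) :
    HasProd (fun i => powerExp (i + 1) (p (i + 1))) (hGen p) := by
  rw [hGen_eq_genFun]
  have h := Nat.Partition.hasProd_genFun (R := R)
    (fun i j => (((i : ℂ) ^ j * (j.factorial : ℂ))⁻¹) • p i ^ j)
  refine (congrArg (fun F : ℕ → R⟦X⟧ => HasProd F _) (funext fun i => ?_)).mpr h
  ext n
  have hs := (Nat.Partition.summable_genFun_term
    (fun i j => (((i : ℂ) ^ j * (j.factorial : ℂ))⁻¹) • p i ^ j) i).map_tsum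
    (PowerSeries.coeff n) (PowerSeries.WithPiTopology.continuous_coeff _ _)
  rw [map_add]
  refine Eq.trans ?_ (congrArg (fun x => (PowerSeries.coeff n) 1 + x) hs.symm)
  simp only [powerExp, PowerSeries.coeff_mk, map_smul, PowerSeries.coeff_one,
    PowerSeries.coeff_X_pow]
  rcases Nat.eq_zero_or_pos n with rfl | hn
  · have : ∀ j : ℕ, ((0 : ℕ) = (i + 1) * (j + 1)) ↔ False := by
      intro j; simp
    simp [this]
  by_cases h : (i + 1) ∣ n
  · obtain ⟨k, rfl⟩ := h
    have hk : k ≠ 0 := by rintro rfl; simp at hn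
    obtain ⟨k, rfl⟩ := Nat.exists_eq_succ_of_ne_zero hk
    rw [tsum_eq_single k]
    · simp
    · intro j hj
      have : ¬ (i + 1) * (k + 1) = (i + 1) * (j + 1) := by
        intro h
        have := Nat.eq_of_mul_eq_mul_left (by omega) h
        omega
      simp [this]
  · have h' : ∀ j : ℕ, ¬ n = (i + 1) * (j + 1) := by
      rintro j rfl; simp at h
    simp [h, h', hn.ne']

lemma hGen_add (p q : ℕ → R) : hGen (p + q) = hGen p * hGen q := by
  let _ : TopologicalSpace R := ⊥
  have : DiscreteTopology R := ⟨rfl⟩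
  open scoped PowerSeries.WithPiTopology in
  have h := (hasProd_hGen p).mul (hasProd_hGen q)
  have h2 := hasProd_hGen (p + q)
  simp only [Pi.add_apply, powerExp_add (Nat.succ_ne_zero _)] at h2
  exact h2.unique h

lemma hGen_zero : hGen (0 : ℕ → R) = 1 := by
  let _ : TopologicalSpace R := ⊥
  have : DiscreteTopology R := ⟨rfl⟩
  have h2 := hasProd_hGen (0 : ℕ → R)
  have : (fun i : ℕ => powerExp (i + 1) ((0 : ℕ → R) (i + 1))) = fun _ => 1 := by
    funext i
    have h := powerExp_add (R := R) (Nat.succ_ne_zero i) 0 0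
    ext n
    simp only [powerExp, PowerSeries.coeff_mk, PowerSeries.coeff_one, Pi.zero_apply]
    rcases Nat.eq_zero_or_pos n with rfl | hn
    · simp
    · by_cases h : (i + 1) ∣ n
      · obtain ⟨k, rfl⟩ := h
        have hk : k ≠ 0 := by rintro rfl; simp at hn
        simp [hk]
      · simp [h, hn.ne']
  rw [this] at h2
  open scoped PowerSeries.WithPiTopology in
  exact h2.unique hasProd_one

lemma hGen_sum {ι : Type*} (s : Finset ι) (p : ι → ℕ → R) :
    hGen (∑ i ∈ s, p i) = ∏ i ∈ s, hGen (p i) := by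
  classical
  induction s using Finset.induction_on with
  | empty => simp [hGen_zero]
  | insert a s ha ih => rw [Finset.sum_insert ha, Finset.prod_insert ha, hGen_add, ih]

lemma completeHomogeneous_scale (x : R) (p : ℕ → R) (n : ℕ) :
    completeHomogeneous (fun k => x ^ k * p k) (n : ℤ) =
      x ^ n * completeHomogeneous p (n : ℤ) := by
  simp only [completeHomogeneous_natCast, prod_map_mul_pow, Finset.mul_sum, mul_smul_comm]

lemma map_completeHomogeneous {S : Type*} [CommRing S] [Algebra ℂ S] (f : R →ₐ[ℂ] S)
    (p : ℕ → R) (k : ℤ) :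
    f (completeHomogeneous p k) = completeHomogeneous (fun i => f (p i)) k := by
  cases k with
  | ofNat n =>
    simp only [completeHomogeneous, map_sum, map_smul, map_multiset_prod, Multiset.map_map]
    rfl
  | negSucc n => simp [completeHomogeneous]

lemma completeHomogeneous_congr {p q : ℕ → R} (h : ∀ i, 0 < i → p i = q i) (k : ℤ) :
    completeHomogeneous p k = completeHomogeneous q k := by
  cases k with
  | ofNat n =>
    simp only [completeHomogeneous]
    refine Finset.sum_congr rfl fun μ _ => ?_
    rw [Multiset.map_congr rfl fun _ hi => h _ (μ.parts_pos hi)]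
  | negSucc n => rfl

end CompleteHomogeneous

/-! ### Counting permutations by cycle type -/

lemma zNumber_pos {n : ℕ} (μ : Nat.Partition n) : 0 < zNumber μ.parts :=
  Finset.prod_pos fun _ hi =>
    Nat.mul_pos (pow_pos (μ.parts_pos (Multiset.mem_toFinset.1 hi)) _) (Nat.factorial_pos _)

lemma zNumber_eq_prod_mul_autNumber (m : Multiset ℕ) : zNumber m = m.prod * autNumber m := by
  rw [zNumber, autNumber, Finset.prod_mul_distrib, Finset.prod_multiset_count]

lemma autNumber_eq_prod_of_subset {m : Multiset ℕ} {s : Finset ℕ} (h : m.toFinset ⊆ s) :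
    autNumber m = ∏ i ∈ s, (m.count i).factorial := by
  refine Finset.prod_subset h fun i _ hi => ?_
  rw [Multiset.mem_toFinset] at hi
  rw [Multiset.count_eq_zero_of_notMem hi, Nat.factorial_zero]

lemma zNumber_add_replicate_one (m : Multiset ℕ) (hm : ∀ a ∈ m, 2 ≤ a) (k : ℕ) :
    zNumber (m + Multiset.replicate k 1) =
      k.factorial * m.prod * ∏ n ∈ m.toFinset, (m.count n).factorial := by
  have h1 : (1 : ℕ) ∉ m := fun h => absurd (hm 1 h) (by norm_num)
  have h1' : (1 : ℕ) ∉ m.toFinset := by simpa using h1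
  rw [zNumber_eq_prod_mul_autNumber, autNumber_eq_prod_of_subset (s := insert 1 m.toFinset),
    Finset.prod_insert h1']
  · have e : ∀ i ∈ m.toFinset, ((m + Multiset.replicate k 1).count i).factorial =
        (m.count i).factorial := by
      intro i hi
      have : i ≠ 1 := by rintro rfl; exact h1' hi
      simp [Multiset.count_replicate, this.symm]
    rw [Finset.prod_congr rfl e]
    simp [Multiset.count_eq_zero_of_notMem h1]
    ring
  · intro i hi
    simp only [Multiset.mem_toFinset, Multiset.mem_add, Multiset.mem_replicate] at hi
    simp only [Finset.mem_insert, Multiset.mem_toFinset]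
    tauto

section Perm

variable {α : Type*} [Fintype α] [DecidableEq α]

lemma card_partition_eq_mul_zNumber (μ : Nat.Partition (Fintype.card α)) :
    (Finset.univ.filter fun σ : Equiv.Perm α => σ.partition = μ).card * zNumber μ.parts =
      (Fintype.card α).factorial := by
  set m := μ.parts.filter fun n => 2 ≤ n with hm
  have hm2 : ∀ a ∈ m, 2 ≤ a := fun a ha => (Multiset.mem_filter.1 ha).2
  have hμ : μ.parts = m + Multiset.replicate (Fintype.card α - m.sum) 1 := by
    have h2 : μ.parts.filter (fun n => ¬ 2 ≤ n) =
        Multiset.replicate (μ.parts.filter (fun n => ¬ 2 ≤ n)).card 1 := by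
      rw [Multiset.eq_replicate_card]
      intro b hb
      have := Multiset.mem_filter.1 hb
      have := μ.parts_pos this.1
      omega
    have h3 := Multiset.filter_add_not (fun n => 2 ≤ n) μ.parts
    rw [h2, ← hm] at h3
    have h4 := congrArg Multiset.sum h3
    rw [Multiset.sum_add, Multiset.sum_replicate, smul_eq_mul, mul_one, μ.parts_sum] at h4
    have h5 : Fintype.card α - m.sum = (μ.parts.filter (fun n => ¬ 2 ≤ n)).card := by omega
    rw [h5]
    exact h3.symm
  have hle : m.sum ≤ Fintype.card α := by
    have := congrArg Multiset.sum hμ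
    rw [Multiset.sum_add, μ.parts_sum] at this
    omega
  have hset : (Finset.univ.filter fun σ : Equiv.Perm α => σ.partition = μ) =
      Finset.univ.filter fun σ : Equiv.Perm α => σ.cycleType = m := by
    ext σ
    simp only [Finset.mem_filter, Finset.mem_univ, true_and]
    constructor
    · rintro rfl
      exact (Equiv.Perm.filter_parts_partition_eq_cycleType).symm
    · intro h
      apply Nat.Partition.ext
      rw [hμ, Equiv.Perm.parts_partition, ← Equiv.Perm.sum_cycleType, h]
  have h := Equiv.Perm.card_of_cycleType_mul_eq α m
  rw [if_pos ⟨hle, hm2⟩] at h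
  rw [hset, ← h, hμ, zNumber_add_replicate_one m hm2]

/-- Averaging over all permutations amounts to summing over cycle types with weights
`1 / z_μ`. -/
lemma sum_perm_eq_sum_partition {n : ℕ} (hn : Fintype.card α = n) (F : Multiset ℕ → ℂ) :
    ∑ σ : Equiv.Perm α, F σ.partition.parts =
      n.factorial * ∑ μ : Nat.Partition n, (zNumber μ.parts : ℂ)⁻¹ * F μ.parts := by
  subst hn
  rw [Finset.mul_sum, ← Finset.sum_fiberwise (s := Finset.univ)
    (g := fun σ : Equiv.Perm α => σ.partition)]
  refine Finset.sum_congr rfl fun μ _ => ?_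
  rw [Finset.sum_congr rfl (g := fun _ => F μ.parts), Finset.sum_const,
    ← card_partition_eq_mul_zNumber μ]
  · have h0 : (zNumber μ.parts : ℂ) ≠ 0 := by exact_mod_cast (zNumber_pos μ).ne'
    rw [nsmul_eq_mul, Nat.cast_mul, mul_assoc, mul_inv_cancel_left₀ h0]
  · intro σ hσ
    rw [(Finset.mem_filter.1 hσ).2]

lemma prod_parts_partition (σ : Equiv.Perm α) {M : Type*} [CommMonoid M] (g : ℕ → M) :
    (σ.partition.parts.map g).prod =
      (∏ c ∈ σ.cycleFactorsFinset, g c.support.card) *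
        ∏ _a ∈ Finset.univ.filter (fun a => σ a = a), g 1 := by
  rw [Equiv.Perm.parts_partition, Multiset.map_add, Multiset.prod_add, Equiv.Perm.cycleType_def]
  congr 1
  · rw [Multiset.map_map]
    rfl
  · have : (Finset.univ.filter fun a => σ a = a) = σ.supportᶜ := by
      ext a; simp
    rw [Multiset.map_replicate, Multiset.prod_replicate, Finset.prod_const, this,
      Finset.card_compl]

lemma prod_quotient_eq_prod_parts (σ : Equiv.Perm α)
    [Fintype (Quotient (Equiv.Perm.SameCycle.setoid σ))]
    [DecidableEq (Quotient (Equiv.Perm.SameCycle.setoid σ))]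
    {M : Type*} [CommMonoid M] (g : ℕ → M) :
    ∏ q : Quotient (Equiv.Perm.SameCycle.setoid σ),
        g (Finset.univ.filter fun a => (Quotient.mk _ a) = q).card =
      (σ.partition.parts.map g).prod := by
  classical
  rw [prod_parts_partition, ← Finset.prod_filter_mul_prod_filter_not Finset.univ
    (fun q : Quotient (Equiv.Perm.SameCycle.setoid σ) => ∃ a, Quotient.mk _ a = q ∧ σ a ≠ a)]
  congr 1
  · refine Finset.prod_nbij (Quotient.lift σ.cycleOf fun a b h => Equiv.Perm.SameCycle.cycleOf_eq h)
      ?_ ?_ ?_ ?_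
    · intro q hq
      obtain ⟨a, rfl, ha⟩ := (Finset.mem_filter.1 hq).2
      exact Equiv.Perm.cycleOf_mem_cycleFactorsFinset_iff.2 (Equiv.Perm.mem_support.2 ha)
    · intro q hq q' hq' h
      obtain ⟨a, rfl, ha⟩ := (Finset.mem_filter.1 hq).2
      obtain ⟨b, rfl, hb⟩ := (Finset.mem_filter.1 hq').2
      apply Quotient.sound
      change σ.cycleOf a = σ.cycleOf b at h
      have : b ∈ (σ.cycleOf b).support :=
        (Equiv.Perm.mem_support_cycleOf_iff).2 ⟨.refl _ _, Equiv.Perm.mem_support.2 hb⟩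
      rw [← h] at this
      exact ((Equiv.Perm.mem_support_cycleOf_iff).1 this).1
    · intro c hc
      have hc' := (Equiv.Perm.mem_cycleFactorsFinset_iff.1 hc).1
      obtain ⟨a, ha, -⟩ := hc'
      have ha' : a ∈ c.support := Equiv.Perm.mem_support.2 ha
      refine ⟨Quotient.mk _ a, ?_, ?_⟩
      · simp only [Finset.coe_filter, Finset.mem_univ, true_and, Set.mem_ofPred_eq]
        exact ⟨a, rfl, Equiv.Perm.mem_support.1
          (Equiv.Perm.mem_cycleFactorsFinset_support_le hc ha')⟩
      · exact (Equiv.Perm.cycle_is_cycleOf ha' hc).symm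
    · intro q hq
      obtain ⟨a, rfl, ha⟩ := (Finset.mem_filter.1 hq).2
      congr 2
      ext b
      simp only [Finset.mem_filter, Finset.mem_univ, true_and]
      change _ ↔ b ∈ (σ.cycleOf a).support
      rw [Equiv.Perm.mem_support_cycleOf_iff, Quotient.eq]
      exact ⟨fun h => ⟨h.symm, Equiv.Perm.mem_support.2 ha⟩, fun h => h.1.symm⟩
  · refine (Finset.prod_nbij (fun a => Quotient.mk _ a) ?_ ?_ ?_ ?_).symm
    · intro a ha
      simp only [Finset.mem_filter, Finset.mem_univ, true_and] at ha ⊢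
      rintro ⟨b, hb, hb'⟩
      have hs : σ.SameCycle b a := Quotient.exact hb
      exact hb' ((hs.apply_eq_self_iff).2 ha)
    · intro a ha b hb h
      simp only [Finset.coe_filter, Finset.mem_univ, true_and, Set.mem_ofPred_eq] at ha hb
      exact (Equiv.Perm.SameCycle.eq_of_left (Quotient.exact h) ha)
    · intro q hq
      simp only [Finset.coe_filter, Finset.mem_univ, true_and, Set.mem_ofPred_eq] at hq
      obtain ⟨a, rfl⟩ := Quotient.exists_rep q
      exact ⟨a, by simpa using not_not.1 fun h => hq ⟨a, rfl, h⟩, rfl⟩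
    · intro a ha
      simp only [Finset.mem_filter, Finset.mem_univ, true_and] at ha
      have : (Finset.univ.filter fun b => (Quotient.mk (Equiv.Perm.SameCycle.setoid σ) b) =
          Quotient.mk _ a) = {a} := by
        ext b
        simp only [Finset.mem_filter, Finset.mem_univ, true_and, Finset.mem_singleton]
        exact ⟨fun h => Equiv.Perm.SameCycle.eq_of_right (Quotient.exact h) ha, fun h => by rw [h]⟩
      rw [this, Finset.card_singleton]

/-- A product of power sums over the cycles of a permutation is the sum of the monomials of all
colorings that the permutation leaves invariant. -/
lemma prod_powerSum_partition {ι R : Type*} [Fintype ι] [DecidableEq ι] [CommRing R]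
    (x : ι → R) (σ : Equiv.Perm α) :
    (σ.partition.parts.map fun k => ∑ i, x i ^ k).prod =
      ∑ f : α → ι with f ∘ σ = f, ∏ a, x (f a) := by
  classical
  let Q := Quotient (Equiv.Perm.SameCycle.setoid σ)
  have hcomp : ∀ (f : α → ι), f ∘ σ = f → ∀ a b, σ.SameCycle a b → f a = f b := by
    rintro f hf a b ⟨i, rfl⟩
    have h1 : ∀ c, f (σ c) = f c := fun c => congrFun hf c
    have h2 : ∀ n : ℕ, ∀ c, f ((σ ^ n) c) = f c := by
      intro n
      induction n with
      | zero => simp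
      | succ n ih => intro c; rw [pow_succ', Equiv.Perm.mul_apply, h1, ih]
    obtain ⟨n, hn⟩ | ⟨n, hn⟩ : (∃ n : ℕ, i = n) ∨ ∃ n : ℕ, i = -n := by
      rcases Int.eq_nat_or_neg i with ⟨n, h | h⟩
      · exact .inl ⟨n, h⟩
      · exact .inr ⟨n, h⟩
    · subst hn; rw [zpow_natCast, h2]
    · subst hn
      rw [← h2 n ((σ ^ (-(n : ℤ))) a), ← Equiv.Perm.mul_apply]
      simp
  rw [← prod_quotient_eq_prod_parts σ, Finset.prod_univ_sum, Fintype.piFinset_univ]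
  refine Finset.sum_bij' (fun (g : Q → ι) _ => fun a => g (Quotient.mk _ a))
    (fun f _ => fun q => f q.out) ?_ ?_ ?_ ?_ ?_
  · intro g _
    simp only [Finset.mem_filter, Finset.mem_univ, true_and]
    funext a
    have : (Quotient.mk (Equiv.Perm.SameCycle.setoid σ) (σ a)) = Quotient.mk _ a :=
      Quotient.sound (Equiv.Perm.sameCycle_apply_left.2 (Equiv.Perm.SameCycle.refl _ _))
    simp only [Function.comp_apply, this]
  · intro f _; simp
  · intro g _
    funext q
    simp
  · intro f hf
    funext a
    have h : σ.SameCycle _ a :=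
      Quotient.exact (Quotient.out_eq (Quotient.mk (Equiv.Perm.SameCycle.setoid σ) a))
    exact hcomp f (Finset.mem_filter.1 hf).2 _ _ h
  · intro g _
    rw [← Finset.prod_fiberwise (s := Finset.univ)
      (g := fun a => Quotient.mk (Equiv.Perm.SameCycle.setoid σ) a)]
    refine Finset.prod_congr rfl fun q _ => ?_
    rw [Finset.prod_congr rfl (g := fun _ => x (g q)), Finset.prod_const]
    intro a ha
    exact congrArg (fun q => x (g q)) (Finset.mem_filter.1 ha).2

end Perm

lemma completeHomogeneous_pow {R : Type*} [CommRing R] [Algebra ℂ R] (x : R) (n : ℕ) :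
    completeHomogeneous (fun k => x ^ k) (n : ℤ) = x ^ n := by
  have h := completeHomogeneous_scale x (fun _ => 1) n
  simp only [mul_one] at h
  rw [h, completeHomogeneous_natCast]
  have h2 := sum_perm_eq_sum_partition (Fintype.card_fin n) (fun _ => 1)
  simp only [Finset.sum_const, Finset.card_univ, Fintype.card_perm, Fintype.card_fin, nsmul_eq_mul,
    mul_one] at h2
  have h3 : ∑ μ : Nat.Partition n, (zNumber μ.parts : ℂ)⁻¹ = 1 := by
    have h0 : ((n.factorial : ℕ) : ℂ) ≠ 0 := by exact_mod_cast n.factorial_ne_zero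
    exact (mul_right_cancel₀ h0 (by rw [one_mul, mul_comm]; exact h2)).symm
  simp only [Multiset.map_const', Multiset.prod_replicate, one_pow]
  rw [← Finset.sum_smul, h3, one_smul, mul_one]

/-! ### Traces in the group algebra -/

section TraceForm

variable {A : Type*} [Ring A] [Algebra ℂ A]

/-- The trace of `x ↦ u * x * v`. -/
def traceForm (u v : A) : ℂ :=
  LinearMap.trace ℂ A (LinearMap.mulLeft ℂ u * LinearMap.mulRight ℂ v)

/-- The trace form as a bilinear map. -/
def traceFormₗ : A →ₗ[ℂ] A →ₗ[ℂ] ℂ :=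
  LinearMap.mk₂ ℂ traceForm
    (fun u u' v => by
      have : LinearMap.mulLeft ℂ (u + u') = LinearMap.mulLeft ℂ u + LinearMap.mulLeft ℂ u' := by
        ext x; simp [add_mul]
      rw [traceForm, this, add_mul, map_add]; rfl)
    (fun a u v => by
      have : LinearMap.mulLeft ℂ (a • u) = a • LinearMap.mulLeft ℂ u := by
        ext x; simp
      rw [traceForm, this, smul_mul_assoc, map_smul]; rfl)
    (fun u v v' => by
      have : LinearMap.mulRight ℂ (v + v') = LinearMap.mulRight ℂ v + LinearMap.mulRight ℂ v' := by
        ext x; simp [mul_add]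
      rw [traceForm, this, mul_add, map_add]; rfl)
    (fun a u v => by
      have : LinearMap.mulRight ℂ (a • v) = a • LinearMap.mulRight ℂ v := by
        ext x; simp
      rw [traceForm, this, mul_smul_comm, map_smul]; rfl)

lemma traceFormₗ_apply (u v : A) : traceFormₗ u v = traceForm u v := rfl

lemma traceForm_mul_comm_left (u u' v : A) : traceForm (u * u') v = traceForm (u' * u) v := by
  have e : ∀ a b : A, LinearMap.mulLeft ℂ (a * b) * LinearMap.mulRight ℂ v =
      LinearMap.mulLeft ℂ a * (LinearMap.mulLeft ℂ b * LinearMap.mulRight ℂ v) := by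
    intro a b; ext x; simp
  have e' : (LinearMap.mulLeft ℂ u' * LinearMap.mulRight ℂ v) * LinearMap.mulLeft ℂ u =
      LinearMap.mulLeft ℂ u' * (LinearMap.mulLeft ℂ u * LinearMap.mulRight ℂ v) := by
    ext x; simp [mul_assoc]
  rw [traceForm, traceForm, e, e, LinearMap.trace_mul_comm, e']

lemma traceForm_map {B : Type*} [Ring B] [Algebra ℂ B] (φ : A ≃ₐ[ℂ] B) (u v : A) :
    traceForm (φ u) (φ v) = traceForm u v := by
  rw [traceForm, traceForm, ← LinearMap.trace_conj' _ φ.toLinearEquiv]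
  congr 1
  ext x
  simp [LinearEquiv.conj_apply]

lemma traceForm_eq_zero {u v : A} (h : ∀ x, u * x * v = 0) : traceForm u v = 0 := by
  have : LinearMap.mulLeft ℂ u * LinearMap.mulRight ℂ v = 0 := by
    ext x; simpa [mul_assoc] using h x
  rw [traceForm, this, map_zero]

lemma traceForm_of_rank_one [Module.Finite ℂ A] {u v w : A} {t : A →ₗ[ℂ] ℂ}
    (h : ∀ x, u * x * v = t x • w) : traceForm u v = t w := by
  have : LinearMap.mulLeft ℂ u * LinearMap.mulRight ℂ v = t.smulRight w := by
    ext x; simpa [mul_assoc] using h x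
  rw [traceForm, this]
  simp

/-- The character of the left ideal generated by a quasi-idempotent. -/
lemma trace_lsmul_span [Module.Finite ℂ A] {c : A} {κ : ℂ} (hκ : κ ≠ 0) (hc : c * c = κ • c)
    (u : A) :
    LinearMap.trace ℂ (Ideal.span {c} : Ideal A) (Algebra.lsmul ℂ ℂ (Ideal.span {c} : Ideal A) u) =
      κ⁻¹ * traceForm u c := by
  let I : Ideal A := Ideal.span {c}
  let i : I →ₗ[ℂ] A := (Submodule.subtype I).restrictScalars ℂ
  let π : A →ₗ[ℂ] I := κ⁻¹ •
    { toFun := fun x => ⟨x * c, Ideal.mem_span_singleton'.2 ⟨x, rfl⟩⟩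
      map_add' := fun x y => Subtype.ext (add_mul x y c)
      map_smul' := fun a x => Subtype.ext (smul_mul_assoc a x c) }
  have hπ : ∀ x, ((π x : I) : A) = κ⁻¹ • (x * c) := fun x => rfl
  have h1 : (Algebra.lsmul ℂ ℂ I u : I →ₗ[ℂ] I) = π ∘ₗ (LinearMap.mulLeft ℂ u ∘ₗ i) := by
    ext y
    obtain ⟨z, hz⟩ := Ideal.mem_span_singleton'.1 y.2
    change u * (y : A) = κ⁻¹ • (u * (y : A) * c)
    rw [← hz, mul_assoc u, mul_assoc z, hc, mul_smul_comm, mul_smul_comm, smul_smul,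
      inv_mul_cancel₀ hκ, one_smul]
  have : Module.Finite ℂ I := Module.Finite.of_injective i Subtype.val_injective
  change LinearMap.trace ℂ I (Algebra.lsmul ℂ ℂ I u) = _
  rw [h1, LinearMap.trace_comp_comm', traceForm, ← smul_eq_mul, ← map_smul]
  congr 1
  ext x
  change u * (κ⁻¹ • (x * c)) = κ⁻¹ • (u * (x * c))
  rw [mul_smul_comm]

end TraceForm

section GroupAlgebra

variable {G : Type*} [Group G]

lemma traceForm_conj (σ τ : G) (v : MonoidAlgebra ℂ G) :
    traceForm (MonoidAlgebra.of ℂ G (τ * σ * τ⁻¹)) v = traceForm (MonoidAlgebra.of ℂ G σ) v := by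
  rw [map_mul, traceForm_mul_comm_left, ← map_mul]
  congr 2
  group

lemma monoidAlgebra_hom_ext {M : Type*} [AddCommMonoid M] [Module ℂ M]
    {f g : MonoidAlgebra ℂ G →ₗ[ℂ] M}
    (h : ∀ σ, f (MonoidAlgebra.of ℂ G σ) = g (MonoidAlgebra.of ℂ G σ)) : f = g :=
  (MonoidAlgebra.basis G ℂ).ext fun σ => by
    simpa [MonoidAlgebra.basis_apply] using h σ

variable [Fintype G]

instance : Module.Finite ℂ (MonoidAlgebra ℂ G) :=
  Module.Finite.of_basis (MonoidAlgebra.basis G ℂ)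

lemma trace_monoidAlgebra (f : MonoidAlgebra ℂ G →ₗ[ℂ] MonoidAlgebra ℂ G) :
    LinearMap.trace ℂ _ f = ∑ τ : G, (f (MonoidAlgebra.of ℂ G τ)).coeff τ := by
  classical
  rw [LinearMap.trace_eq_matrix_trace ℂ (MonoidAlgebra.basis G ℂ), Matrix.trace]
  refine Finset.sum_congr rfl fun τ _ => ?_
  rw [Matrix.diag_apply, LinearMap.toMatrix_apply, MonoidAlgebra.basis_apply]
  rfl

open Classical in
lemma traceForm_of_of (σ ρ : G) :
    traceForm (MonoidAlgebra.of ℂ G σ) (MonoidAlgebra.of ℂ G ρ) =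
      ∑ τ : G, if σ * τ * ρ = τ then 1 else 0 := by
  rw [traceForm, trace_monoidAlgebra]
  refine Finset.sum_congr rfl fun τ _ => ?_
  have : (LinearMap.mulLeft ℂ (MonoidAlgebra.of ℂ G σ) * LinearMap.mulRight ℂ
      (MonoidAlgebra.of ℂ G ρ)) (MonoidAlgebra.of ℂ G τ) =
      MonoidAlgebra.of ℂ G (σ * τ * ρ) := by
    simp [mul_assoc]
  rw [this, MonoidAlgebra.of_apply, MonoidAlgebra.coeff_single, Finsupp.single_apply]

lemma traceForm_comm (u v : MonoidAlgebra ℂ G) : traceForm u v = traceForm v u := by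
  classical
  have : (traceFormₗ : MonoidAlgebra ℂ G →ₗ[ℂ] _) = traceFormₗ.flip := by
    refine monoidAlgebra_hom_ext fun σ => monoidAlgebra_hom_ext fun ρ => ?_
    rw [LinearMap.flip_apply, traceFormₗ_apply, traceFormₗ_apply, traceForm_of_of,
      traceForm_of_of]
    refine Fintype.sum_equiv (Equiv.inv G) _ _ fun τ => ?_
    refine if_congr ⟨fun h => ?_, fun h => ?_⟩ rfl rfl
    · have : ρ = τ⁻¹ * σ⁻¹ * τ := by rw [← mul_right_inj (σ * τ), h]; group
      rw [this]; simp only [Equiv.inv_apply]; group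
    · simp only [Equiv.inv_apply] at h
      have : σ = τ * ρ⁻¹ * τ⁻¹ := by rw [← mul_right_inj (ρ * τ⁻¹), h]; group
      rw [this]; group
  exact congrArg (fun B => B u v) this

lemma traceForm_one (v : MonoidAlgebra ℂ G) :
    traceForm 1 v = Fintype.card G * v.coeff 1 := by
  classical
  have : (traceFormₗ 1 : MonoidAlgebra ℂ G →ₗ[ℂ] ℂ) = (Fintype.card G : ℂ) •
      (Finsupp.lapply 1 ∘ₗ (MonoidAlgebra.basis G ℂ).repr.toLinearMap) := by
    refine monoidAlgebra_hom_ext fun ρ => ?_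
    rw [traceFormₗ_apply, ← map_one (MonoidAlgebra.of ℂ G), traceForm_of_of]
    simp only [one_mul, mul_eq_left, Finset.sum_const, Finset.card_univ, nsmul_eq_mul]
    change _ = (Fintype.card G : ℂ) * (MonoidAlgebra.of ℂ G ρ).coeff 1
    rw [MonoidAlgebra.of_apply, MonoidAlgebra.coeff_single, Finsupp.single_apply]
  exact congrArg (fun f => f v) this

lemma sum_traceForm_mul_traceForm (u v : MonoidAlgebra ℂ G) :
    ∑ σ : G, traceForm (MonoidAlgebra.of ℂ G σ) u * traceForm (MonoidAlgebra.of ℂ G σ⁻¹) v =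
      Fintype.card G * traceForm v u := by
  classical
  have : (∑ σ : G, traceForm (MonoidAlgebra.of ℂ G σ) u •
        (traceFormₗ (MonoidAlgebra.of ℂ G σ⁻¹)) : MonoidAlgebra ℂ G →ₗ[ℂ] ℂ) =
      (Fintype.card G : ℂ) • traceFormₗ.flip u := by
    refine monoidAlgebra_hom_ext fun ρ => ?_
    simp only [LinearMap.sum_apply, LinearMap.smul_apply, traceFormₗ_apply, LinearMap.flip_apply,
      traceForm_of_of, smul_eq_mul, Finset.mul_sum, mul_ite, mul_one, mul_zero]
    rw [Finset.sum_comm, Finset.sum_congr rfl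
      (g := fun _ => traceForm (MonoidAlgebra.of ℂ G ρ) u)]
    · rw [Finset.sum_const, Finset.card_univ, nsmul_eq_mul]
    · intro τ _
      have e : ∀ σ : G, σ⁻¹ * τ * ρ = τ ↔ τ * ρ * τ⁻¹ = σ := by
        intro σ
        rw [mul_assoc, inv_mul_eq_iff_eq_mul, mul_inv_eq_iff_eq_mul]
      simp only [e, Finset.sum_ite_eq, Finset.mem_univ, if_true, traceForm_conj]
  have h := congrArg (fun f => f v) this
  simpa [traceFormₗ_apply] using h

end GroupAlgebra

/-! ### Young symmetrizers -/

section Symmetrizer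

variable {α : Type*}

lemma comp_swap_eq [DecidableEq α] {K : Type*} {f : α → K} {x y : α}
    (h : f x = f y) : f ∘ Equiv.swap x y = f := by
  funext z
  simp only [Function.comp_apply, Equiv.swap_apply_def]
  split_ifs with h1 h2
  · rw [h1, h]
  · rw [h2, h]
  · rfl

lemma eq_zero_of_eq_neg {M : Type*} [AddCommGroup M] [Module ℂ M] {v : M} (h : v = -v) : v = 0 := by
  have h2 : (2 : ℂ) • v = 0 := by
    rw [two_smul]
    nth_rewrite 2 [h]
    exact add_neg_cancel v
  exact (smul_eq_zero.1 h2).resolve_left two_ne_zero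

/-- `r` and `c` are the row and column functions of a bijection with the cells of a diagram. -/
structure IsTableau (r c : α → ℕ) : Prop where
  inj : ∀ x y, r x = r y → c x = c y → x = y
  lower : ∀ x i j, i ≤ r x → j ≤ c x → ∃ y, r y = i ∧ c y = j

variable {r c : α → ℕ}

lemma IsTableau.swap (h : IsTableau r c) : IsTableau c r :=
  ⟨fun x y h1 h2 => h.inj x y h2 h1, fun x i j hi hj =>
    let ⟨y, h1, h2⟩ := h.lower x j i hj hi; ⟨y, h2, h1⟩⟩

variable [Fintype α]

lemma IsTableau.card_fiber_le (h : IsTableau r c) {f : α → ℕ}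
    (hf : ∀ x y, c x = c y → f x = f y → x = y) (j k : ℕ) :
    (Finset.univ.filter fun x => c x = j ∧ f x < k).card ≤
      (Finset.univ.filter fun x => c x = j ∧ r x < k).card := by
  by_cases hk : ∀ x, c x = j → r x < k
  · refine Finset.card_le_card fun x hx => ?_
    simp only [Finset.mem_filter, Finset.mem_univ, true_and] at hx ⊢
    exact ⟨hx.1, hk x hx.1⟩
  · push Not at hk
    obtain ⟨x₀, hx₀, hk⟩ := hk
    calc _ ≤ (Finset.range k).card := by
          refine Finset.card_le_card_of_injOn f ?_ ?_
          · intro x hx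
            simp only [Finset.coe_filter, Finset.mem_univ, true_and, Set.mem_ofPred_eq] at hx
            simpa using hx.2
          · intro x hx y hy hxy
            simp only [Finset.coe_filter, Finset.mem_univ, true_and, Set.mem_ofPred_eq] at hx hy
            exact hf x y (hx.1.trans hy.1.symm) hxy
      _ ≤ ((Finset.univ.filter fun x => c x = j ∧ r x < k).image r).card := by
          refine Finset.card_le_card fun i hi => ?_
          rw [Finset.mem_range] at hi
          obtain ⟨y, h1, h2⟩ := h.lower x₀ i j (by omega) hx₀.ge
          exact Finset.mem_image.2 ⟨y, by simp [h1, h2, hi], h1⟩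
      _ ≤ _ := Finset.card_image_le

lemma card_filter_lt_eq_sum (c f : α → ℕ) (k : ℕ) :
    (Finset.univ.filter fun x => f x < k).card =
      ∑ j ∈ Finset.univ.image c, (Finset.univ.filter fun x => c x = j ∧ f x < k).card := by
  rw [Finset.card_eq_sum_card_fiberwise (f := c) (t := Finset.univ.image c)]
  · refine Finset.sum_congr rfl fun j _ => ?_
    rw [Finset.filter_filter]
    simp only [and_comm]
  · intro x _
    simp

lemma IsTableau.card_le (h : IsTableau r c) {f : α → ℕ}
    (hf : ∀ x y, c x = c y → f x = f y → x = y) (k : ℕ) :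
    (Finset.univ.filter fun x => f x < k).card ≤ (Finset.univ.filter fun x => r x < k).card := by
  rw [card_filter_lt_eq_sum c, card_filter_lt_eq_sum c]
  exact Finset.sum_le_sum fun j _ => h.card_fiber_le hf j k

lemma card_filter_comp_perm (τ : Equiv.Perm α) (P : α → Prop) [DecidablePred P] :
    (Finset.univ.filter fun x => P (τ x)).card = (Finset.univ.filter P).card :=
  Finset.card_equiv τ (by simp)

/-- A permutation that does not map two cells of one column into one row is a product of a
row-preserving and a column-preserving permutation. -/
lemma IsTableau.exists_mul (h : IsTableau r c) {τ : Equiv.Perm α}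
    (hτ : ∀ x y, r x = r y → c (τ⁻¹ x) = c (τ⁻¹ y) → x = y) :
    ∃ p q : Equiv.Perm α, r ∘ p = r ∧ c ∘ q = c ∧ τ = p * q := by
  have key : ∀ x, ∃ y, r y = r x ∧ c y = c (τ⁻¹ x) := by
    intro x
    by_contra hcon
    push Not at hcon
    set k := c (τ⁻¹ x) with hkdef
    have hlt : ∀ y, r y = r x → c y < k := by
      intro y hy
      by_contra hle
      obtain ⟨z, h1, h2⟩ := h.lower y (r x) k hy.ge (by omega)
      exact hcon z h1 h2
    have h1 := card_filter_comp_perm τ⁻¹ (fun x => c x < k)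
    rw [card_filter_lt_eq_sum r (fun x => c (τ⁻¹ x)), card_filter_lt_eq_sum r c] at h1
    have h2 := (Finset.sum_eq_sum_iff_of_le
      (fun i _ => h.swap.card_fiber_le (f := fun x => c (τ⁻¹ x)) hτ i k)).1 h1 (r x) (by simp)
    have h3 : (Finset.univ.filter fun y => r y = r x ∧ c (τ⁻¹ y) < k) ⊆
        Finset.univ.filter fun y => r y = r x ∧ c y < k := by
      intro y hy
      simp only [Finset.mem_filter, Finset.mem_univ, true_and] at hy ⊢
      exact ⟨hy.1, hlt y hy.1⟩
    have h4 := Finset.eq_of_subset_of_card_le h3 h2.ge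
    have h5 : x ∈ Finset.univ.filter fun y => r y = r x ∧ c y < k := by
      simp [hlt x rfl]
    rw [← h4] at h5
    simp only [Finset.mem_filter, Finset.mem_univ, true_and] at h5
    exact absurd h5 (lt_irrefl _)
  choose P hP1 hP2 using key
  have hinj : Function.Injective P := by
    intro x y hxy
    refine hτ x y ?_ ?_
    · rw [← hP1 x, ← hP1 y, hxy]
    · rw [← hP2 x, ← hP2 y, hxy]
  let p : Equiv.Perm α := Equiv.ofBijective P (Finite.injective_iff_bijective.1 hinj)
  have hp1 : ∀ x, r (p x) = r x := hP1
  have hp2 : ∀ x, c (p x) = c (τ⁻¹ x) := hP2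
  refine ⟨p⁻¹, p * τ, ?_, ?_, by group⟩
  · funext x
    simpa using (hp1 (p⁻¹ x)).symm
  · funext x
    simpa using hp2 (τ x)

variable [DecidableEq α] {K L : Type*}

/-- The permutation `σ` as an element of the group algebra. -/
abbrev permOf (σ : Equiv.Perm α) : MonoidAlgebra ℂ (Equiv.Perm α) := MonoidAlgebra.of ℂ _ σ

open Classical in
/-- The sum of all permutations that preserve `f`. -/
def rowSum (f : α → K) : MonoidAlgebra ℂ (Equiv.Perm α) :=
  ∑ σ ∈ Finset.univ.filter (fun σ : Equiv.Perm α => f ∘ σ = f), permOf σ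

open Classical in
/-- The signed sum of all permutations that preserve `g`. -/
def colSum (g : α → K) : MonoidAlgebra ℂ (Equiv.Perm α) :=
  ∑ σ ∈ Finset.univ.filter (fun σ : Equiv.Perm α => g ∘ σ = g),
    ((Equiv.Perm.sign σ : ℤ) : ℂ) • permOf σ

lemma permOf_mul_rowSum (f : α → K) (τ : Equiv.Perm α) :
    permOf τ * rowSum (f ∘ τ) = rowSum f * permOf τ := by
  classical
  rw [rowSum, rowSum, Finset.mul_sum, Finset.sum_mul]
  refine Finset.sum_bij' (fun σ _ => τ * σ * τ⁻¹) (fun σ _ => τ⁻¹ * σ * τ) ?_ ?_ ?_ ?_ ?_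
  · intro σ hσ
    simp only [Finset.mem_filter, Finset.mem_univ, true_and] at hσ ⊢
    funext x
    simpa using congrFun hσ (τ⁻¹ x)
  · intro σ hσ
    simp only [Finset.mem_filter, Finset.mem_univ, true_and] at hσ ⊢
    funext x
    simpa using congrFun hσ (τ x)
  · intro σ _; group
  · intro σ _; group
  · intro σ _
    rw [← map_mul, ← map_mul]
    congr 1
    group

lemma permOf_mul_colSum (g : α → K) (τ : Equiv.Perm α) :
    permOf τ * colSum (g ∘ τ) = colSum g * permOf τ := by
  classical
  rw [colSum, colSum, Finset.mul_sum, Finset.sum_mul]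
  refine Finset.sum_bij' (fun σ _ => τ * σ * τ⁻¹) (fun σ _ => τ⁻¹ * σ * τ) ?_ ?_ ?_ ?_ ?_
  · intro σ hσ
    simp only [Finset.mem_filter, Finset.mem_univ, true_and] at hσ ⊢
    funext x
    simpa using congrFun hσ (τ⁻¹ x)
  · intro σ hσ
    simp only [Finset.mem_filter, Finset.mem_univ, true_and] at hσ ⊢
    funext x
    simpa using congrFun hσ (τ x)
  · intro σ _; group
  · intro σ _; group
  · intro σ _
    rw [mul_smul_comm, smul_mul_assoc, ← map_mul, ← map_mul]
    congr 2
    · rcases Int.units_eq_one_or (Equiv.Perm.sign τ) with h | h <;> simp [h]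
    · group

lemma permOf_mul_rowSum_self {f : α → K} {p : Equiv.Perm α} (hp : f ∘ p = f) :
    permOf p * rowSum f = rowSum f := by
  classical
  rw [rowSum, Finset.mul_sum]
  refine Finset.sum_bij' (fun σ _ => p * σ) (fun σ _ => p⁻¹ * σ) ?_ ?_ ?_ ?_ ?_
  · intro σ hσ
    simp only [Finset.mem_filter, Finset.mem_univ, true_and] at hσ ⊢
    rw [Equiv.Perm.coe_mul, ← Function.comp_assoc, hp, hσ]
  · intro σ hσ
    simp only [Finset.mem_filter, Finset.mem_univ, true_and] at hσ ⊢
    have hp' : f ∘ (p⁻¹ : Equiv.Perm α) = f := by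
      funext x; simpa using (congrFun hp (p⁻¹ x)).symm
    rw [Equiv.Perm.coe_mul, ← Function.comp_assoc, hp', hσ]
  · intro σ _; group
  · intro σ _; group
  · intro σ _
    rw [← map_mul]

lemma rowSum_mul_permOf_self {f : α → K} {p : Equiv.Perm α} (hp : f ∘ p = f) :
    rowSum f * permOf p = rowSum f := by
  rw [← permOf_mul_rowSum, hp, permOf_mul_rowSum_self hp]

lemma permOf_mul_colSum_self {g : α → K} {q : Equiv.Perm α} (hq : g ∘ q = g) :
    permOf q * colSum g = ((Equiv.Perm.sign q : ℤ) : ℂ) • colSum g := by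
  classical
  rw [colSum, Finset.mul_sum, Finset.smul_sum]
  refine Finset.sum_bij' (fun σ _ => q * σ) (fun σ _ => q⁻¹ * σ) ?_ ?_ ?_ ?_ ?_
  · intro σ hσ
    simp only [Finset.mem_filter, Finset.mem_univ, true_and] at hσ ⊢
    rw [Equiv.Perm.coe_mul, ← Function.comp_assoc, hq, hσ]
  · intro σ hσ
    simp only [Finset.mem_filter, Finset.mem_univ, true_and] at hσ ⊢
    have hq' : g ∘ (q⁻¹ : Equiv.Perm α) = g := by
      funext x; simpa using (congrFun hq (q⁻¹ x)).symm
    rw [Equiv.Perm.coe_mul, ← Function.comp_assoc, hq', hσ]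
  · intro σ _; group
  · intro σ _; group
  · intro σ _
    rw [mul_smul_comm, ← map_mul, smul_smul]
    congr 1
    rcases Int.units_eq_one_or (Equiv.Perm.sign q) with h | h <;> simp [h]

lemma colSum_mul_permOf_self {g : α → K} {q : Equiv.Perm α} (hq : g ∘ q = g) :
    colSum g * permOf q = ((Equiv.Perm.sign q : ℤ) : ℂ) • colSum g := by
  rw [← permOf_mul_colSum, hq, permOf_mul_colSum_self hq]

lemma colSum_mul_rowSum_eq_zero {g : α → K} {f : α → L} {x y : α} (hxy : x ≠ y)
    (hg : g x = g y) (hf : f x = f y) : colSum g * rowSum f = 0 := by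
  have h1 := colSum_mul_permOf_self (comp_swap_eq hg)
  have h2 := permOf_mul_rowSum_self (comp_swap_eq hf)
  rw [Equiv.Perm.sign_swap hxy] at h1
  have h3 : colSum g * rowSum f = -(colSum g * rowSum f) := by
    conv_lhs => rw [← h2, ← mul_assoc, h1]
    simp
  exact eq_zero_of_eq_neg h3

lemma rowSum_mul_colSum_eq_zero {g : α → K} {f : α → L} {x y : α} (hxy : x ≠ y)
    (hg : g x = g y) (hf : f x = f y) : rowSum f * colSum g = 0 := by
  have h1 := permOf_mul_colSum_self (comp_swap_eq hg)
  have h2 := rowSum_mul_permOf_self (comp_swap_eq hf)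
  rw [Equiv.Perm.sign_swap hxy] at h1
  have h3 : rowSum f * colSum g = -(rowSum f * colSum g) := by
    conv_lhs => rw [← h2, mul_assoc, h1]
    simp
  exact eq_zero_of_eq_neg h3

/-- The number of permutations that preserve `f`. -/
def stabCard (f : α → K) : ℕ := by
  classical exact (Finset.univ.filter fun σ : Equiv.Perm α => f ∘ ⇑σ = f).card

lemma stabCard_ne_zero (f : α → K) : (stabCard f : ℂ) ≠ 0 := by
  classical
  have : 0 < stabCard f := Finset.card_pos.2 ⟨1, by simp⟩
  exact_mod_cast this.ne'

lemma rowSum_mul_rowSum (f : α → K) : rowSum f * rowSum f = (stabCard f : ℂ) • rowSum f := by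
  classical
  conv_lhs => rw [rowSum, Finset.sum_mul]
  rw [Finset.sum_congr rfl (g := fun _ => rowSum f), Finset.sum_const, Nat.cast_smul_eq_nsmul]
  · rfl
  · intro σ hσ
    exact permOf_mul_rowSum_self (Finset.mem_filter.1 hσ).2

/-- The symmetrizers of a coloring and of the columns annihilate each other unless the coloring is
dominated by the rows. -/
lemma IsTableau.colSum_mul_rowSum (h : IsTableau r c) {f : α → ℕ} {k : ℕ}
    (hk : (Finset.univ.filter fun x => r x < k).card < (Finset.univ.filter fun x => f x < k).card)
    (x : MonoidAlgebra ℂ (Equiv.Perm α)) : colSum c * x * rowSum f = 0 := by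
  have : (LinearMap.mulRight ℂ (rowSum f)) ∘ₗ (LinearMap.mulLeft ℂ (colSum c)) = 0 := by
    refine monoidAlgebra_hom_ext fun τ => ?_
    change colSum c * permOf τ * rowSum f = 0
    have e : permOf τ * rowSum f = rowSum (f ∘ ⇑τ⁻¹) * permOf τ := by
      rw [← permOf_mul_rowSum]
      congr 2
      funext x
      simp
    rw [mul_assoc, e, ← mul_assoc]
    suffices h0 : ∃ x y, x ≠ y ∧ c x = c y ∧ (f ∘ ⇑τ⁻¹) x = (f ∘ ⇑τ⁻¹) y by
      obtain ⟨x, y, h1, h2, h3⟩ := h0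
      rw [colSum_mul_rowSum_eq_zero h1 h2 h3, zero_mul]
    by_contra hcon
    push Not at hcon
    have h2 := h.card_le (f := f ∘ ⇑τ⁻¹)
      (fun x y h1 h2 => by_contra fun hne => hcon x y hne h1 h2) k
    have h3 := card_filter_comp_perm τ⁻¹ (fun x => f x < k)
    simp only [Function.comp_apply] at h2
    omega
  exact congrArg (fun f => f x) this

/-- The Young symmetrizer of a tableau. -/
def youngSym (r c : α → ℕ) : MonoidAlgebra ℂ (Equiv.Perm α) := rowSum r * colSum c

lemma IsTableau.exists_smul (h : IsTableau r c) (τ : Equiv.Perm α) :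
    ∃ t : ℂ, rowSum r * permOf τ * colSum c = t • youngSym r c := by
  by_cases hτ : ∀ x y, r x = r y → c (τ⁻¹ x) = c (τ⁻¹ y) → x = y
  · obtain ⟨p, q, hp, hq, rfl⟩ := h.exists_mul hτ
    refine ⟨((Equiv.Perm.sign q : ℤ) : ℂ), ?_⟩
    rw [permOf, map_mul, ← mul_assoc, rowSum_mul_permOf_self hp, mul_assoc,
      permOf_mul_colSum_self hq, mul_smul_comm]
    rfl
  · push Not at hτ
    obtain ⟨x, y, h1, h2, h3⟩ := hτ
    refine ⟨0, ?_⟩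
    have e : permOf τ * colSum c = colSum (c ∘ ⇑τ⁻¹) * permOf τ := by
      rw [← permOf_mul_colSum]
      congr 2
      funext x
      simp
    rw [mul_assoc, e, ← mul_assoc, rowSum_mul_colSum_eq_zero h3 (g := c ∘ ⇑τ⁻¹) h2 h1, zero_mul,
      zero_smul]

lemma IsTableau.exists_functional (h : IsTableau r c) :
    ∃ t : MonoidAlgebra ℂ (Equiv.Perm α) →ₗ[ℂ] ℂ,
      ∀ x, rowSum r * x * colSum c = t x • youngSym r c := by
  choose t ht using h.exists_smul
  refine ⟨(MonoidAlgebra.basis _ ℂ).constr ℂ t, fun x => ?_⟩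
  have : LinearMap.mulRight ℂ (colSum c) ∘ₗ LinearMap.mulLeft ℂ (rowSum r) =
      ((MonoidAlgebra.basis _ ℂ).constr ℂ t).smulRight (youngSym r c) := by
    refine monoidAlgebra_hom_ext fun τ => ?_
    rw [LinearMap.smulRight_apply]
    have e : (MonoidAlgebra.basis (Equiv.Perm α) ℂ).constr ℂ t (MonoidAlgebra.of ℂ _ τ) = t τ := by
      rw [MonoidAlgebra.of_apply, ← MonoidAlgebra.basis_apply, Module.Basis.constr_basis]
    rw [e]
    exact ht τ
  exact congrArg (fun f => f x) this

lemma IsTableau.coeff_youngSym (h : IsTableau r c) : (youngSym r c).coeff 1 = 1 := by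
  classical
  rw [youngSym, rowSum, colSum, Finset.sum_mul_sum, MonoidAlgebra.coeff_sum,
    Finsupp.finsetSum_apply]
  refine (Finset.sum_eq_single 1 ?_ fun h1 => absurd (by simp) h1).trans ?_
  · intro p hp hp1
    rw [MonoidAlgebra.coeff_sum, Finsupp.finsetSum_apply]
    refine Finset.sum_eq_zero fun q hq => ?_
    rw [mul_smul_comm, ← map_mul, MonoidAlgebra.coeff_smul_apply, MonoidAlgebra.of_apply,
      MonoidAlgebra.coeff_single, Finsupp.single_apply, if_neg, smul_zero]
    intro hpq
    apply hp1
    ext x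
    have hp' : r ∘ p = r := by simpa using hp
    have hq' : c ∘ q = c := by simpa using hq
    have e : p = q⁻¹ := eq_inv_of_mul_eq_one_left hpq
    refine h.inj _ _ (congrFun hp' x) ?_
    rw [e]
    simpa using (congrFun hq' (q⁻¹ x)).symm
  · rw [MonoidAlgebra.coeff_sum, Finsupp.finsetSum_apply]
    refine (Finset.sum_eq_single 1 ?_ fun h1 => absurd (by simp) h1).trans ?_
    · intro q _ hq
      rw [mul_smul_comm, ← map_mul, one_mul, MonoidAlgebra.coeff_smul_apply,
        MonoidAlgebra.of_apply, MonoidAlgebra.coeff_single, Finsupp.single_apply, if_neg hq,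
        smul_zero]
    · simp

lemma IsTableau.youngSym_ne_zero (h : IsTableau r c) : youngSym r c ≠ 0 := by
  intro h0
  have := h.coeff_youngSym
  rw [h0] at this
  simp at this

lemma IsTableau.exists_quasi_idempotent (h : IsTableau r c) :
    ∃ κ : ℂ, κ ≠ 0 ∧ youngSym r c * youngSym r c = κ • youngSym r c ∧
      traceForm (rowSum r) (youngSym r c) = stabCard r * κ := by
  obtain ⟨t, ht⟩ := h.exists_functional
  have hsq : youngSym r c * youngSym r c = t (colSum c * rowSum r) • youngSym r c := by
    rw [← ht]
    simp only [youngSym, mul_assoc]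
  refine ⟨t (colSum c * rowSum r), fun h0 => ?_, hsq, ?_⟩
  · rw [h0, zero_smul] at hsq
    have h1 := traceForm_one (youngSym r c)
    have hn : IsNilpotent (LinearMap.mulLeft ℂ (1 : MonoidAlgebra ℂ (Equiv.Perm α)) *
        LinearMap.mulRight ℂ (youngSym r c)) := by
      refine ⟨2, ?_⟩
      refine LinearMap.ext fun x => ?_
      simp [pow_two, mul_assoc, hsq]
    have h2 := (LinearMap.isNilpotent_trace_of_isNilpotent hn).eq_zero
    rw [← traceForm, h1, h.coeff_youngSym, mul_one] at h2
    exact Fintype.card_ne_zero (by exact_mod_cast h2)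
  · have h1 : ∀ x, rowSum r * x * youngSym r c =
        (t ∘ₗ LinearMap.mulRight ℂ (rowSum r)) x • youngSym r c := by
      intro x
      rw [LinearMap.comp_apply, LinearMap.mulRight_apply, ← ht]
      simp only [youngSym, mul_assoc]
    rw [traceForm_of_rank_one h1, LinearMap.comp_apply, LinearMap.mulRight_apply]
    have h2 : t (youngSym r c * rowSum r) • youngSym r c =
        (stabCard r * t (colSum c * rowSum r)) • youngSym r c := by
      rw [← ht, ← smul_smul, ← hsq, ← smul_mul_assoc]
      have : (stabCard r : ℂ) • youngSym r c = rowSum r * youngSym r c := by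
        rw [youngSym, ← mul_assoc, rowSum_mul_rowSum, smul_mul_assoc]
      rw [this]
      simp only [youngSym, mul_assoc]
    exact smul_left_injective ℂ h.youngSym_ne_zero h2

end Symmetrizer

/-! ### Characters of tableaux as functions of the cycle type -/

section Character

variable {α : Type*} [Fintype α]

/-- The exponent of the monomial of a coloring. -/
def weight {ι : Type*} (f : α → ι) : ι →₀ ℕ := ∑ x, Finsupp.single (f x) 1

lemma prod_X_eq_monomial {ι : Type*} (f : α → ι) :
    ∏ x, (MvPolynomial.X (f x) : MvPolynomial ι ℂ) = MvPolynomial.monomial (weight f) 1 := by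
  rw [weight, MvPolynomial.monomial_sum_one]
  rfl

lemma weight_apply {ι : Type*} [DecidableEq ι] (f : α → ι) (i : ι) :
    weight f i = (Finset.univ.filter fun x => f x = i).card := by
  rw [weight, Finsupp.finsetSum_apply, Finset.card_filter]
  simp only [Finsupp.single_apply]

lemma card_filter_lt_eq_sum_weight {N : ℕ} (f : α → Fin N) (k : ℕ) :
    (Finset.univ.filter fun x => (f x : ℕ) < k).card =
      ∑ i ∈ Finset.univ.filter (fun i : Fin N => (i : ℕ) < k), weight f i := by
  rw [Finset.card_eq_sum_card_fiberwise (f := f)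
    (t := Finset.univ.filter fun i : Fin N => (i : ℕ) < k)]
  · refine Finset.sum_congr rfl fun i hi => ?_
    rw [weight_apply, Finset.filter_filter]
    congr 1
    ext x
    simp only [Finset.mem_filter, Finset.mem_univ, true_and] at hi ⊢
    exact ⟨fun h => h.2, fun h => ⟨h ▸ hi, h⟩⟩
  · intro x hx
    simpa using hx

lemma exists_perm_comp_eq {K : Type*} [DecidableEq K] {f g : α → K}
    (h : ∀ i, (Finset.univ.filter fun x => f x = i).card =
      (Finset.univ.filter fun x => g x = i).card) :
    ∃ ρ : Equiv.Perm α, f = g ∘ ρ := by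
  have e : ∀ i, Nonempty ({x // f x = i} ≃ {x // g x = i}) := by
    intro i
    refine ⟨Fintype.equivOfCardEq ?_⟩
    rw [Fintype.card_subtype, Fintype.card_subtype, h]
  replace e := fun i => Classical.choice (e i)
  refine ⟨(Equiv.sigmaFiberEquiv f).symm.trans ((Equiv.sigmaCongrRight e).trans
    (Equiv.sigmaFiberEquiv g)), ?_⟩
  funext x
  exact ((e (f x)) ⟨x, rfl⟩).2.symm

variable [DecidableEq α]

/-- `F` is, as a function of the cycle type, the character of the left ideal generated by the Young
symmetrizer of `(r, c)`, whose square is `κ` times itself. -/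
structure IsCharacter (r c : α → ℕ) (κ : ℂ) (F : Multiset ℕ → ℂ) : Prop where
  tableau : IsTableau r c
  ne_zero : κ ≠ 0
  trace : traceForm (rowSum r) (youngSym r c) = stabCard r * κ
  eq : ∀ σ : Equiv.Perm α, F σ.partition.parts = κ⁻¹ * traceForm (permOf σ) (youngSym r c)

/-- The product of power sums `p_μ` in the variables indexed by `ι`. -/
def powerSumProd (ι : Type*) [Fintype ι] (μ : Multiset ℕ) : MvPolynomial ι ℂ :=
  (μ.map fun k => ∑ i, MvPolynomial.X i ^ k).prod

variable {ι : Type*} [Fintype ι] [DecidableEq ι]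

lemma coeff_powerSumProd (σ : Equiv.Perm α) (a : ι →₀ ℕ) :
    (powerSumProd ι σ.partition.parts).coeff a =
      ∑ f : α → ι with weight f = a, if f ∘ σ = f then 1 else 0 := by
  rw [powerSumProd, prod_powerSum_partition, MvPolynomial.coeff_sum]
  simp only [prod_X_eq_monomial, MvPolynomial.coeff_monomial]
  rw [Finset.sum_filter, Finset.sum_filter]
  refine Finset.sum_congr rfl fun f _ => ?_
  split_ifs <;> rfl

variable {r c : α → ℕ} {κ : ℂ} {F : Multiset ℕ → ℂ} {n : ℕ}

lemma IsCharacter.sum_coeff (h : IsCharacter r c κ F) (hn : Fintype.card α = n) (a : ι →₀ ℕ) :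
    ∑ μ : Nat.Partition n, (zNumber μ.parts : ℂ)⁻¹ *
        ((powerSumProd ι μ.parts).coeff a * F μ.parts) =
      (n.factorial : ℂ)⁻¹ * κ⁻¹ *
        ∑ f : α → ι with weight f = a, traceForm (rowSum f) (youngSym r c) := by
  have h0 : (n.factorial : ℂ) ≠ 0 := by exact_mod_cast n.factorial_ne_zero
  rw [← mul_right_inj' h0, ← sum_perm_eq_sum_partition hn
    (fun m => (powerSumProd ι m).coeff a * F m), mul_assoc, mul_inv_cancel_left₀ h0]
  simp only [h.eq, coeff_powerSumProd, Finset.sum_mul, Finset.mul_sum]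
  rw [Finset.sum_comm]
  refine Finset.sum_congr rfl fun f _ => ?_
  rw [← traceFormₗ_apply, rowSum, map_sum, LinearMap.sum_apply, Finset.sum_filter, Finset.mul_sum]
  refine Finset.sum_congr rfl fun σ _ => ?_
  by_cases hσ : f ∘ σ = f
  · simp [hσ, traceFormₗ_apply]
  · simp [hσ]

lemma traceForm_rowSum_youngSym_eq_zero (h : IsTableau r c) {f : α → ℕ} {k : ℕ}
    (hk : (Finset.univ.filter fun x => r x < k).card <
      (Finset.univ.filter fun x => f x < k).card) :
    traceForm (rowSum f) (youngSym r c) = 0 := by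
  rw [traceForm_comm]
  refine traceForm_eq_zero fun x => ?_
  rw [youngSym, mul_assoc, mul_assoc, ← mul_assoc (colSum c), h.colSum_mul_rowSum hk, mul_zero]

lemma rowSum_val_comp {N : ℕ} (f : α → Fin N) : rowSum (fun x => (f x : ℕ)) = rowSum f := by
  classical
  rw [rowSum, rowSum]
  refine Finset.sum_congr ?_ fun _ _ => rfl
  ext σ
  simp only [Finset.mem_filter, Finset.mem_univ, true_and, funext_iff, Function.comp_apply,
    Fin.ext_iff]

lemma IsCharacter.sum_coeff_eq_zero (h : IsCharacter r c κ F) (hn : Fintype.card α = n) {N k : ℕ}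
    (a : Fin N →₀ ℕ)
    (hk : (Finset.univ.filter fun x => r x < k).card <
      ∑ i ∈ Finset.univ.filter (fun i : Fin N => (i : ℕ) < k), a i) :
    ∑ μ : Nat.Partition n, (zNumber μ.parts : ℂ)⁻¹ *
        ((powerSumProd (Fin N) μ.parts).coeff a * F μ.parts) = 0 := by
  rw [h.sum_coeff hn, Finset.sum_eq_zero, mul_zero]
  intro f hf
  rw [← rowSum_val_comp]
  refine traceForm_rowSum_youngSym_eq_zero h.tableau (k := k) ?_
  rw [card_filter_lt_eq_sum_weight, (Finset.mem_filter.1 hf).2]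
  exact hk

lemma card_filter_comp_eq {K : Type*} [DecidableEq K] (g : α → K) (ρ : Equiv.Perm α) :
    (Finset.univ.filter fun τ : Equiv.Perm α => g ∘ τ = g ∘ ρ).card = stabCard g := by
  classical
  rw [stabCard]
  refine Finset.card_bij' (fun τ _ => τ * ρ⁻¹) (fun τ _ => τ * ρ) ?_ ?_ ?_ ?_
  · intro τ hτ
    simp only [Finset.mem_filter, Finset.mem_univ, true_and] at hτ ⊢
    funext x
    simpa using congrFun hτ (ρ⁻¹ x)
  · intro τ hτ
    simp only [Finset.mem_filter, Finset.mem_univ, true_and] at hτ ⊢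
    funext x
    simpa using congrFun hτ (ρ x)
  · intro τ _; group
  · intro τ _; group

lemma traceForm_rowSum_comp (f : α → ℕ) (ρ : Equiv.Perm α) (v : MonoidAlgebra ℂ (Equiv.Perm α)) :
    traceForm (rowSum (f ∘ ρ)) v = traceForm (rowSum f) v := by
  have h : rowSum (f ∘ ρ) = permOf ρ⁻¹ * (rowSum f * permOf ρ) := by
    rw [← permOf_mul_rowSum, ← mul_assoc, ← map_mul, inv_mul_cancel, map_one, one_mul]
  rw [h, traceForm_mul_comm_left, mul_assoc, ← map_mul, mul_inv_cancel, map_one, mul_one]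

lemma IsCharacter.sum_coeff_eq_one (h : IsCharacter r c κ F) (hn : Fintype.card α = n) {N : ℕ}
    (hN : ∀ x, r x < N) (a : Fin N →₀ ℕ)
    (ha : ∀ i : Fin N, a i = (Finset.univ.filter fun x => r x = i).card) :
    ∑ μ : Nat.Partition n, (zNumber μ.parts : ℂ)⁻¹ *
        ((powerSumProd (Fin N) μ.parts).coeff a * F μ.parts) = 1 := by
  rw [h.sum_coeff hn]
  let g : α → Fin N := fun x => ⟨r x, hN x⟩
  have hg : weight g = a := by
    ext i
    rw [weight_apply, ha]
    simp [g, Fin.ext_iff]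
  have hweight : ∀ f : α → Fin N, weight f = a ↔ ∃ ρ : Equiv.Perm α, f = g ∘ ρ := by
    intro f
    constructor
    · intro hf
      refine exists_perm_comp_eq fun i => ?_
      rw [← weight_apply, ← weight_apply, hf, hg]
    · rintro ⟨ρ, rfl⟩
      rw [← hg]
      ext i
      rw [weight_apply, weight_apply]
      exact card_filter_comp_perm ρ fun x => g x = i
  have hvalue : ∀ f : α → Fin N, weight f = a →
      traceForm (rowSum f) (youngSym r c) = stabCard r * κ := by
    intro f hf
    obtain ⟨ρ, rfl⟩ := (hweight f).1 hf
    rw [← h.trace, ← rowSum_val_comp, ← traceForm_rowSum_comp r ρ]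
    rfl
  have hstab : stabCard g = stabCard r := by
    classical
    rw [stabCard, stabCard]
    congr 1
    ext σ
    simp only [Finset.mem_filter, Finset.mem_univ, true_and, funext_iff, Function.comp_apply,
      Fin.ext_iff, g]
  have hcount : (Finset.univ.filter fun f : α → Fin N => weight f = a).card * stabCard r =
      n.factorial := by
    classical
    rw [← hn, ← Fintype.card_perm, ← Finset.card_univ,
      Finset.card_eq_sum_card_fiberwise (f := fun ρ : Equiv.Perm α => g ∘ ρ)
        (t := Finset.univ.filter fun f : α → Fin N => weight f = a), Finset.sum_congr rfl
        (g := fun _ => stabCard r), Finset.sum_const, smul_eq_mul]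
    · intro f hf
      obtain ⟨ρ, rfl⟩ := (hweight f).1 (Finset.mem_filter.1 hf).2
      rw [← hstab]
      exact card_filter_comp_eq g ρ
    · intro ρ _
      simpa using (hweight _).2 ⟨ρ, rfl⟩
  rw [Finset.sum_congr rfl fun f hf => hvalue f (Finset.mem_filter.1 hf).2, Finset.sum_const,
    nsmul_eq_mul, ← hcount, Nat.cast_mul]
  have h1 := h.ne_zero
  have h2 := stabCard_ne_zero r
  have h3 : ((Finset.univ.filter fun f : α → Fin N => weight f = a).card : ℂ) ≠ 0 := by
    intro h0
    have := congrArg (Nat.cast : ℕ → ℂ) hcount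
    rw [Nat.cast_mul, h0, zero_mul] at this
    exact n.factorial_ne_zero (by exact_mod_cast this.symm)
  field_simp

/-! ### Transport of tableaux -/

variable {β : Type*} [Fintype β] [DecidableEq β]

lemma partition_permCongr (e : α ≃ β) (σ : Equiv.Perm α) :
    (e.permCongr σ).partition.parts = σ.partition.parts := by
  have h : (e.permCongr σ).cycleType = σ.cycleType := by
    rw [← Equiv.Perm.cycleType_extendDomain
      (e.trans (Equiv.subtypeUnivEquiv (p := fun _ : β => True) fun _ => trivial).symm)]
    congr 1
  rw [Equiv.Perm.parts_partition, Equiv.Perm.parts_partition, ← Equiv.Perm.sum_cycleType,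
    ← Equiv.Perm.sum_cycleType, h, Fintype.card_congr e]

lemma domCongr_rowSum (e : α ≃ β) (f : β → ℕ) :
    MonoidAlgebra.domCongr ℂ ℂ e.permCongrHom (rowSum (f ∘ e)) = rowSum f := by
  classical
  rw [rowSum, rowSum, map_sum]
  refine Finset.sum_equiv e.permCongr ?_ ?_
  · intro σ
    simp only [Finset.mem_filter, Finset.mem_univ, true_and, funext_iff, Function.comp_apply,
      Equiv.permCongr_apply]
    exact ⟨fun h x => by simpa using h (e.symm x), fun h x => by simpa using h (e x)⟩
  · intro σ _
    rw [permOf, MonoidAlgebra.of_apply, MonoidAlgebra.domCongr_single]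
    rfl

lemma domCongr_colSum (e : α ≃ β) (f : β → ℕ) :
    MonoidAlgebra.domCongr ℂ ℂ e.permCongrHom (colSum (f ∘ e)) = colSum f := by
  classical
  rw [colSum, colSum, map_sum]
  refine Finset.sum_equiv e.permCongr ?_ ?_
  · intro σ
    simp only [Finset.mem_filter, Finset.mem_univ, true_and, funext_iff, Function.comp_apply,
      Equiv.permCongr_apply]
    exact ⟨fun h x => by simpa using h (e.symm x), fun h x => by simpa using h (e x)⟩
  · intro σ _
    rw [map_smul, permOf, MonoidAlgebra.of_apply, MonoidAlgebra.domCongr_single,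
      Equiv.Perm.sign_permCongr]
    rfl

lemma sum_mul_eq_zero_of_tableaux {r' c' : α → ℕ} {κ' : ℂ} {F' : Multiset ℕ → ℂ}
    (hn : Fintype.card α = n)
    (hF : ∀ σ : Equiv.Perm α, F σ.partition.parts = κ⁻¹ * traceForm (permOf σ) (youngSym r c))
    (hF' : ∀ σ : Equiv.Perm α, F' σ.partition.parts = κ'⁻¹ * traceForm (permOf σ) (youngSym r' c'))
    (h0 : traceForm (youngSym r' c') (youngSym r c) = 0) :
    ∑ μ : Nat.Partition n, (zNumber μ.parts : ℂ)⁻¹ * (F μ.parts * F' μ.parts) = 0 := by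
  have hfac : (n.factorial : ℂ) ≠ 0 := by exact_mod_cast n.factorial_ne_zero
  rw [← mul_right_inj' hfac, ← sum_perm_eq_sum_partition hn (fun m => F m * F' m)]
  have hinv : ∀ σ : Equiv.Perm α, σ.partition.parts = σ⁻¹.partition.parts := by
    intro σ
    rw [Equiv.Perm.parts_partition, Equiv.Perm.parts_partition, Equiv.Perm.cycleType_inv,
      Equiv.Perm.support_inv]
  have e : ∀ σ : Equiv.Perm α, F σ.partition.parts * F' σ.partition.parts = (κ⁻¹ * κ'⁻¹) *
      (traceForm (permOf σ) (youngSym r c) * traceForm (permOf σ⁻¹) (youngSym r' c')) := by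
    intro σ
    rw [hF]
    conv_lhs => rw [hinv, hF']
    ring
  simp only [e]
  rw [← Finset.mul_sum, sum_traceForm_mul_traceForm, h0]
  simp

/-- Characters of different tableaux are orthogonal. -/
lemma IsCharacter.orthogonal (h : IsCharacter r c κ F) {r' c' : β → ℕ} {κ' : ℂ}
    {F' : Multiset ℕ → ℂ} (h' : IsCharacter r' c' κ' F') (hn : Fintype.card α = n)
    (hn' : Fintype.card β = n) {k : ℕ}
    (hk : (Finset.univ.filter fun x => r x < k).card ≠
      (Finset.univ.filter fun x => r' x < k).card) :
    ∑ μ : Nat.Partition n, (zNumber μ.parts : ℂ)⁻¹ * (F μ.parts * F' μ.parts) = 0 := by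
  let e : α ≃ β := Fintype.equivOfCardEq (hn.trans hn'.symm)
  have hF' : ∀ σ : Equiv.Perm α, F' σ.partition.parts =
      κ'⁻¹ * traceForm (permOf σ) (youngSym (r' ∘ e) (c' ∘ e)) := by
    intro σ
    rw [← partition_permCongr e, h'.eq,
      ← traceForm_map (MonoidAlgebra.domCongr ℂ ℂ e.permCongrHom) (permOf σ), youngSym, youngSym,
      map_mul, domCongr_rowSum, domCongr_colSum, permOf, permOf, MonoidAlgebra.of_apply,
      MonoidAlgebra.of_apply, MonoidAlgebra.domCongr_single]
    rfl
  have ht : IsTableau (r' ∘ e) (c' ∘ e) :=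
    ⟨fun x y h1 h2 => e.injective (h'.tableau.inj _ _ h1 h2), fun x i j hi hj => by
      obtain ⟨y, h1, h2⟩ := h'.tableau.lower (e x) i j hi hj
      exact ⟨e.symm y, by simpa using h1, by simpa using h2⟩⟩
  have hcard : (Finset.univ.filter fun x => r' x < k).card =
      (Finset.univ.filter fun x => (r' ∘ e) x < k).card :=
    (Finset.card_equiv e (by simp)).symm
  rw [hcard] at hk
  refine sum_mul_eq_zero_of_tableaux hn h.eq hF' ?_
  have key : ∀ {r₁ c₁ r₂ c₂ : α → ℕ}, IsTableau r₁ c₁ →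
      (Finset.univ.filter fun x => r₁ x < k).card < (Finset.univ.filter fun x => r₂ x < k).card →
      traceForm (youngSym r₁ c₁) (youngSym r₂ c₂) = 0 := by
    intro r₁ c₁ r₂ c₂ h1 hlt
    refine traceForm_eq_zero fun x => ?_
    have := h1.colSum_mul_rowSum hlt x
    rw [youngSym, youngSym, mul_assoc, mul_assoc, ← mul_assoc x, ← mul_assoc (colSum c₁),
      ← mul_assoc (colSum c₁), this, zero_mul, mul_zero]
  rcases lt_or_gt_of_ne hk with hlt | hlt
  · rw [traceForm_comm]
    exact key h.tableau hlt
  · exact key ht hlt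

end Character

/-! ### Specht modules -/

lemma isTableau_cells (ν : YoungDiagram) :
    IsTableau (fun x : ν.cells => x.1.1) (fun x : ν.cells => x.1.2) :=
  ⟨fun _ _ h1 h2 => Subtype.ext (Prod.ext h1 h2), fun x i j hi hj =>
    ⟨⟨(i, j), ν.up_left_mem hi hj x.2⟩, rfl, rfl⟩⟩

lemma youngSymmetrizer_eq (ν : YoungDiagram) :
    youngSymmetrizer ν = youngSym (fun x : ν.cells => x.1.1) (fun x : ν.cells => x.1.2) := by
  classical
  rw [youngSymmetrizer, youngSym, rowSum, colSum]
  congr 1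
  · refine Finset.sum_congr ?_ fun _ _ => rfl
    ext σ
    simp [funext_iff]
  · refine Finset.sum_congr ?_ fun σ _ => ?_
    · ext σ
      simp [funext_iff]
    · rw [permOf, MonoidAlgebra.of_apply, MonoidAlgebra.smul_single', mul_one]

/-- The characters of the Specht modules are the characters of the diagrams, seen as tableaux. -/
lemma exists_isCharacter_chi (ν : YoungDiagram) :
    ∃ κ, IsCharacter (fun x : ν.cells => x.1.1) (fun x : ν.cells => x.1.2) κ (chi ν) := by
  obtain ⟨κ, h0, h1, h2⟩ := (isTableau_cells ν).exists_quasi_idempotent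
  refine ⟨κ, isTableau_cells ν, h0, h2, fun σ => ?_⟩
  have hex : ∃ τ : Equiv.Perm ν.cells, τ.partition.parts = σ.partition.parts := ⟨σ, rfl⟩
  have hτ := Classical.epsilon_spec hex
  set τ := Classical.epsilon fun τ : Equiv.Perm ν.cells => τ.partition.parts = σ.partition.parts
    with hτdef
  obtain ⟨ρ, hρ⟩ := isConj_iff.1 (Equiv.Perm.partition_eq_of_isConj.2 (Nat.Partition.ext hτ))
  rw [← youngSymmetrizer_eq] at h1 ⊢
  have h3 : chi ν σ.partition.parts = spechtCharacter ν τ := rfl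
  rw [h3, ← hρ, permOf, traceForm_conj]
  exact trace_lsmul_span h0 h1 _

/-! ### Alternants and the Jacobi-Trudi determinant -/

section Alternant

variable {N : ℕ}

/-- The alternant `det (x_j ^ l_i)`. -/
def alternant (l : Fin N → ℕ) : MvPolynomial (Fin N) ℂ :=
  Matrix.det (Matrix.of fun i j : Fin N => MvPolynomial.X j ^ l i)

/-- The exponents `N - 1 - i`. -/
def stair (N : ℕ) (i : Fin N) : ℕ := N - 1 - i

variable {R : Type*} [CommRing R] [Algebra ℂ R]

/-- The Jacobi-Trudi determinant of `l - stair`. -/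
def jacobiTrudi (p : ℕ → R) (l : Fin N → ℕ) : R :=
  Matrix.det (Matrix.of fun i j : Fin N =>
    completeHomogeneous p ((l i : ℤ) - (stair N j : ℤ)))

lemma hGen_pow_mul (x : R) :
    hGen (fun k => x ^ k) * (1 - PowerSeries.C x * PowerSeries.X) = 1 := by
  ext n
  rw [mul_sub, mul_one, map_sub, mul_left_comm, PowerSeries.coeff_C_mul, PowerSeries.coeff_one]
  cases n with
  | zero => simp [hGen, completeHomogeneous_pow]
  | succ n =>
    rw [PowerSeries.coeff_succ_mul_X]
    simp only [hGen, PowerSeries.coeff_mk]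
    rw [completeHomogeneous_pow, completeHomogeneous_pow, if_neg (Nat.succ_ne_zero n), pow_succ',
      sub_self]

/-- The power sums of the variables. -/
def varPowerSum (N : ℕ) (k : ℕ) : MvPolynomial (Fin N) ℂ := ∑ i, MvPolynomial.X i ^ k

/-- `∏_{i ≠ j} (1 - x_i t)` as a polynomial in `t`. -/
def omitProd (j : Fin N) : Polynomial (MvPolynomial (Fin N) ℂ) :=
  ∏ i ∈ Finset.univ.erase j, (1 - Polynomial.C (MvPolynomial.X i) * Polynomial.X)

lemma natDegree_omitProd_lt (j : Fin N) : (omitProd j).natDegree < N := by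
  have hN : 0 < N := j.pos
  refine lt_of_le_of_lt (Polynomial.natDegree_prod_le _ _) ?_
  refine lt_of_le_of_lt (Finset.sum_le_sum (g := fun _ => 1) fun i _ => ?_) ?_
  · refine (Polynomial.natDegree_sub_le _ _).trans ?_
    rw [Polynomial.natDegree_one, max_eq_right (Nat.zero_le _)]
    exact (Polynomial.natDegree_C_mul_le _ _).trans Polynomial.natDegree_X_le
  · simp
    omega

lemma pow_eq_sum_omitProd (j : Fin N) (l : ℕ) :
    (MvPolynomial.X j : MvPolynomial (Fin N) ℂ) ^ l = ∑ k : Fin N,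
      completeHomogeneous (varPowerSum N) ((l : ℤ) - (k : ℤ)) * (omitProd j).coeff k := by
  have h1 : hGen (varPowerSum N) = ∏ i : Fin N,
      hGen (fun k => (MvPolynomial.X i : MvPolynomial (Fin N) ℂ) ^ k) := by
    rw [← hGen_sum]
    congr 1
    funext k
    simp [varPowerSum]
  have h2 : (omitProd j : (MvPolynomial (Fin N) ℂ)⟦X⟧) * hGen (varPowerSum N) =
      hGen (fun k => (MvPolynomial.X j : MvPolynomial (Fin N) ℂ) ^ k) := by
    have h3 : (omitProd j : (MvPolynomial (Fin N) ℂ)⟦X⟧) = ∏ i ∈ Finset.univ.erase j,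
        (1 - PowerSeries.C (MvPolynomial.X i : MvPolynomial (Fin N) ℂ) * PowerSeries.X) := by
      rw [omitProd, ← Polynomial.coeToPowerSeries.ringHom_apply, map_prod]
      simp
    rw [mul_comm, h1, h3, ← Finset.mul_prod_erase _ _ (Finset.mem_univ j), mul_assoc,
      ← Finset.prod_mul_distrib, Finset.prod_congr rfl fun i _ => hGen_pow_mul _,
      Finset.prod_const_one, mul_one]
  have h4 := congrArg (PowerSeries.coeff l) h2
  simp only [hGen, PowerSeries.coeff_mul, PowerSeries.coeff_mk, Polynomial.coeff_coe] at h4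
  rw [completeHomogeneous_pow, Finset.Nat.sum_antidiagonal_eq_sum_range_succ_mk] at h4
  let g : ℕ → MvPolynomial (Fin N) ℂ := fun k =>
    completeHomogeneous (varPowerSum N) ((l : ℤ) - (k : ℤ)) * (omitProd j).coeff k
  have h5 : ∑ k ∈ Finset.range l.succ, g k = ∑ k ∈ Finset.range (N + l.succ), g k := by
    refine Finset.sum_subset (Finset.range_mono (by omega)) fun k _ hk => ?_
    rw [Finset.mem_range, not_lt] at hk
    simp only [g]
    rw [completeHomogeneous_of_neg _ (by omega), zero_mul]
  have h6 : ∑ k ∈ Finset.range N, g k = ∑ k ∈ Finset.range (N + l.succ), g k := by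
    refine Finset.sum_subset (Finset.range_mono (by omega)) fun k _ hk => ?_
    rw [Finset.mem_range, not_lt] at hk
    simp only [g]
    rw [Polynomial.coeff_eq_zero_of_natDegree_lt ((natDegree_omitProd_lt j).trans_le hk), mul_zero]
  rw [← h4, ← Finset.sum_range g, h6, ← h5]
  refine Finset.sum_congr rfl fun k hk => ?_
  rw [Finset.mem_range] at hk
  simp only [g]
  rw [mul_comm, Nat.cast_sub (by omega)]

lemma completeHomogeneous_zero (p : ℕ → R) : completeHomogeneous p 0 = 1 := by
  have h := completeHomogeneous_natCast p 0
  rw [Nat.cast_zero] at h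
  rw [h, Fintype.sum_unique, show (default : Nat.Partition 0).parts = 0 from rfl]
  simp [zNumber]

lemma jacobiTrudi_stair (p : ℕ → R) : jacobiTrudi p (stair N) = 1 := by
  rw [jacobiTrudi, Matrix.det_of_isUpperTriangular]
  · refine Finset.prod_eq_one fun i _ => ?_
    rw [Matrix.of_apply, sub_self, completeHomogeneous_zero]
  · intro i j hij
    simp only [id_eq] at hij
    refine completeHomogeneous_of_neg _ ?_
    simp only [stair]
    omega

lemma alternant_eq (l : Fin N → ℕ) :
    alternant l = jacobiTrudi (varPowerSum N) l * alternant (stair N) := by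
  let E : Matrix (Fin N) (Fin N) (MvPolynomial (Fin N) ℂ) :=
    Matrix.of fun k j => (omitProd j).coeff (stair N k)
  have h : ∀ l : Fin N → ℕ, alternant l = jacobiTrudi (varPowerSum N) l * E.det := by
    intro l
    rw [alternant, jacobiTrudi, ← Matrix.det_mul]
    congr 1
    ext1 i j
    rw [Matrix.mul_apply, Matrix.of_apply, pow_eq_sum_omitProd, ← Equiv.sum_comp Fin.revPerm]
    refine Finset.sum_congr rfl fun k _ => ?_
    have : ((Fin.revPerm k : Fin N) : ℕ) = stair N k := by
      simp [stair, Fin.val_rev]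
      omega
    simp only [this, E, Matrix.of_apply]
  rw [h l, h (stair N), jacobiTrudi_stair, one_mul]

/-! ### The expansion of products of complete homogeneous functions -/

lemma prod_completeHomogeneous (p : ℕ → R) (a : Fin N →₀ ℕ) {n : ℕ} (hn : ∑ i, a i = n) :
    ∏ i, completeHomogeneous p (a i : ℤ) = ∑ μ : Nat.Partition n, ((zNumber μ.parts : ℂ)⁻¹ *
      (powerSumProd (Fin N) μ.parts).coeff a) • (μ.parts.map p).prod := by
  classical
  let q : Fin N → ℕ → MvPolynomial (Fin N) R := fun i k =>
    MvPolynomial.X i ^ k * MvPolynomial.C (p k)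
  have h1 := congrArg (PowerSeries.coeff n) (hGen_sum Finset.univ q)
  have h2 := congrArg (MvPolynomial.coeff a) h1
  rw [PowerSeries.coeff_prod, MvPolynomial.coeff_sum] at h2
  have hq : ∀ (i : Fin N) (m : ℕ), PowerSeries.coeff m (hGen (q i)) =
      MvPolynomial.monomial (Finsupp.single i m) (completeHomogeneous p (m : ℤ)) := by
    intro i m
    simp only [hGen, PowerSeries.coeff_mk, q]
    rw [completeHomogeneous_scale]
    have := map_completeHomogeneous (Algebra.ofId R (MvPolynomial (Fin N) R) |>.restrictScalars ℂ)
      p m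
    change _ * completeHomogeneous (fun k =>
      (Algebra.ofId R (MvPolynomial (Fin N) R) |>.restrictScalars ℂ) (p k)) m = _
    rw [← this]
    change _ * MvPolynomial.C _ = _
    rw [mul_comm, MvPolynomial.C_mul_X_pow_eq_monomial]
  simp only [hq] at h2
  have hprod : ∀ l : Fin N →₀ ℕ, ∏ i, (MvPolynomial.monomial (Finsupp.single i (l i))
      (completeHomogeneous p (l i : ℤ)) : MvPolynomial (Fin N) R) =
      MvPolynomial.monomial l (∏ i, completeHomogeneous p (l i : ℤ)) := by
    intro l
    rw [← MvPolynomial.monomial_sum_prod, Finsupp.univ_sum_single]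
  simp only [hprod, MvPolynomial.coeff_monomial] at h2
  rw [Finset.sum_ite_eq' , if_pos (by simp [Finset.mem_finsuppAntidiag, hn])] at h2
  rw [← h2]
  simp only [hGen, PowerSeries.coeff_mk, completeHomogeneous_natCast]
  rw [MvPolynomial.coeff_sum]
  refine Finset.sum_congr rfl fun μ _ => ?_
  have hmap : (μ.parts.map (∑ i, q i)).prod =
      MvPolynomial.map (algebraMap ℂ R) (powerSumProd (Fin N) μ.parts) *
        MvPolynomial.C (μ.parts.map p).prod := by
    rw [powerSumProd, map_multiset_prod, map_multiset_prod, Multiset.map_map, Multiset.map_map,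
      ← Multiset.prod_map_mul]
    congr 1
    refine Multiset.map_congr rfl fun k _ => ?_
    simp [q, Finset.sum_mul]
  rw [hmap, MvPolynomial.coeff_smul, mul_comm, MvPolynomial.coeff_C_mul, MvPolynomial.coeff_map,
    mul_comm, ← Algebra.smul_def, smul_smul]

end Alternant

/-! ### Frobenius characters of Jacobi-Trudi determinants -/

section Frobenius

variable {N : ℕ}

lemma alternant_eq_sum (l : Fin N → ℕ) :
    alternant l = ∑ w : Equiv.Perm (Fin N), ((Equiv.Perm.sign w : ℤ) : ℂ) •
      MvPolynomial.monomial (Finsupp.equivFunOnFinite.symm (l ∘ w)) 1 := by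
  rw [alternant, Matrix.det_apply]
  refine Finset.sum_congr rfl fun w _ => ?_
  have : ∏ i, Matrix.of (fun i j : Fin N => (MvPolynomial.X j ^ l i : MvPolynomial (Fin N) ℂ))
      (w i) i = MvPolynomial.monomial (Finsupp.equivFunOnFinite.symm (l ∘ w)) 1 := by
    simp only [Matrix.of_apply, MvPolynomial.X_pow_eq_monomial]
    rw [← MvPolynomial.monomial_sum_one]
    congr 1
    rw [← Finsupp.univ_sum_single (Finsupp.equivFunOnFinite.symm (l ∘ w))]
    rfl
  rw [this]
  rcases Int.units_eq_one_or (Equiv.Perm.sign w) with h | h <;> simp [h]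

/-- The coefficient of `x ^ l` in `alternant stair * p_μ`. -/
def altCoeff (l : Fin N → ℕ) (μ : Multiset ℕ) : ℂ :=
  (alternant (stair N) * powerSumProd (Fin N) μ).coeff (Finsupp.equivFunOnFinite.symm l)

lemma altCoeff_eq_sum (l : Fin N → ℕ) (μ : Multiset ℕ) :
    altCoeff l μ = ∑ w : Equiv.Perm (Fin N), ((Equiv.Perm.sign w : ℤ) : ℂ) *
      if ∀ i, stair N (w i) ≤ l i then (powerSumProd (Fin N) μ).coeff
        (Finsupp.equivFunOnFinite.symm fun i => l i - stair N (w i)) else 0 := by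
  rw [altCoeff, alternant_eq_sum, Finset.sum_mul, MvPolynomial.coeff_sum]
  refine Finset.sum_congr rfl fun w _ => ?_
  rw [smul_mul_assoc, MvPolynomial.coeff_smul, smul_eq_mul, MvPolynomial.coeff_monomial_mul',
    one_mul]
  congr 1
  exact if_congr Iff.rfl (congrArg (fun a => MvPolynomial.coeff a _)
    (Finsupp.ext fun _ => rfl)) rfl

lemma jacobiTrudi_eq_sum {R : Type*} [CommRing R] [Algebra ℂ R] (p : ℕ → R) (l : Fin N → ℕ)
    {n : ℕ} (hl : ∑ i, l i = n + ∑ i, stair N i) :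
    jacobiTrudi p l = ∑ μ : Nat.Partition n,
      ((zNumber μ.parts : ℂ)⁻¹ * altCoeff l μ.parts) • (μ.parts.map p).prod := by
  simp only [altCoeff_eq_sum, Finset.mul_sum, Finset.sum_smul]
  rw [Finset.sum_comm, jacobiTrudi, ← Matrix.det_transpose, Matrix.det_apply]
  refine Finset.sum_congr rfl fun w _ => ?_
  simp only [Matrix.transpose_apply, Matrix.of_apply]
  by_cases h : ∀ i, stair N (w i) ≤ l i
  · have e : ∀ i, ((l i : ℤ) - (stair N (w i) : ℤ)) = ((l i - stair N (w i) : ℕ) : ℤ) := by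
      intro i; rw [Nat.cast_sub (h i)]
    simp only [e, if_pos h]
    have h1 := prod_completeHomogeneous p
      (Finsupp.equivFunOnFinite.symm fun i => l i - stair N (w i)) (n := n) (by
        simp only [Finsupp.equivFunOnFinite_symm_apply_apply]
        have h2 : ∑ i, stair N (w i) = ∑ i, stair N i := Equiv.sum_comp w (stair N)
        have h3 : ∑ i, (l i - stair N (w i)) + ∑ i, stair N (w i) = ∑ i, l i := by
          rw [← Finset.sum_add_distrib]
          exact Finset.sum_congr rfl fun i _ => Nat.sub_add_cancel (h i)
        omega)
    simp only [Finsupp.equivFunOnFinite_symm_apply_apply] at h1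
    rw [h1, Finset.smul_sum]
    refine Finset.sum_congr rfl fun μ _ => ?_
    rcases Int.units_eq_one_or (Equiv.Perm.sign w) with h | h <;> simp [h]
  · simp only [if_neg h, mul_zero, zero_smul, Finset.sum_const_zero]
    push Not at h
    obtain ⟨i, hi⟩ := h
    rw [Finset.prod_eq_zero (Finset.mem_univ i) (completeHomogeneous_of_neg _ (by omega)),
      smul_zero]

lemma coeff_alternant {l m : Fin N → ℕ} (hl : StrictAnti l) (hm : StrictAnti m) :
    (alternant l).coeff (Finsupp.equivFunOnFinite.symm m) = if l = m then 1 else 0 := by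
  rw [alternant_eq_sum, MvPolynomial.coeff_sum]
  simp only [MvPolynomial.coeff_smul, MvPolynomial.coeff_monomial, EmbeddingLike.apply_eq_iff_eq,
    smul_eq_mul]
  rw [Finset.sum_eq_single 1]
  · simp
  · intro w _ hw
    rw [if_neg, mul_zero]
    intro h
    apply hw
    have hmono : StrictMono w := by
      intro i j hij
      have := hm hij
      rw [← h] at this
      exact hl.lt_iff_gt.1 this
    refine Equiv.coe_fn_injective ((StrictMono.range_inj hmono strictMono_id).1 ?_)
    rw [w.surjective.range_eq, Set.range_id]
  · simp

lemma sum_altCoeff_mul_altCoeff {l m : Fin N → ℕ} (hl : StrictAnti l) (hm : StrictAnti m) {n : ℕ}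
    (hn : ∑ i, l i = n + ∑ i, stair N i) :
    ∑ μ : Nat.Partition n, (zNumber μ.parts : ℂ)⁻¹ * (altCoeff l μ.parts * altCoeff m μ.parts) =
      if l = m then 1 else 0 := by
  rw [← coeff_alternant hl hm, alternant_eq, jacobiTrudi_eq_sum _ _ hn, Finset.sum_mul,
    MvPolynomial.coeff_sum]
  refine Finset.sum_congr rfl fun μ _ => ?_
  rw [smul_mul_assoc, MvPolynomial.coeff_smul, smul_eq_mul, mul_assoc, mul_comm _ (alternant _)]
  rfl

/-- The strictly decreasing exponents `ν_i + N - 1 - i`. -/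
def shifted (ν : YoungDiagram) (N : ℕ) (i : Fin N) : ℕ := ν.rowLen i + stair N i

lemma strictAnti_shifted (ν : YoungDiagram) (N : ℕ) : StrictAnti (shifted ν N) := by
  intro i j hij
  have h := ν.rowLen_anti i j hij.le
  have h2 : (i : ℕ) < j := hij
  have h3 := j.2
  simp only [shifted, stair]
  omega

lemma rowLen_eq_zero {ν : YoungDiagram} {i : ℕ} (h : ν.colLen 0 ≤ i) : ν.rowLen i = 0 := by
  by_contra h0
  have : (i, 0) ∈ ν := YoungDiagram.mem_iff_lt_rowLen.2 (Nat.pos_of_ne_zero h0)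
  have := YoungDiagram.mem_iff_lt_colLen.1 this
  omega

lemma schur_eq_det {R : Type*} [CommRing R] [Algebra ℂ R] (p : ℕ → R) (ν : YoungDiagram)
    (hN : ν.colLen 0 ≤ N) :
    schur p ν = Matrix.det (Matrix.of fun i j : Fin N =>
      completeHomogeneous p ((ν.rowLen i : ℤ) - (i : ℤ) + (j : ℤ))) := by
  induction N, hN using Nat.le_induction with
  | base => rfl
  | succ N hN ih =>
    rw [ih, Matrix.det_succ_row _ (Fin.last N), Finset.sum_eq_single (Fin.last N)]
    · have h : completeHomogeneous p ((ν.rowLen N : ℤ) - (N : ℤ) + (N : ℤ)) = 1 := by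
        rw [rowLen_eq_zero hN]
        simpa using completeHomogeneous_zero p
      simp only [Matrix.of_apply, Fin.val_last, h, mul_one, Even.neg_pow ⟨N, rfl⟩, one_pow, one_mul]
      congr 1
      ext1 i j
      simp [Fin.succAbove_last]
    · intro j _ hj
      have hj' : (j : ℕ) < N := by
        have := j.2
        have : (j : ℕ) ≠ N := fun h => hj (Fin.ext h)
        omega
      rw [Matrix.of_apply, completeHomogeneous_of_neg, mul_zero, zero_mul]
      rw [Fin.val_last, rowLen_eq_zero hN]
      omega
    · simp

lemma schur_eq_jacobiTrudi {R : Type*} [CommRing R] [Algebra ℂ R] (p : ℕ → R) (ν : YoungDiagram)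
    (hN : ν.colLen 0 ≤ N) : schur p ν = jacobiTrudi p (shifted ν N) := by
  rw [schur_eq_det p ν hN, jacobiTrudi]
  congr 1
  ext1 i j
  have h1 := i.2
  have h2 := j.2
  simp only [Matrix.of_apply, shifted, stair]
  congr 1
  omega

lemma card_cells_row (ν : YoungDiagram) (i : ℕ) :
    (Finset.univ.filter fun x : ν.cells => x.1.1 = i).card = ν.rowLen i := by
  rw [YoungDiagram.rowLen_eq_card]
  refine Finset.card_bij (fun x _ => x.1) ?_ ?_ ?_
  · intro x hx
    exact YoungDiagram.mem_row_iff.2 ⟨x.2, (Finset.mem_filter.1 hx).2⟩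
  · intro x _ y _ h
    exact Subtype.ext h
  · intro y hy
    obtain ⟨h1, h2⟩ := YoungDiagram.mem_row_iff.1 hy
    exact ⟨⟨y, h1⟩, by simp [h2], rfl⟩

lemma fst_lt_colLen (ν : YoungDiagram) (x : ν.cells) : x.1.1 < ν.colLen 0 :=
  YoungDiagram.mem_iff_lt_colLen.1 (ν.up_left_mem le_rfl (Nat.zero_le x.1.2) x.2)

lemma card_cells_lt (ν : YoungDiagram) (hN : ν.colLen 0 ≤ N) (k : ℕ) :
    (Finset.univ.filter fun x : ν.cells => x.1.1 < k).card =
      ∑ i ∈ Finset.univ.filter (fun i : Fin N => (i : ℕ) < k), ν.rowLen i := by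
  have h := card_filter_lt_eq_sum_weight
    (fun x : ν.cells => (⟨x.1.1, (fst_lt_colLen ν x).trans_le hN⟩ : Fin N)) k
  rw [h]
  refine Finset.sum_congr rfl fun i _ => ?_
  rw [weight_apply, ← card_cells_row]
  simp [Fin.ext_iff]

lemma card_cells (ν : YoungDiagram) (hN : ν.colLen 0 ≤ N) :
    ν.cells.card = ∑ i : Fin N, ν.rowLen i := by
  have h := card_cells_lt ν hN N
  rw [Finset.filter_true_of_mem fun x _ => (fst_lt_colLen ν x).trans_le hN,
    Finset.filter_true_of_mem fun i _ => i.2] at h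
  simpa using h

/-- A nontrivial permutation increases the first element that it moves. -/
lemma exists_first_lt {w : Equiv.Perm (Fin N)} (hw : w ≠ 1) :
    ∃ j, j < w j ∧ ∀ i < j, w i = i := by
  have hne : (Finset.univ.filter fun j => w j ≠ j).Nonempty := by
    by_contra h
    apply hw
    ext j
    rw [Finset.not_nonempty_iff_eq_empty, Finset.filter_eq_empty_iff] at h
    simpa using congrArg Fin.val (not_not.1 (h (Finset.mem_univ j)))
  refine ⟨(Finset.univ.filter fun j => w j ≠ j).min' hne, ?_, fun i hi => ?_⟩
  swap
  · by_contra h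
    exact absurd (Finset.min'_le _ i (by simpa using h)) (not_le.2 hi)
  · set j := (Finset.univ.filter fun j => w j ≠ j).min' hne with hj
    have h1 : w j ≠ j := (Finset.mem_filter.1 (Finset.min'_mem _ hne)).2
    by_contra h2
    have h3 : w j < j := lt_of_le_of_ne (not_lt.1 h2) h1
    have h4 : w (w j) = w j := by
      by_contra h
      exact absurd (Finset.min'_le _ (w j) (by simpa using h)) (not_le.2 h3)
    exact h1 (w.injective h4)

/-- The pairing of the Jacobi-Trudi determinant of `ν` with the character of `lam`. -/
def pairing (N : ℕ) (ν lam : YoungDiagram) (n : ℕ) : ℂ :=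
  ∑ μ : Nat.Partition n, (zNumber μ.parts : ℂ)⁻¹ *
    (altCoeff (shifted ν N) μ.parts * chi lam μ.parts)

lemma pairing_eq_sum (ν lam : YoungDiagram) (n : ℕ) :
    pairing N ν lam n = ∑ w : Equiv.Perm (Fin N), ((Equiv.Perm.sign w : ℤ) : ℂ) *
      if ∀ i, stair N (w i) ≤ shifted ν N i then
        ∑ μ : Nat.Partition n, (zNumber μ.parts : ℂ)⁻¹ *
          ((powerSumProd (Fin N) μ.parts).coeff
            (Finsupp.equivFunOnFinite.symm fun i => shifted ν N i - stair N (w i)) *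
              chi lam μ.parts) else 0 := by
  simp only [pairing, altCoeff_eq_sum, Finset.sum_mul, Finset.mul_sum]
  rw [Finset.sum_comm]
  refine Finset.sum_congr rfl fun w _ => ?_
  split_ifs
  · rw [Finset.mul_sum]
    exact Finset.sum_congr rfl fun μ _ => by ring
  · simp

lemma term_eq_zero {ν lam : YoungDiagram} {n : ℕ} (hn : lam.cells.card = n)
    (hN : lam.colLen 0 ≤ N) {w : Equiv.Perm (Fin N)}
    {k : Fin N} (hlt : ∀ j < k, lam.rowLen j = ν.rowLen j ∧ w j = j)
    (hk : lam.rowLen k < shifted ν N k - stair N (w k)) :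
    ∑ μ : Nat.Partition n, (zNumber μ.parts : ℂ)⁻¹ *
      ((powerSumProd (Fin N) μ.parts).coeff
        (Finsupp.equivFunOnFinite.symm fun i => shifted ν N i - stair N (w i)) *
          chi lam μ.parts) = 0 := by
  obtain ⟨κ, hκ⟩ := exists_isCharacter_chi lam
  refine hκ.sum_coeff_eq_zero (by simpa using hn) (k := k + 1) _ ?_
  rw [card_cells_lt lam hN]
  refine Finset.sum_lt_sum (fun i hi => ?_) ⟨k, by simp, hk⟩
  rcases lt_or_eq_of_le (Nat.lt_succ_iff.1 (Finset.mem_filter.1 hi).2) with h | h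
  · obtain ⟨h1, h2⟩ := hlt i h
    simp only [Finsupp.equivFunOnFinite_symm_apply_apply, h1, h2, shifted]
    omega
  · rw [Fin.ext h]
    exact hk.le

lemma pairing_eq_zero {ν lam : YoungDiagram} {n : ℕ} (hn : lam.cells.card = n)
    (hN : lam.colLen 0 ≤ N) {k : Fin N} (hlt : ∀ j < k, lam.rowLen j = ν.rowLen j)
    (hk : lam.rowLen k < ν.rowLen k) : pairing N ν lam n = 0 := by
  rw [pairing_eq_sum]
  refine Finset.sum_eq_zero fun w _ => ?_
  split_ifs
  swap
  · rw [mul_zero]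
  by_cases hw : ∀ j < k, w j = j
  · have hwk : k ≤ w k := by
      by_contra h
      have := hw _ (not_le.1 h)
      exact absurd (w.injective this) (not_le.1 h).ne
    rw [term_eq_zero hn hN (k := k) (fun j hj => ⟨hlt j hj, hw j hj⟩), mul_zero]
    have h2 : (k : ℕ) ≤ w k := hwk
    have h3 := (w k).2
    simp only [shifted, stair]
    omega
  · have hw1 : w ≠ 1 := by
      rintro rfl
      exact hw fun j _ => rfl
    obtain ⟨j, h1, h2⟩ := exists_first_lt hw1
    have hjk : j < k := by
      by_contra h
      exact hw fun i hi => h2 i (hi.trans_le (not_lt.1 h))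
    rw [term_eq_zero hn hN (k := j) (fun i hi => ⟨hlt i (hi.trans hjk), h2 i hi⟩), mul_zero]
    have h3 : (j : ℕ) < w j := h1
    have h4 := (w j).2
    rw [hlt j hjk]
    simp only [shifted, stair]
    omega

lemma pairing_self {ν : YoungDiagram} {n : ℕ} (hn : ν.cells.card = n) (hN : ν.colLen 0 ≤ N) :
    pairing N ν ν n = 1 := by
  rw [pairing_eq_sum, Finset.sum_eq_single 1]
  · have e : ∀ i : Fin N, shifted ν N i - stair N i = ν.rowLen i := by
      intro i
      simp [shifted]
    have h0 : ∀ i : Fin N, stair N i ≤ shifted ν N i := fun i => Nat.le_add_left _ _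
    obtain ⟨κ, hκ⟩ := exists_isCharacter_chi ν
    simp only [Equiv.Perm.sign_one, Units.val_one, Int.cast_one, one_mul, Equiv.Perm.coe_one, id_eq,
      e, h0, implies_true, if_true]
    refine hκ.sum_coeff_eq_one (by simpa using hn)
      (fun x => (fst_lt_colLen ν x).trans_le hN) _ fun i => ?_
    rw [card_cells_row]
    rfl
  · intro w _ hw
    split_ifs
    swap
    · rw [mul_zero]
    obtain ⟨j, h1, h2⟩ := exists_first_lt hw
    rw [term_eq_zero hn hN (k := j) (fun i hi => ⟨rfl, h2 i hi⟩), mul_zero]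
    have h3 : (j : ℕ) < w j := h1
    have h4 := (w j).2
    simp only [shifted, stair]
    omega
  · simp

/-! ### Diagrams of partitions -/

lemma rowLens_diagram {n : ℕ} (ν : Nat.Partition n) :
    (diagram ν).rowLens = ν.parts.sort (· ≥ ·) :=
  YoungDiagram.rowLens_ofRowLens_eq_self fun _ hx => ν.parts_pos ((Multiset.mem_sort _).1 hx)

lemma card_cells_diagram {n : ℕ} (ν : Nat.Partition n) : (diagram ν).cells.card = n := by
  have h1 := congrArg List.sum (rowLens_diagram ν)
  rw [card_cells _ le_rfl, ← Finset.sum_range]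
  have h2 : (ν.parts.sort (· ≥ ·)).sum = n := by
    rw [← Multiset.sum_coe, Multiset.sort_eq, ν.parts_sum]
  exact h1.trans h2

lemma colLen_le_card (ν : YoungDiagram) : ν.colLen 0 ≤ ν.cells.card := by
  rw [YoungDiagram.colLen_eq_card]
  exact Finset.card_le_card (Finset.filter_subset _ _)

lemma colLen_diagram_le {n : ℕ} (ν : Nat.Partition n) : (diagram ν).colLen 0 ≤ n :=
  (colLen_le_card _).trans (card_cells_diagram ν).le

lemma diagram_injective {n : ℕ} {ν lam : Nat.Partition n}
    (h : ∀ i : Fin n, (diagram ν).rowLen i = (diagram lam).rowLen i) : ν = lam := by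
  have h1 : diagram ν = diagram lam := by
    ext ⟨i, j⟩
    rw [YoungDiagram.mem_cells, YoungDiagram.mem_cells, YoungDiagram.mem_iff_lt_rowLen,
      YoungDiagram.mem_iff_lt_rowLen]
    by_cases hi : i < n
    · rw [h ⟨i, hi⟩]
    · rw [rowLen_eq_zero ((colLen_diagram_le ν).trans (not_lt.1 hi)),
        rowLen_eq_zero ((colLen_diagram_le lam).trans (not_lt.1 hi))]
  have h2 := congrArg YoungDiagram.rowLens h1
  rw [rowLens_diagram, rowLens_diagram] at h2
  apply Nat.Partition.ext
  rw [← Multiset.sort_eq ν.parts (· ≥ ·), h2, Multiset.sort_eq]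

/-! ### The Frobenius formula -/

/-- The parts of a partition, ordered lexicographically. -/
def lexKey {n : ℕ} (ν : Nat.Partition n) : Lex (Fin n → ℕ) :=
  toLex fun i => (diagram ν).rowLen i

lemma lexKey_injective {n : ℕ} : Function.Injective (lexKey : Nat.Partition n → _) :=
  fun _ _ h => diagram_injective fun i => congrFun (toLex.injective h) i

lemma pairing_diagram_eq_zero {n : ℕ} {ν lam : Nat.Partition n} (h : lexKey lam < lexKey ν) :
    pairing n (diagram ν) (diagram lam) n = 0 := by
  obtain ⟨k, h1, h2⟩ := h
  exact pairing_eq_zero (card_cells_diagram lam) (colLen_diagram_le lam) (k := k) h1 h2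

lemma sum_chi_mul_chi_eq_zero {n : ℕ} {ν lam : Nat.Partition n} (h : lexKey lam < lexKey ν) :
    ∑ μ : Nat.Partition n, (zNumber μ.parts : ℂ)⁻¹ *
      (chi (diagram lam) μ.parts * chi (diagram ν) μ.parts) = 0 := by
  obtain ⟨k, h1, h2⟩ := h
  obtain ⟨κ, hκ⟩ := exists_isCharacter_chi (diagram lam)
  obtain ⟨κ', hκ'⟩ := exists_isCharacter_chi (diagram ν)
  refine hκ.orthogonal hκ' (k := k + 1) (by simpa using card_cells_diagram lam)
    (by simpa using card_cells_diagram ν) (ne_of_lt ?_)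
  rw [card_cells_lt _ (colLen_diagram_le lam), card_cells_lt _ (colLen_diagram_le ν)]
  refine Finset.sum_lt_sum (fun i hi => ?_) ⟨k, by simp, h2⟩
  rcases lt_or_eq_of_le (Nat.lt_succ_iff.1 (Finset.mem_filter.1 hi).2) with h | h
  · exact (h1 i h).le
  · rw [Fin.ext h]
    exact le_of_lt h2

lemma chi_eq_sum {n : ℕ} (ν μ : Nat.Partition n) :
    chi (diagram ν) μ.parts = ∑ lam : Nat.Partition n,
      pairing n (diagram lam) (diagram ν) n * altCoeff (shifted (diagram lam) n) μ.parts := by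
  let Φ : Matrix (Nat.Partition n) (Nat.Partition n) ℂ :=
    Matrix.of fun lam μ => altCoeff (shifted (diagram lam) n) μ.parts
  let Ψ : Matrix (Nat.Partition n) (Nat.Partition n) ℂ :=
    Matrix.of fun μ lam => (zNumber μ.parts : ℂ)⁻¹ * altCoeff (shifted (diagram lam) n) μ.parts
  have h1 : Φ * Ψ = 1 := by
    ext lam lam'
    rw [Matrix.mul_apply, Matrix.one_apply]
    have hs : ∑ i, shifted (diagram lam) n i = n + ∑ i, stair n i := by
      simp only [shifted, Finset.sum_add_distrib]
      rw [← card_cells _ (colLen_diagram_le lam), card_cells_diagram]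
    have h := sum_altCoeff_mul_altCoeff (strictAnti_shifted (diagram lam) n)
      (strictAnti_shifted (diagram lam') n) hs
    have hiff : shifted (diagram lam) n = shifted (diagram lam') n ↔ lam = lam' := by
      constructor
      · intro h
        refine diagram_injective fun i => ?_
        have := congrFun h i
        simpa [shifted] using this
      · rintro rfl; rfl
    simp only [hiff] at h
    rw [← h]
    exact Finset.sum_congr rfl fun μ _ => by simp only [Φ, Ψ, Matrix.of_apply]; ring
  have h2 : Ψ * Φ = 1 := mul_eq_one_comm.1 h1
  calc chi (diagram ν) μ.parts = ∑ μ' : Nat.Partition n,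
        chi (diagram ν) μ'.parts * (1 : Matrix (Nat.Partition n) (Nat.Partition n) ℂ) μ' μ := by
        simp [Matrix.one_apply]
    _ = _ := by
        rw [← h2]
        simp only [Matrix.mul_apply, Finset.mul_sum, pairing, Finset.sum_mul]
        rw [Finset.sum_comm]
        refine Finset.sum_congr rfl fun lam _ => Finset.sum_congr rfl fun μ' _ => ?_
        simp only [Φ, Ψ, Matrix.of_apply]
        ring

lemma chi_eq_altCoeff {n : ℕ} (ν : Nat.Partition n) : ∀ μ : Nat.Partition n,
    chi (diagram ν) μ.parts = altCoeff (shifted (diagram ν) n) μ.parts := by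
  induction ν using (InvImage.wf lexKey (wellFounded_lt (α := Lex (Fin n → ℕ)))).induction with
  | _ ν ih =>
    intro μ
    rw [chi_eq_sum, Finset.sum_eq_single ν]
    · rw [pairing_self (card_cells_diagram ν) (colLen_diagram_le ν), one_mul]
    · intro lam _ hlam
      rcases lt_trichotomy (lexKey lam) (lexKey ν) with h | h | h
      · have h1 : pairing n (diagram lam) (diagram ν) n = 0 := by
          rw [pairing, ← sum_chi_mul_chi_eq_zero h]
          exact Finset.sum_congr rfl fun μ _ => by rw [ih lam h μ]
        rw [h1, zero_mul]
      · exact absurd (lexKey_injective h) hlam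
      · rw [pairing_diagram_eq_zero h, zero_mul]
    · simp

/-- The Frobenius formula: the Schur functions are the characteristics of the Specht modules. -/
lemma sum_chi_smul_eq_schur {R : Type*} [CommRing R] [Algebra ℂ R] (p : ℕ → R) {n : ℕ}
    (ν : Nat.Partition n) :
    ∑ μ : Nat.Partition n, (chi (diagram ν) μ.parts / (zNumber μ.parts : ℂ)) •
      (μ.parts.map p).prod = schur p (diagram ν) := by
  have hs : ∑ i, shifted (diagram ν) n i = n + ∑ i, stair n i := by
    simp only [shifted, Finset.sum_add_distrib]
    rw [← card_cells _ (colLen_diagram_le ν), card_cells_diagram]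
  rw [schur_eq_jacobiTrudi p _ (colLen_diagram_le ν), jacobiTrudi_eq_sum p _ hs]
  exact Finset.sum_congr rfl fun μ _ => by rw [chi_eq_altCoeff, div_eq_inv_mul]

end Frobenius

/-! ### Hook lengths -/

lemma prod_hookLength_row {M : Type*} [CommMonoid M] (g : ℕ → M) (ν : YoungDiagram) {N a : ℕ}
    (hN : ν.colLen 0 ≤ N) (ha : a < N) :
    (∏ x ∈ Finset.range (ν.rowLen a), g (hookLength ν (a, x))) *
        ∏ k ∈ Finset.Ioo a N, g ((ν.rowLen a + (N - 1 - a)) - (ν.rowLen k + (N - 1 - k))) =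
      ∏ r ∈ Finset.Icc 1 (ν.rowLen a + (N - 1 - a)), g r := by
  have hcol : ∀ x < ν.rowLen a, a < ν.colLen x := fun x hx =>
    YoungDiagram.mem_iff_lt_colLen.1 (YoungDiagram.mem_iff_lt_rowLen.2 hx)
  have hcolN : ∀ x, ν.colLen x ≤ N := fun x => (ν.colLen_anti 0 x (Nat.zero_le x)).trans hN
  have hhook : ∀ x < ν.rowLen a, hookLength ν (a, x) + x + a + 1 = ν.rowLen a + ν.colLen x := by
    intro x hx
    have := hcol x hx
    simp only [hookLength]
    omega
  have hrow : ∀ k, a < k → ν.rowLen k ≤ ν.rowLen a := fun k hk => ν.rowLen_anti a k hk.le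
  have inj1 : Set.InjOn (fun x => hookLength ν (a, x)) (Finset.range (ν.rowLen a)) := by
    intro x hx y hy hxy
    rw [Finset.coe_range, Set.mem_Iio] at hx hy
    have h1 := hhook x hx
    have h2 := hhook y hy
    simp only at hxy
    rcases lt_trichotomy x y with h | h | h
    · have := ν.colLen_anti x y h.le
      omega
    · exact h
    · have := ν.colLen_anti y x h.le
      omega
  have inj2 : Set.InjOn (fun k => (ν.rowLen a + (N - 1 - a)) - (ν.rowLen k + (N - 1 - k)))
      (Finset.Ioo a N) := by
    intro x hx y hy hxy
    rw [Finset.coe_Ioo, Set.mem_Ioo] at hx hy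
    have h1 := hrow x hx.1
    have h2 := hrow y hy.1
    simp only at hxy
    rcases lt_trichotomy x y with h | h | h
    · have := ν.rowLen_anti x y h.le
      omega
    · exact h
    · have := ν.rowLen_anti y x h.le
      omega
  have hdisj : Disjoint ((Finset.range (ν.rowLen a)).image fun x => hookLength ν (a, x))
      ((Finset.Ioo a N).image fun k =>
        (ν.rowLen a + (N - 1 - a)) - (ν.rowLen k + (N - 1 - k))) := by
    rw [Finset.disjoint_left]
    intro s hs hs'
    obtain ⟨x, hx, rfl⟩ := Finset.mem_image.1 hs
    obtain ⟨k, hk, hxk⟩ := Finset.mem_image.1 hs'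
    rw [Finset.mem_range] at hx
    rw [Finset.mem_Ioo] at hk
    have h1 := hhook x hx
    have h2 := hrow k hk.1
    by_cases h : x < ν.rowLen k
    · have : k < ν.colLen x :=
        YoungDiagram.mem_iff_lt_colLen.1 (YoungDiagram.mem_iff_lt_rowLen.2 h)
      omega
    · have : ¬ k < ν.colLen x := fun h' =>
        h (YoungDiagram.mem_iff_lt_rowLen.1 (YoungDiagram.mem_iff_lt_colLen.2 h'))
      omega
  have hunion : ((Finset.range (ν.rowLen a)).image fun x => hookLength ν (a, x)) ∪
      ((Finset.Ioo a N).image fun k =>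
        (ν.rowLen a + (N - 1 - a)) - (ν.rowLen k + (N - 1 - k))) =
      Finset.Icc 1 (ν.rowLen a + (N - 1 - a)) := by
    refine Finset.eq_of_subset_of_card_le ?_ ?_
    · refine Finset.union_subset ?_ ?_
      · intro s hs
        obtain ⟨x, hx, rfl⟩ := Finset.mem_image.1 hs
        rw [Finset.mem_range] at hx
        have h1 := hhook x hx
        have h2 := hcol x hx
        have h3 := hcolN x
        rw [Finset.mem_Icc]
        omega
      · intro s hs
        obtain ⟨k, hk, rfl⟩ := Finset.mem_image.1 hs
        rw [Finset.mem_Ioo] at hk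
        have h2 := hrow k hk.1
        rw [Finset.mem_Icc]
        omega
    · rw [Finset.card_union_of_disjoint hdisj, Finset.card_image_of_injOn inj1,
        Finset.card_image_of_injOn inj2, Finset.card_range, Nat.card_Ioo, Nat.card_Icc]
      omega
  rw [← hunion, Finset.prod_union hdisj, Finset.prod_image inj1, Finset.prod_image inj2]

@[to_additive]
lemma prod_cells {M : Type*} [CommMonoid M] (ν : YoungDiagram) {N : ℕ} (hN : ν.colLen 0 ≤ N)
    (g : ℕ × ℕ → M) :
    ∏ c ∈ ν.cells, g c = ∏ a ∈ Finset.range N, ∏ x ∈ Finset.range (ν.rowLen a), g (a, x) := by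
  rw [← Finset.prod_fiberwise_of_maps_to (g := Prod.fst) (t := Finset.range N)]
  · refine Finset.prod_congr rfl fun a _ => ?_
    have : (ν.cells.filter fun c => c.1 = a) = {a} ×ˢ Finset.range (ν.rowLen a) := by
      rw [← YoungDiagram.row_eq_prod]
      rfl
    rw [this, Finset.prod_product, Finset.prod_singleton]
  · intro c hc
    rw [Finset.mem_range]
    exact (fst_lt_colLen ν ⟨c, hc⟩).trans_le hN

/-! ### The principal specialization of Schur functions -/

section Specialization

variable {K : Type*} [Field K]

/-- The quantum number `e (x / 2) - e (- x / 2)`. -/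
def qNum (e : AddChar ℂ K) (x : ℂ) : K := e (x / 2) - e (-(x / 2))

/-- The power sums of the principal specialization. -/
def specPower (e : AddChar ℂ K) (c : K) (k : ℕ) : K := c ^ k / qNum e k

lemma addChar_pow (e : AddChar ℂ K) (x : ℂ) (k : ℕ) : e x ^ k = e (k * x) := by
  rw [← AddChar.map_nsmul_eq_pow, nsmul_eq_mul]

lemma addChar_sub_eq (e : AddChar ℂ K) (x y : ℂ) :
    e (-x) - e (-y) = e (-((x + y) / 2)) * qNum e (y - x) := by
  rw [qNum, mul_sub, ← AddChar.map_add_eq_mul, ← AddChar.map_add_eq_mul]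
  congr 2 <;> ring

lemma addChar_sum (e : AddChar ℂ K) {ι : Type*} (s : Finset ι) (f : ι → ℂ) :
    e (∑ i ∈ s, f i) = ∏ i ∈ s, e (f i) := by
  classical
  induction s using Finset.induction_on with
  | empty => simp
  | insert a s ha ih => rw [Finset.sum_insert ha, Finset.prod_insert ha,
      AddChar.map_add_eq_mul, ih]

variable [Algebra ℂ K] {e : AddChar ℂ K} (c : K)

lemma completeHomogeneous_specPower_succ (hq : ∀ r : ℕ, 0 < r → qNum e r ≠ 0) (n : ℕ) :
    completeHomogeneous (specPower e c) ((n + 1 : ℕ) : ℤ) * qNum e ((n + 1 : ℕ) : ℂ) =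
      c * e (n / 2) * completeHomogeneous (specPower e c) (n : ℤ) := by
  have h1 : hGen (fun k => e (1 / 2) ^ k * specPower e c k) =
      hGen (fun k => e (-(1 / 2)) ^ k * specPower e c k) * hGen (fun k => c ^ k) := by
    rw [← hGen_add]
    ext n
    simp only [hGen, PowerSeries.coeff_mk]
    refine completeHomogeneous_congr (fun k hk => ?_) _
    have h := hq k hk
    rw [Pi.add_apply, specPower]
    have : qNum e k = e (1 / 2) ^ k - e (-(1 / 2)) ^ k := by
      rw [qNum, addChar_pow, addChar_pow]
      congr 2 <;> ring
    field_simp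
    rw [this]
    ring
  have h2 : hGen (fun k => e (1 / 2) ^ k * specPower e c k) *
      (1 - PowerSeries.C c * PowerSeries.X) =
      hGen (fun k => e (-(1 / 2)) ^ k * specPower e c k) := by
    rw [h1, mul_assoc, hGen_pow_mul, mul_one]
  have h3 := congrArg (PowerSeries.coeff (n + 1)) h2
  rw [mul_sub, mul_one, map_sub, mul_left_comm, PowerSeries.coeff_C_mul,
    PowerSeries.coeff_succ_mul_X] at h3
  simp only [hGen, PowerSeries.coeff_mk, completeHomogeneous_scale] at h3
  simp only [addChar_pow] at h3
  rw [qNum]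
  have e1 : e (((n + 1 : ℕ) : ℂ) / 2) = e (((n + 1 : ℕ) : ℂ) * (1 / 2)) := by congr 1; ring
  have e2 : e (-(((n + 1 : ℕ) : ℂ) / 2)) = e (((n + 1 : ℕ) : ℂ) * -(1 / 2)) := by congr 1; ring
  have e3 : e ((n : ℂ) / 2) = e ((n : ℂ) * (1 / 2)) := by congr 1; ring
  rw [e1, e2, e3]
  linear_combination h3

lemma completeHomogeneous_specPower_mul (hq : ∀ r : ℕ, 0 < r → qNum e r ≠ 0) (n : ℕ) :
    completeHomogeneous (specPower e c) n * ∏ r ∈ Finset.Icc 1 n, qNum e r =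
      c ^ n * e ((n : ℂ) * (n - 1) / 4) := by
  induction n with
  | zero => simp [completeHomogeneous_zero]
  | succ n ih =>
    rw [Finset.prod_Icc_succ_top (by omega), mul_comm (∏ _ ∈ _, _), ← mul_assoc,
      completeHomogeneous_specPower_succ c hq, mul_assoc, ih, pow_succ]
    have : e (((n + 1 : ℕ) : ℂ) * ((n + 1 : ℕ) - 1) / 4) =
        e (n / 2) * e ((n : ℂ) * (n - 1) / 4) := by
      rw [← AddChar.map_add_eq_mul]
      congr 1
      push_cast
      ring
    rw [this]
    ring

lemma completeHomogeneous_specPower_pred (hq : ∀ r : ℕ, 0 < r → qNum e r ≠ 0) (hc : c ≠ 0)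
    (m : ℤ) :
    completeHomogeneous (specPower e c) (m - 1) =
      completeHomogeneous (specPower e c) m * (c⁻¹ * (e (1 / 2) * (1 - e (-(m : ℂ))))) := by
  rcases lt_trichotomy m 0 with h | h | h
  · rw [completeHomogeneous_of_neg _ h, completeHomogeneous_of_neg _ (by omega), zero_mul]
  · subst h
    rw [completeHomogeneous_of_neg _ (by omega)]
    simp
  · obtain ⟨n, rfl⟩ : ∃ n : ℕ, m = ((n + 1 : ℕ) : ℤ) := ⟨(m - 1).toNat, by omega⟩
    have h := completeHomogeneous_specPower_succ c hq n
    have h1 : (((n + 1 : ℕ) : ℤ) - 1) = (n : ℤ) := by push_cast; ring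
    have h2 : e (1 / 2) * (1 - e (-(((n + 1 : ℕ) : ℤ) : ℂ))) =
        e (-(n / 2)) * qNum e ((n + 1 : ℕ) : ℂ) := by
      rw [qNum, mul_sub, mul_sub, mul_one, ← AddChar.map_add_eq_mul, ← AddChar.map_add_eq_mul,
        ← AddChar.map_add_eq_mul]
      congr 2 <;> push_cast <;> ring
    have h3 : e (-((n : ℂ) / 2)) * e (n / 2) = 1 := by
      rw [← AddChar.map_add_eq_mul, neg_add_cancel, AddChar.map_zero_eq_one]
    rw [h1, h2]
    calc completeHomogeneous (specPower e c) (n : ℤ)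
        = c⁻¹ * c * (e (-((n : ℂ) / 2)) * e (n / 2)) *
            completeHomogeneous (specPower e c) (n : ℤ) := by
          rw [h3, inv_mul_cancel₀ hc]; ring
      _ = c⁻¹ * e (-((n : ℂ) / 2)) * (c * e (n / 2) *
            completeHomogeneous (specPower e c) (n : ℤ)) := by ring
      _ = _ := by rw [← h]; ring

lemma completeHomogeneous_specPower_sub (hq : ∀ r : ℕ, 0 < r → qNum e r ≠ 0) (hc : c ≠ 0)
    (l k : ℕ) :
    completeHomogeneous (specPower e c) ((l : ℤ) - k) =
      completeHomogeneous (specPower e c) l * ((c⁻¹ ^ k * e ((k : ℂ) ^ 2 / 2)) *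
        ∏ s ∈ Finset.range k, (-e (-(l : ℂ)) + e (-(s : ℂ)))) := by
  induction k with
  | zero => simp
  | succ k ih =>
    have h1 : (l : ℤ) - ((k + 1 : ℕ) : ℤ) = ((l : ℤ) - k) - 1 := by push_cast; ring
    rw [h1, completeHomogeneous_specPower_pred c hq hc, ih, Finset.prod_range_succ]
    have h2 : e (1 / 2) * (1 - e (-(((l : ℤ) - k : ℤ) : ℂ))) =
        e (k + 1 / 2) * (-e (-(l : ℂ)) + e (-(k : ℂ))) := by
      rw [mul_sub, mul_add, mul_one, mul_neg, ← AddChar.map_add_eq_mul, ← AddChar.map_add_eq_mul,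
        ← AddChar.map_add_eq_mul, neg_add_eq_sub]
      congr 2 <;> push_cast <;> ring
    have h3 : e (((k + 1 : ℕ) : ℂ) ^ 2 / 2) = e ((k : ℂ) ^ 2 / 2) * e (k + 1 / 2) := by
      rw [← AddChar.map_add_eq_mul]
      congr 1
      push_cast
      ring
    rw [h2, h3]
    ring

lemma jacobiTrudi_specPower (hq : ∀ r : ℕ, 0 < r → qNum e r ≠ 0) (hc : c ≠ 0) {N : ℕ}
    (m : Fin N → ℕ) :
    Matrix.det (Matrix.of fun i j : Fin N =>
        completeHomogeneous (specPower e c) ((m i : ℤ) - (j : ℕ))) =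
      (∏ i, completeHomogeneous (specPower e c) (m i)) *
        (∏ j : Fin N, c⁻¹ ^ (j : ℕ) * e (((j : ℕ) : ℂ) ^ 2 / 2)) *
        ∏ i, ∏ j ∈ Finset.Ioi i, (e (-(m i : ℂ)) - e (-(m j : ℂ))) := by
  let P : Fin N → Polynomial K := fun j =>
    ∏ s ∈ Finset.range j, (Polynomial.X + Polynomial.C (e (-(s : ℂ))))
  have hmon : ∀ j, (P j).Monic := fun j =>
    Polynomial.monic_prod_of_monic _ _ fun s _ => Polynomial.monic_X_add_C _
  have hdeg : ∀ j, (P j).natDegree = j := by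
    intro j
    rw [Polynomial.natDegree_prod_of_monic _ _ fun s _ => Polynomial.monic_X_add_C _]
    simp
  have hM : (Matrix.of fun i j : Fin N =>
        completeHomogeneous (specPower e c) ((m i : ℤ) - (j : ℕ))) =
      Matrix.of fun i j : Fin N => completeHomogeneous (specPower e c) (m i) *
        (Matrix.of fun i j : Fin N => (c⁻¹ ^ (j : ℕ) * e (((j : ℕ) : ℂ) ^ 2 / 2)) *
          (Matrix.of fun i j : Fin N => (P j).eval (-e (-(m i : ℂ)))) i j) i j := by
    ext i j
    simp only [Matrix.of_apply]
    rw [completeHomogeneous_specPower_sub c hq hc]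
    simp [P, Polynomial.eval_prod]
  rw [hM, Matrix.det_mul_column, Matrix.det_mul_row,
    ← Matrix.det_eval_matrixOfPolynomials_eq_det_vandermonde _ P hdeg hmon,
    Matrix.det_vandermonde, mul_assoc]
  congr 2
  refine Finset.prod_congr rfl fun i _ => Finset.prod_congr rfl fun j _ => ?_
  ring

end Specialization

lemma prod_Ioi_rev {M : Type*} [CommMonoid M] {N : ℕ} (F : ℕ → ℕ → M) :
    ∏ i : Fin N, ∏ j ∈ Finset.Ioi i, F (i.rev : ℕ) (j.rev : ℕ) =
      ∏ a ∈ Finset.range N, ∏ k ∈ Finset.Ioo a N, F k a := by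
  have h1 : ∀ i : Fin N, ∏ j ∈ Finset.Ioi i, F (i.rev : ℕ) (j.rev : ℕ) =
      ∏ j : Fin N, if j.rev < i.rev then F (i.rev : ℕ) (j.rev : ℕ) else 1 := by
    intro i
    rw [← Finset.prod_filter]
    refine Finset.prod_congr ?_ fun _ _ => rfl
    ext j
    simp [Fin.rev_lt_rev]
  have h2 : ∀ a ∈ Finset.range N, ∏ k ∈ Finset.Ioo a N, F k a =
      ∏ k ∈ Finset.range N, if a < k then F k a else 1 := by
    intro a _
    rw [← Finset.prod_filter]
    refine Finset.prod_congr ?_ fun _ _ => rfl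
    ext j
    simp [and_comm]
  rw [Finset.prod_congr rfl h2, Finset.prod_congr rfl fun i _ => h1 i, Finset.prod_comm,
    ← Fin.prod_univ_eq_prod_range
      (fun a => ∏ k ∈ Finset.range N, if a < k then F k a else 1) N,
    ← Equiv.prod_comp Fin.revPerm]
  refine Finset.prod_congr rfl fun a _ => ?_
  rw [← Fin.prod_univ_eq_prod_range (fun k => if (a : ℕ) < k then F k a else 1) N,
    ← Equiv.prod_comp Fin.revPerm]
  refine Finset.prod_congr rfl fun k _ => ?_
  simp only [Fin.revPerm_apply, Fin.rev_rev, Fin.val_fin_lt]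

lemma sum_Ioo_add (N : ℕ) (g : ℕ → ℂ) :
    ∑ a ∈ Finset.range N, ∑ k ∈ Finset.Ioo a N, (g k + g a) =
      (N - 1) * ∑ a ∈ Finset.range N, g a := by
  induction N with
  | zero => simp
  | succ N ih =>
    have h : ∀ a ∈ Finset.range N, ∑ k ∈ Finset.Ioo a (N + 1), (g k + g a) =
        ∑ k ∈ Finset.Ioo a N, (g k + g a) + (g N + g a) := by
      intro a ha
      have ha' := Finset.mem_range.1 ha
      have : Finset.Ioo a (N + 1) = insert N (Finset.Ioo a N) := by
        ext x
        simp only [Finset.mem_Ioo, Finset.mem_insert]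
        omega
      rw [this, Finset.sum_insert (by simp), add_comm]
    rw [Finset.sum_range_succ, Finset.sum_congr rfl h, Finset.sum_add_distrib, ih,
      Finset.sum_add_distrib, Finset.sum_range_succ]
    have : Finset.Ioo N (N + 1) = ∅ := by
      ext x
      simp
    rw [this]
    simp
    ring

lemma two_mul_f2 (ν : YoungDiagram) {N : ℕ} (hN : ν.colLen 0 ≤ N) :
    2 * f2 ν = ∑ a ∈ Finset.range N, (ν.rowLen a : ℂ) * (ν.rowLen a - 2 * a - 1) := by
  rw [f2, ← mul_assoc, mul_one_div_cancel two_ne_zero, one_mul]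
  rw [← Finset.sum_subset (Finset.range_mono hN)]
  · refine Finset.sum_congr rfl fun a _ => ?_
    ring
  · intro a _ ha
    rw [rowLen_eq_zero (by simpa using ha)]
    simp

lemma sum_exponent_eq_f2 (ν : YoungDiagram) {N : ℕ} (hN : ν.colLen 0 ≤ N) :
    ∑ a ∈ Finset.range N, ((ν.rowLen a + (N - 1 - a) : ℕ) : ℂ) *
          ((ν.rowLen a + (N - 1 - a) : ℕ) - 1) / 4 +
        ∑ a ∈ Finset.range N, (a : ℂ) ^ 2 / 2 -
        ∑ a ∈ Finset.range N, ∑ k ∈ Finset.Ioo a N, (((ν.rowLen k + (N - 1 - k) : ℕ) : ℂ) +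
          ((ν.rowLen a + (N - 1 - a) : ℕ) : ℂ)) / 2 = f2 ν / 2 := by
  have hf : f2 ν / 2 = (2 * f2 ν) / 4 := by ring
  simp only [← Finset.sum_div]
  rw [sum_Ioo_add N fun a => ((ν.rowLen a + (N - 1 - a) : ℕ) : ℂ), hf, two_mul_f2 ν hN]
  have hδ : ∀ a ∈ Finset.range N, ((N - 1 - a : ℕ) : ℂ) = N - 1 - a := by
    intro a ha
    have := Finset.mem_range.1 ha
    rw [Nat.cast_sub (by omega), Nat.cast_sub (by omega), Nat.cast_one]
  have hs : ∀ M : ℕ, ∑ a ∈ Finset.range M, (a : ℂ) = M * (M - 1) / 2 ∧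
      ∑ a ∈ Finset.range M, (a : ℂ) ^ 2 = M * (M - 1) * (2 * M - 1) / 6 := by
    intro M
    induction M with
    | zero => simp
    | succ M ih =>
      rw [Finset.sum_range_succ, Finset.sum_range_succ, ih.1, ih.2]
      constructor <;> push_cast <;> ring
  have h1 : ∑ a ∈ Finset.range N, ((ν.rowLen a + (N - 1 - a) : ℕ) : ℂ) *
          ((ν.rowLen a + (N - 1 - a) : ℕ) - 1) =
      ∑ a ∈ Finset.range N, (((ν.rowLen a : ℂ) * (ν.rowLen a - 2 * a - 1)) +
        2 * (N - 1) * ν.rowLen a + ((a : ℂ) ^ 2 - (2 * N - 3) * a + (N - 1) * (N - 2))) := by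
    refine Finset.sum_congr rfl fun a ha => ?_
    rw [Nat.cast_add, hδ a ha]
    ring
  have h2 : ∑ a ∈ Finset.range N, ((ν.rowLen a + (N - 1 - a) : ℕ) : ℂ) =
      ∑ a ∈ Finset.range N, ((ν.rowLen a : ℂ) + (N - 1 - a)) := by
    refine Finset.sum_congr rfl fun a ha => ?_
    rw [Nat.cast_add, hδ a ha]
  rw [h1, h2]
  simp only [Finset.sum_add_distrib, Finset.sum_sub_distrib, ← Finset.mul_sum, (hs N).1, (hs N).2,
    Finset.sum_const, Finset.card_range, nsmul_eq_mul]
  ring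

/-- The principal specialization of Schur functions, as a hook product. -/
theorem schur_specPower {K : Type*} [Field K] [Algebra ℂ K] {e : AddChar ℂ K} {c : K}
    (hq : ∀ r : ℕ, 0 < r → qNum e r ≠ 0) (hc : c ≠ 0) (ν : YoungDiagram) :
    schur (specPower e c) ν =
      e (f2 ν / 2) * ∏ x ∈ ν.cells, c / qNum e (hookLength ν x) := by
  set N := ν.colLen 0 with hNdef
  have hN : ν.colLen 0 ≤ N := le_rfl
  let M : ℕ → ℕ := fun a => ν.rowLen a + (N - 1 - a)
  have hM : ∀ a k, a < k → k < N → M k < M a := by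
    intro a k h1 h2
    have := ν.rowLen_anti a k h1.le
    simp only [M]
    omega
  have h1 : schur (specPower e c) ν = Matrix.det (Matrix.of fun i j : Fin N =>
        completeHomogeneous (specPower e c) ((M i.rev : ℤ) - (j : ℕ))) := by
    rw [schur_eq_jacobiTrudi _ ν hN, jacobiTrudi, ← Matrix.det_submatrix_equiv_self Fin.revPerm]
    congr 1
    ext i j
    have := j.2
    simp only [Matrix.submatrix_apply, Matrix.of_apply, Fin.revPerm_apply, shifted, stair, M,
      Fin.val_rev]
    congr 2
    omega
  have hE : ∏ i : Fin N, completeHomogeneous (specPower e c) (M i.rev : ℤ) =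
      ∏ a ∈ Finset.range N, completeHomogeneous (specPower e c) (M a : ℤ) := by
    rw [← Fin.prod_univ_eq_prod_range (fun a => completeHomogeneous (specPower e c) (M a : ℤ)) N,
      ← Equiv.prod_comp Fin.revPerm]
    simp
  rw [h1, jacobiTrudi_specPower c hq hc, hE,
    prod_Ioi_rev fun x y => e (-(M x : ℂ)) - e (-(M y : ℂ)),
    Fin.prod_univ_eq_prod_range (fun j => c⁻¹ ^ j * e ((j : ℂ) ^ 2 / 2)) N]
  have hrow : ∀ a ∈ Finset.range N, completeHomogeneous (specPower e c) (M a : ℤ) *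
      ∏ k ∈ Finset.Ioo a N, (e (-(M k : ℂ)) - e (-(M a : ℂ))) =
      c ^ M a * e ((M a : ℂ) * (M a - 1) / 4) *
        (∏ x ∈ Finset.range (ν.rowLen a), (qNum e (hookLength ν (a, x)))⁻¹) *
        e (∑ k ∈ Finset.Ioo a N, -(((M k : ℂ) + M a) / 2)) := by
    intro a ha
    have ha' := Finset.mem_range.1 ha
    have h2 := completeHomogeneous_specPower_mul c hq (M a)
    rw [← prod_hookLength_row (fun r => qNum e (r : ℂ)) ν hN ha'] at h2
    have hx : ∏ x ∈ Finset.range (ν.rowLen a), qNum e (hookLength ν (a, x)) ≠ 0 :=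
      Finset.prod_ne_zero_iff.2 fun x _ => hq _ (by simp [hookLength])
    have h3 : ∏ k ∈ Finset.Ioo a N, (e (-(M k : ℂ)) - e (-(M a : ℂ))) =
        e (∑ k ∈ Finset.Ioo a N, -(((M k : ℂ) + M a) / 2)) *
          ∏ k ∈ Finset.Ioo a N, qNum e ((M a - M k : ℕ) : ℂ) := by
      rw [addChar_sum, ← Finset.prod_mul_distrib]
      refine Finset.prod_congr rfl fun k hk => ?_
      have hk' := Finset.mem_Ioo.1 hk
      rw [addChar_sub_eq, Nat.cast_sub (hM a k hk'.1 hk'.2).le]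
    rw [h3, ← h2, Finset.prod_inv_distrib]
    field_simp
    rfl
  rw [mul_right_comm, ← Finset.prod_mul_distrib, Finset.prod_congr rfl hrow]
  simp only [Finset.prod_mul_distrib]
  rw [← addChar_sum, ← addChar_sum, ← addChar_sum, ← prod_cells ν hN fun x =>
    (qNum e (hookLength ν x))⁻¹, Finset.prod_pow_eq_pow_sum, Finset.prod_pow_eq_pow_sum]
  have hc1 : c ^ (∑ a ∈ Finset.range N, M a) * c⁻¹ ^ (∑ a ∈ Finset.range N, a) =
      c ^ ν.cells.card := by
    have : ∑ a ∈ Finset.range N, M a = ν.cells.card + ∑ a ∈ Finset.range N, a := by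
      rw [card_cells ν hN, ← Finset.sum_range, Finset.sum_add_distrib,
        Finset.sum_range_reflect fun a => a]
    rw [this, pow_add, mul_assoc, ← mul_pow, mul_inv_cancel₀ hc, one_pow, mul_one]
  have he : e (∑ a ∈ Finset.range N, (M a : ℂ) * (M a - 1) / 4) *
      e (∑ a ∈ Finset.range N, (a : ℂ) ^ 2 / 2) *
      e (∑ a ∈ Finset.range N, ∑ k ∈ Finset.Ioo a N, -(((M k : ℂ) + M a) / 2)) =
      e (f2 ν / 2) := by
    rw [← AddChar.map_add_eq_mul, ← AddChar.map_add_eq_mul, ← sum_exponent_eq_f2 ν hN]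
    simp only [Finset.sum_neg_distrib, sub_eq_add_neg, M]
  rw [← he, Finset.prod_div_distrib, Finset.prod_const, ← hc1, Finset.prod_inv_distrib]
  ring

/-! ### The tau-function of the data -/

lemma expSeries_add (a b : ℂ) : expSeries (a + b) = expSeries a * expSeries b :=
  (PowerSeries.exp_mul_exp_eq_exp_add a b).symm

lemma expSeries_zero : expSeries 0 = 1 := by
  rw [expSeries, PowerSeries.rescale_zero]
  simp

lemma rescale_expSeries (a b : ℂ) : PowerSeries.rescale a (expSeries b) = expSeries (a * b) := by
  rw [expSeries, PowerSeries.rescale_rescale, mul_comm, expSeries]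

/-- The additive character `x ↦ exp (x ħ)`. -/
def expChar : AddChar ℂ ℂ⸨X⸩ where
  toFun x := HahnSeries.ofPowerSeries ℤ ℂ (expSeries x)
  map_zero_eq_one' := by rw [expSeries_zero, map_one]
  map_add_eq_mul' a b := by rw [expSeries_add, map_mul]

lemma expChar_apply (x : ℂ) : expChar x = HahnSeries.ofPowerSeries ℤ ℂ (expSeries x) := rfl

lemma qNum_expChar (x : ℂ) :
    qNum expChar x = HahnSeries.ofPowerSeries ℤ ℂ (PowerSeries.rescale x varsigma) := by
  rw [varsigma, map_sub, rescale_expSeries, rescale_expSeries, map_sub, qNum, expChar_apply,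
    expChar_apply]
  congr 4 <;> ring

lemma varsigma_eq : varsigma = PowerSeries.X * calS := by
  ext n
  cases n with
  | zero =>
    rw [varsigma, expSeries, expSeries, map_sub, PowerSeries.coeff_rescale,
      PowerSeries.coeff_rescale]
    simp
  | succ n => rw [mul_comm, PowerSeries.coeff_succ_mul_X, calS, PowerSeries.coeff_mk]

lemma constantCoeff_calS : PowerSeries.constantCoeff calS = 1 := by
  rw [← PowerSeries.coeff_zero_eq_constantCoeff_apply, calS, PowerSeries.coeff_mk, varsigma,
    expSeries, expSeries, map_sub, PowerSeries.coeff_rescale, PowerSeries.coeff_rescale,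
    PowerSeries.coeff_exp]
  norm_num

lemma constantCoeff_rescale_calS (x : ℂ) :
    PowerSeries.constantCoeff (PowerSeries.rescale x calS) = 1 := by
  rw [← PowerSeries.coeff_zero_eq_constantCoeff_apply, PowerSeries.coeff_rescale,
    PowerSeries.coeff_zero_eq_constantCoeff_apply, constantCoeff_calS, pow_zero, one_mul]

lemma rescale_varsigma (x : ℂ) : PowerSeries.rescale x varsigma =
    PowerSeries.C x * PowerSeries.X * PowerSeries.rescale x calS := by
  rw [varsigma_eq, map_mul, PowerSeries.rescale_X]

lemma rescale_varsigma_ne_zero {x : ℂ} (hx : x ≠ 0) : PowerSeries.rescale x varsigma ≠ 0 := by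
  rw [rescale_varsigma]
  refine mul_ne_zero (mul_ne_zero ?_ PowerSeries.X_ne_zero) fun h => ?_
  · simpa using hx
  · simpa [h] using constantCoeff_rescale_calS x

lemma qNum_expChar_ne_zero {x : ℂ} (hx : x ≠ 0) : qNum expChar x ≠ 0 := by
  rw [qNum_expChar, Ne, map_eq_zero_iff _ HahnSeries.ofPowerSeries_injective]
  exact rescale_varsigma_ne_zero hx

lemma ofPowerSeries_yDatum (β w : ℂ) {k : ℕ} (hk : 0 < k) :
    HahnSeries.ofPowerSeries ℤ ℂ (PowerSeries.coeff k (yDatum β w)) /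
      HahnSeries.single (1 : ℤ) (1 : ℂ) = specPower expChar (HahnSeries.C (β * w)) k := by
  have hk0 : (k : ℂ) ≠ 0 := by exact_mod_cast hk.ne'
  have h1 : (PowerSeries.rescale (k : ℂ) calS)⁻¹ * PowerSeries.rescale (k : ℂ) calS = 1 :=
    PowerSeries.inv_mul_cancel _ (by rw [constantCoeff_rescale_calS]; exact one_ne_zero)
  rw [specPower, div_eq_div_iff (by simp) (qNum_expChar_ne_zero hk0), qNum_expChar,
    rescale_varsigma, yDatum, PowerSeries.coeff_mk, if_neg hk.ne', ← HahnSeries.ofPowerSeries_X,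
    ← HahnSeries.ofPowerSeries_C, ← map_pow, ← map_pow, ← map_mul, ← map_mul]
  congr 1
  calc _ = (PowerSeries.C ((β * w) ^ k / (k : ℂ)) * PowerSeries.C (k : ℂ)) * PowerSeries.X *
        ((PowerSeries.rescale (k : ℂ) calS)⁻¹ * PowerSeries.rescale (k : ℂ) calS) := by ring
    _ = _ := by rw [h1, ← map_mul, div_mul_cancel₀ _ hk0, mul_one]

lemma schur_congr {R : Type*} [CommRing R] [Algebra ℂ R] {p q : ℕ → R}
    (h : ∀ k, 0 < k → p k = q k) (ν : YoungDiagram) : schur p ν = schur q ν := by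
  simp only [schur, completeHomogeneous_congr h]

lemma coeff_psiDatum (w : ℂ) (k j : ℕ) :
    PowerSeries.coeff j (PowerSeries.coeff k (psiDatum w)) =
      if (k, j) = (1, 0) then 1 / w else 0 := by
  rw [psiDatum, PowerSeries.coeff_C_mul, PowerSeries.coeff_X]
  by_cases hk : k = 1
  · rw [if_pos hk, mul_one, PowerSeries.coeff_C]
    simp [hk]
  · rw [if_neg hk, mul_zero, map_zero, if_neg (by simp [hk])]

lemma evalAtHbar_psiDatum (w a : ℂ) :
    evalAtHbar (psiDatum w) a = PowerSeries.C (a / w) * PowerSeries.X := by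
  ext n
  rw [evalAtHbar, PowerSeries.coeff_mk, PowerSeries.coeff_C_mul, PowerSeries.coeff_X]
  have h : ∀ kj ∈ Finset.HasAntidiagonal.antidiagonal n,
      PowerSeries.coeff kj.2 (PowerSeries.coeff kj.1 (psiDatum w)) * a ^ kj.1 =
        if kj = (1, 0) then a / w else 0 := by
    rintro ⟨k, j⟩ -
    rw [coeff_psiDatum]
    split_ifs with h
    · rw [(Prod.mk.inj h).1]
      ring
    · rw [zero_mul]
  rw [Finset.sum_congr rfl h, Finset.sum_ite_eq', mul_ite, mul_one, mul_zero]
  simp [eq_comm]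

lemma sum_content (ν : YoungDiagram) : ∑ c ∈ ν.cells, -content c = f2 ν := by
  have h : ∀ n : ℕ, ∑ x ∈ Finset.range n, (x : ℂ) = n * (n - 1) / 2 := by
    intro n
    induction n with
    | zero => simp
    | succ n ih =>
      rw [Finset.sum_range_succ, ih]
      push_cast
      ring
  have h2 := two_mul_f2 ν le_rfl
  refine mul_left_cancel₀ (two_ne_zero (α := ℂ)) ?_
  rw [h2, sum_cells ν le_rfl, Finset.mul_sum]
  refine Finset.sum_congr rfl fun a _ => ?_
  simp only [content, neg_sub, Finset.sum_sub_distrib, h, Finset.sum_const, Finset.card_range,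
    nsmul_eq_mul]
  ring

lemma subst_evalAtHbar_psiDatum (w : ℂ) (ν : YoungDiagram) :
    PowerSeries.subst (∑ c ∈ ν.cells, evalAtHbar (psiDatum w) (-content c)) (PowerSeries.exp ℂ) =
      expSeries (f2 ν / w) := by
  simp only [evalAtHbar_psiDatum]
  rw [← Finset.sum_mul, ← map_sum, ← Finset.sum_div, sum_content, expSeries,
    PowerSeries.rescale_eq_subst, PowerSeries.smul_eq_C_mul]

lemma smul_eq_C_mul (c : ℂ) (f : Fock) :
    c • f = MvPowerSeries.C (HahnSeries.C c) * f := by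
  rw [Algebra.smul_def, MvPowerSeries.algebraMap_apply, HahnSeries.algebraMap_apply',
    ← PowerSeries.C_eq_algebraMap, HahnSeries.ofPowerSeries_C]

theorem relabelledRightSide_eq_hypergeometricTau {β w : ℂ} (hβ : β ≠ 0) (hw : w ≠ 0) :
    relabelledRightSide β w = hypergeometricTau (psiDatum w) (yDatum β w) := by
  rw [relabelledRightSide, hypergeometricTau]
  congr 1
  funext m
  rw [Finset.sum_comm]
  refine Finset.sum_congr rfl fun ν _ => ?_
  have hc : HahnSeries.C (Γ := ℤ) (β * w) ≠ 0 := by simp [hβ, hw]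
  rw [schur_congr (fun k => ofPowerSeries_yDatum β w) (diagram ν),
    schur_specPower (fun r hr => qNum_expChar_ne_zero (by exact_mod_cast hr.ne')) hc,
    subst_evalAtHbar_psiDatum, ← sum_chi_smul_eq_schur, Finset.mul_sum, Finset.sum_mul]
  refine Finset.sum_congr rfl fun μ _ => ?_
  have hexp : HahnSeries.ofPowerSeries ℤ ℂ (expSeries ((1 / w + 1 / 2) * f2 (diagram ν))) =
      HahnSeries.ofPowerSeries ℤ ℂ (expSeries (f2 (diagram ν) / w)) *
        expChar (f2 (diagram ν) / 2) := by
    rw [expChar_apply, ← map_mul, ← expSeries_add]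
    congr 2
    ring
  simp only [qNum_expChar]
  rw [smul_eq_C_mul, hexp, pmon]
  simp only [map_mul]
  ring

/-! ### Scaling and relabelling -/

lemma coeff_laurentScale (c : ℂ) (f : ℂ⸨X⸩) (n : ℤ) :
    (laurentScale c f).coeff n = c ^ n * f.coeff n := rfl

lemma support_laurentScale {c : ℂ} (hc : c ≠ 0) (f : ℂ⸨X⸩) :
    (laurentScale c f).support = f.support := by
  ext n
  simp [coeff_laurentScale, zpow_ne_zero n hc]

lemma laurentScale_single (c : ℂ) (n : ℤ) (x : ℂ) :
    laurentScale c (HahnSeries.single n x) = HahnSeries.single n (c ^ n * x) := by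
  ext k
  rw [coeff_laurentScale, HahnSeries.coeff_single, HahnSeries.coeff_single]
  split_ifs with h
  · rw [h]
  · rw [mul_zero]

lemma laurentScale_mul {c : ℂ} (hc : c ≠ 0) (f g : ℂ⸨X⸩) :
    laurentScale c (f * g) = laurentScale c f * laurentScale c g := by
  ext n
  rw [coeff_laurentScale, HahnSeries.coeff_mul, HahnSeries.coeff_mul, Finset.mul_sum]
  refine Finset.sum_congr ?_ fun ij hij => ?_
  · ext ij
    simp only [Finset.mem_antidiagonal, support_laurentScale hc]
  · rw [coeff_laurentScale, coeff_laurentScale,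
      ← (Finset.mem_antidiagonal.1 hij).2.2, zpow_add₀ hc]
    ring

/-- The substitution `t ↦ c t` in Laurent series. -/
def laurentScaleHom {c : ℂ} (hc : c ≠ 0) : ℂ⸨X⸩ →+* ℂ⸨X⸩ where
  toFun := laurentScale c
  map_one' := by
    rw [← HahnSeries.single_zero_one, laurentScale_single, zpow_zero, mul_one]
  map_mul' := laurentScale_mul hc
  map_zero' := by
    ext n
    simp [coeff_laurentScale]
  map_add' f g := by
    ext n
    simp [coeff_laurentScale, mul_add]

lemma laurentScaleHom_apply {c : ℂ} (hc : c ≠ 0) (f : ℂ⸨X⸩) :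
    laurentScaleHom hc f = laurentScale c f := rfl

lemma laurentScale_ofPowerSeries (c : ℂ) (f : ℂ⟦X⟧) :
    laurentScale c (HahnSeries.ofPowerSeries ℤ ℂ f) =
      HahnSeries.ofPowerSeries ℤ ℂ (PowerSeries.rescale c f) := by
  ext n
  rw [coeff_laurentScale]
  rcases le_or_gt 0 n with h | h
  · obtain ⟨k, rfl⟩ := Int.eq_ofNat_of_zero_le h
    rw [HahnSeries.ofPowerSeries_apply_coeff, HahnSeries.ofPowerSeries_apply_coeff,
      PowerSeries.coeff_rescale, zpow_natCast]
  · have h0 : ∀ F : ℂ⟦X⟧, (HahnSeries.ofPowerSeries ℤ ℂ F).coeff n = 0 := fun F => by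
      rw [HahnSeries.ofPowerSeries_apply]
      refine HahnSeries.embDomain_of_notMem_range ?_
      rintro ⟨k, hk⟩
      have : (k : ℤ) = n := hk
      omega
    rw [h0, h0, mul_zero]

/-- The weighted degree of a monomial, where `p_k` has weight `k`. -/
def monWeight (e : ℕ+ →₀ ℕ) : ℕ := e.sum fun k m => (k : ℕ) * m

lemma monWeight_add (e e' : ℕ+ →₀ ℕ) : monWeight (e + e') = monWeight e + monWeight e' :=
  Finsupp.sum_add_index' (by simp) fun k a b => mul_add _ a b

section Relabel

variable (β : ℂ) {w : ℂ}

lemma coeff_relabel (hw : w ≠ 0) (f : Fock) (e : ℕ+ →₀ ℕ) :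
    MvPowerSeries.coeff e (relabel β w f) = (HahnSeries.single (-1 : ℤ) (β * w)) ^ monWeight e *
      laurentScaleHom (inv_ne_zero hw) (MvPowerSeries.coeff e f) := rfl

lemma relabel_C (hw : w ≠ 0) (x : ℂ⸨X⸩) :
    relabel β w (MvPowerSeries.C x) = MvPowerSeries.C (laurentScale w⁻¹ x) := by
  classical
  ext1 e
  rw [coeff_relabel β hw, MvPowerSeries.coeff_C, MvPowerSeries.coeff_C]
  split_ifs with h
  · simp [h, monWeight, laurentScaleHom_apply]
  · simp

/-- The relabelling as a ring homomorphism. -/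
def relabelHom (hw : w ≠ 0) : Fock →+* Fock where
  toFun := relabel β w
  map_one' := by
    have := relabel_C β hw 1
    rwa [map_one, ← laurentScaleHom_apply (inv_ne_zero hw), map_one, map_one] at this
  map_mul' f g := by
    classical
    ext1 e
    rw [coeff_relabel β hw, MvPowerSeries.coeff_mul, MvPowerSeries.coeff_mul, map_sum,
      Finset.mul_sum]
    refine Finset.sum_congr rfl fun ij hij => ?_
    rw [coeff_relabel β hw, coeff_relabel β hw, ← Finset.HasAntidiagonal.mem_antidiagonal.1 hij,
      monWeight_add, pow_add, map_mul (laurentScaleHom _)]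
    ring
  map_zero' := by
    ext1 e
    rw [coeff_relabel β hw, map_zero, map_zero, mul_zero]
  map_add' f g := by
    ext1 e
    rw [map_add, coeff_relabel β hw, coeff_relabel β hw, coeff_relabel β hw, map_add, map_add,
      mul_add]

lemma relabelHom_apply (hw : w ≠ 0) (f : Fock) : relabelHom β hw f = relabel β w f := rfl

lemma relabel_pvar (hw : w ≠ 0) {k : ℕ} (hk : 0 < k) :
    relabel β w (pvar k) =
      MvPowerSeries.C ((HahnSeries.single (-1 : ℤ) (β * w)) ^ k) * pvar k := by
  classical
  ext1 e
  rw [coeff_relabel β hw, MvPowerSeries.coeff_C_mul, pvar, MvPowerSeries.coeff_X]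
  split_ifs with h
  · have : monWeight e = k := by
      rw [h, monWeight, Finsupp.sum_single_index (by simp), mul_one, Nat.toPNat'_coe, if_pos hk]
    rw [this, map_one]
  · rw [map_zero, mul_zero, mul_zero]

lemma relabel_pmon (hw : w ≠ 0) (μ : Multiset ℕ) (hμ : ∀ k ∈ μ, 0 < k) :
    relabel β w (pmon μ) =
      MvPowerSeries.C ((HahnSeries.single (-1 : ℤ) (β * w)) ^ μ.sum) * pmon μ := by
  induction μ using Multiset.induction_on with
  | empty =>
    rw [← relabelHom_apply β hw]
    simp [pmon]
  | cons k μ ih =>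
    have h1 := ih fun j hj => hμ j (Multiset.mem_cons_of_mem hj)
    have h2 := relabel_pvar β hw (hμ k (Multiset.mem_cons_self k μ))
    have h3 : pmon (k ::ₘ μ) = pvar k * pmon μ := by
      rw [pmon, Multiset.map_cons, Multiset.prod_cons, pmon]
    rw [← relabelHom_apply β hw] at h1 h2 ⊢
    rw [h3, map_mul, h1, h2, Multiset.sum_cons, pow_add, map_mul MvPowerSeries.C]
    ring

lemma relabel_term (hw : w ≠ 0) {m : ℕ} (x : ℂ⸨X⸩) (μ : Nat.Partition m) :
    relabel β w (MvPowerSeries.C x * pmon μ.parts) =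
      MvPowerSeries.C (laurentScaleHom (inv_ne_zero hw) x *
        (HahnSeries.single (-1 : ℤ) (β * w)) ^ m) * pmon μ.parts := by
  have h := relabel_pmon β hw μ.parts fun k hk => μ.parts_pos hk
  rw [μ.parts_sum] at h
  rw [← relabelHom_apply β hw, map_mul, relabelHom_apply, relabelHom_apply, h, relabel_C β hw,
    laurentScaleHom_apply, map_mul MvPowerSeries.C, mul_assoc]

/-- The relabelling of the coefficient of a monomial. -/
def relabelCoeff (hw : w ≠ 0) (e : ℕ+ →₀ ℕ) : ℂ⸨X⸩ →+ ℂ⸨X⸩ :=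
  (AddMonoidHom.mulLeft ((HahnSeries.single (-1 : ℤ) (β * w)) ^ monWeight e)).comp
    (laurentScaleHom (inv_ne_zero hw)).toAddMonoidHom

end Relabel

lemma relabelCoeff_apply (β : ℂ) {w : ℂ} (hw : w ≠ 0) (e : ℕ+ →₀ ℕ) (x : ℂ⸨X⸩) :
    relabelCoeff β hw e x = (HahnSeries.single (-1 : ℤ) (β * w)) ^ monWeight e *
      laurentScaleHom (inv_ne_zero hw) x := rfl

lemma relabelCoeff_injective {β w : ℂ} (hβ : β ≠ 0) (hw : w ≠ 0) (e : ℕ+ →₀ ℕ) :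
    Function.Injective (relabelCoeff β hw e) := by
  intro x y hxy
  rw [relabelCoeff_apply, relabelCoeff_apply] at hxy
  refine (laurentScaleHom (inv_ne_zero hw)).injective (mul_left_cancel₀ (pow_ne_zero _ ?_) hxy)
  simp [hβ, hw]

lemma relabel_formalSum {β w : ℂ} (hβ : β ≠ 0) (hw : w ≠ 0) (f : ℕ → Fock) :
    relabel β w (formalSum f) = formalSum fun m => relabel β w (f m) := by
  ext1 e
  exact AddMonoidHom.map_finsum_of_injective (relabelCoeff β hw e)
    (relabelCoeff_injective hβ hw e) fun m => MvPowerSeries.coeff e (f m)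

lemma relabel_fockExp {β w : ℂ} (hβ : β ≠ 0) (hw : w ≠ 0) {F : Fock}
    (hF : MvPowerSeries.constantCoeff F = 0) :
    relabel β w (fockExp F) = fockExp (relabel β w F) := by
  have h1 : PowerSeries.HasSubst F := PowerSeries.HasSubst.of_constantCoeff_zero hF
  have h2 : PowerSeries.HasSubst (relabel β w F) := by
    refine PowerSeries.HasSubst.of_constantCoeff_zero ?_
    rw [← MvPowerSeries.coeff_zero_eq_constantCoeff_apply, coeff_relabel β hw,
      MvPowerSeries.coeff_zero_eq_constantCoeff_apply, hF, map_zero, mul_zero]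
  ext1 e
  rw [fockExp, fockExp, PowerSeries.coeff_subst h2, coeff_relabel β hw,
    PowerSeries.coeff_subst h1, ← relabelCoeff_apply β hw,
    AddMonoidHom.map_finsum_of_injective _ (relabelCoeff_injective hβ hw e)]
  refine finsum_congr fun d => ?_
  rw [smul_eq_mul, smul_eq_mul, relabelCoeff_apply, map_mul (laurentScaleHom _),
    PowerSeries.coeff_exp, RingHom.map_rat_algebraMap, mul_left_comm, ← relabelHom_apply β hw,
    ← map_pow (relabelHom β hw),
    relabelHom_apply, coeff_relabel β hw]

lemma constantCoeff_exponent (w : ℂ) (I : ℕ → Multiset ℕ → ℂ) :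
    MvPowerSeries.constantCoeff (exponent w I) = 0 := by
  have h : ∀ m : ℕ, ∀ μ : Nat.Partition (m + 1),
      MvPowerSeries.constantCoeff (pmon μ.parts) = 0 := by
    intro m μ
    have hμ : μ.parts ≠ 0 := fun h0 => by
      have := μ.parts_sum
      rw [h0] at this
      simp at this
    obtain ⟨k, hk⟩ := Multiset.exists_mem_of_ne_zero hμ
    obtain ⟨s, hs⟩ := Multiset.exists_cons_of_mem hk
    rw [hs, pmon, Multiset.map_cons, Multiset.prod_cons, map_mul, pvar,
      MvPowerSeries.constantCoeff_X, zero_mul]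
  rw [← MvPowerSeries.coeff_zero_eq_constantCoeff_apply]
  refine (finsum_congr fun m => ?_).trans finsum_zero
  rw [map_sum]
  refine Finset.sum_eq_zero fun μ _ => ?_
  rw [MvPowerSeries.coeff_zero_eq_constantCoeff_apply, map_mul, h, mul_zero]

lemma laurentScale_genusSum (c : ℂ) (a : ℕ → ℂ) :
    laurentScale c (genusSum a) = genusSum fun g => c ^ (2 * g) * a g := by
  rw [genusSum, laurentScale_ofPowerSeries, genusSum]
  congr 1
  ext n
  rw [PowerSeries.coeff_rescale, PowerSeries.coeff_mk, PowerSeries.coeff_mk]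
  split_ifs with h
  · rw [Nat.two_mul_div_two_of_even h]
  · rw [mul_zero]

lemma C_mul_genusSum (c : ℂ) (a : ℕ → ℂ) :
    HahnSeries.C c * genusSum a = genusSum fun g => c * a g := by
  rw [genusSum, ← HahnSeries.ofPowerSeries_C, ← map_mul, genusSum]
  congr 1
  ext n
  rw [PowerSeries.coeff_C_mul, PowerSeries.coeff_mk, PowerSeries.coeff_mk, mul_ite, mul_zero]

theorem relabel_exponent {β w : ℂ} (hβ : β ≠ 0) (hw : w ≠ 0) (I : ℕ → Multiset ℕ → ℂ) :
    relabel β w (exponent w I) = relabelledExponent β w I := by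
  rw [exponent, relabel_formalSum hβ hw, relabelledExponent]
  congr 1
  funext m
  rw [← relabelHom_apply β hw, map_sum]
  refine Finset.sum_congr rfl fun μ _ => ?_
  rw [relabelHom_apply, relabel_term β hw, map_mul (laurentScaleHom _), laurentScaleHom_apply,
    laurentScaleHom_apply, laurentScale_single, laurentScale_genusSum, mul_right_comm,
    HahnSeries.single_pow,
    HahnSeries.single_mul_single]
  congr 2
  set n : ℤ := (μ.parts.card : ℤ)
  have h : ∀ x : ℂ, HahnSeries.single (n - 2) x =
      HahnSeries.single (n - 2) (1 : ℂ) * HahnSeries.C x := by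
    intro x
    rw [HahnSeries.C_apply, HahnSeries.single_mul_single, add_zero, one_mul]
  have h2 : n - 2 + ((m + 1 : ℕ) : ℤ) + (m + 1) • (-1 : ℤ) = n - 2 := by
    rw [nsmul_eq_mul]
    push_cast
    ring
  rw [h2, h, mul_assoc, C_mul_genusSum]
  congr 2
  funext g
  have h3 : w⁻¹ ^ (n - 2 + ((m + 1 : ℕ) : ℤ)) * (β * w) ^ (m + 1) * w⁻¹ ^ (2 * g) =
      β ^ (m + 1) * w ^ (2 - 2 * (g : ℤ) - n) := by
    rw [inv_zpow', inv_pow, ← zpow_natCast, ← zpow_natCast, ← zpow_neg, mul_zpow, ← zpow_natCast,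
      mul_left_comm, mul_assoc, ← zpow_add₀ hw, ← zpow_add₀ hw]
    congr 2
    push_cast
    ring
  rw [mul_one, ← mul_assoc, h3]
  ring

theorem relabel_rightSide {β w : ℂ} (hβ : β ≠ 0) (hw : w ≠ 0) :
    relabel β w (rightSide w) = relabelledRightSide β w := by
  rw [rightSide, relabel_formalSum hβ hw, relabelledRightSide]
  congr 1
  funext m
  rw [← relabelHom_apply β hw, map_sum]
  refine Finset.sum_congr rfl fun μ _ => ?_
  rw [map_sum]
  refine Finset.sum_congr rfl fun ν _ => ?_
  rw [relabelHom_apply, relabel_term β hw]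
  congr 2
  have hexp : w⁻¹ * ((1 + w / 2) * f2 (diagram ν)) = (1 / w + 1 / 2) * f2 (diagram ν) := by
    field_simp
  simp only [map_mul (laurentScaleHom _), map_prod, map_div₀, laurentScaleHom_apply,
    laurentScale_single, laurentScale_ofPowerSeries, PowerSeries.rescale_rescale,
    HahnSeries.C_apply, zpow_zero,
    one_mul, zpow_one, inv_mul_cancel₀ hw, rescale_expSeries]
  rw [mul_assoc]
  congr 1
  · rw [hexp]
  · nth_rewrite 3 [← card_cells_diagram ν]
    rw [← Finset.prod_const, ← Finset.prod_mul_distrib]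
    refine Finset.prod_congr rfl fun c _ => ?_
    rw [div_mul_eq_mul_div, HahnSeries.single_mul_single, one_mul, mul_right_comm,
      mul_inv_cancel₀ hw, one_mul, add_neg_cancel]

/-! ### The data -/

lemma coeff_calS_of_odd {n : ℕ} (hn : Odd n) : PowerSeries.coeff n calS = 0 := by
  rw [calS, PowerSeries.coeff_mk, varsigma, expSeries, expSeries, map_sub,
    PowerSeries.coeff_rescale, PowerSeries.coeff_rescale, Even.neg_pow (hn.add_odd odd_one),
    sub_self]

lemma rescale_neg_one_calS : PowerSeries.rescale (-1 : ℂ) calS = calS := by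
  ext n
  rw [PowerSeries.coeff_rescale]
  rcases Nat.even_or_odd n with h | h
  · rw [h.neg_one_pow, one_mul]
  · rw [coeff_calS_of_odd h, mul_zero]

lemma coeff_inv_calS_of_odd (x : ℂ) {n : ℕ} (hn : Odd n) :
    PowerSeries.coeff n (PowerSeries.rescale x calS)⁻¹ = 0 := by
  have h1 : (PowerSeries.rescale x calS)⁻¹ * PowerSeries.rescale x calS = 1 :=
    PowerSeries.inv_mul_cancel _ (by rw [constantCoeff_rescale_calS]; exact one_ne_zero)
  have h2 : PowerSeries.rescale (-1 : ℂ) (PowerSeries.rescale x calS)⁻¹ *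
      PowerSeries.rescale x calS = 1 := by
    have h3 := congrArg (PowerSeries.rescale (-1 : ℂ)) h1
    rwa [map_mul, map_one, PowerSeries.rescale_rescale, mul_comm x, ← PowerSeries.rescale_rescale,
      rescale_neg_one_calS] at h3
  have h4 : PowerSeries.rescale (-1 : ℂ) (PowerSeries.rescale x calS)⁻¹ =
      (PowerSeries.rescale x calS)⁻¹ :=
    mul_right_cancel₀ (right_ne_zero_of_mul_eq_one h1) (h2.trans h1.symm)
  have h5 := congrArg (PowerSeries.coeff n) h4
  rw [PowerSeries.coeff_rescale, hn.neg_one_pow] at h5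
  linear_combination (-1 / 2 : ℂ) * h5

theorem isDatum_psiDatum (w : ℂ) : IsDatum (psiDatum w) := by
  refine ⟨by simp [psiDatum], fun k n hn => ?_⟩
  rw [coeff_psiDatum, if_neg]
  intro h
  rw [(Prod.mk.inj h).2] at hn
  exact absurd hn (by decide)

theorem isDatum_yDatum (β w : ℂ) : IsDatum (yDatum β w) := by
  refine ⟨?_, fun k n hn => ?_⟩
  · rw [← PowerSeries.coeff_zero_eq_constantCoeff_apply, yDatum, PowerSeries.coeff_mk, if_pos rfl]
  · rw [yDatum, PowerSeries.coeff_mk]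
    split_ifs with h
    · rw [map_zero]
    · rw [PowerSeries.coeff_C_mul, coeff_inv_calS_of_odd _ hn, mul_zero]

/-- The series `- log (1 - c z) = ∑_{k ≥ 1} (c z) ^ k / k`. -/
def logSeries (c : ℂ) : ℂ⟦X⟧ := PowerSeries.mk fun k => c ^ k / (k : ℂ)

lemma constantCoeff_logSeries (c : ℂ) : PowerSeries.constantCoeff (logSeries c) = 0 := by
  rw [← PowerSeries.coeff_zero_eq_constantCoeff_apply, logSeries, PowerSeries.coeff_mk]
  simp

lemma derivative_logSeries (c : ℂ) :
    (1 - PowerSeries.C c * PowerSeries.X) * PowerSeries.derivative ℂ (logSeries c) =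
      PowerSeries.C c := by
  have h : ∀ n, PowerSeries.coeff n (PowerSeries.derivative ℂ (logSeries c)) = c ^ (n + 1) := by
    intro n
    rw [PowerSeries.coeff_derivative, logSeries, PowerSeries.coeff_mk]
    push_cast
    exact div_mul_cancel₀ _ (Nat.cast_add_one_ne_zero n)
  ext n
  rw [sub_mul, one_mul, map_sub, h, mul_assoc, PowerSeries.coeff_C_mul, PowerSeries.coeff_C]
  cases n with
  | zero => simp
  | succ n =>
    rw [PowerSeries.coeff_succ_X_mul, h, if_neg n.succ_ne_zero]
    ring

lemma yDatum_eq_invS (β w : ℂ) : yDatum β w = invS (logSeries (β * w)) := by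
  ext1 k
  rw [yDatum, invS, PowerSeries.coeff_mk, PowerSeries.coeff_mk, logSeries, PowerSeries.coeff_mk]
  split_ifs with h
  · simp [h]
  · rfl

lemma atZero_yDatum (β w : ℂ) : atZero (yDatum β w) = logSeries (β * w) := by
  ext k
  rw [yDatum_eq_invS, atZero, PowerSeries.coeff_map, invS, PowerSeries.coeff_mk, map_mul,
    PowerSeries.constantCoeff_C, PowerSeries.constantCoeff_inv, constantCoeff_rescale_calS,
    inv_one, mul_one]

lemma atZero_psiDatum (w : ℂ) : atZero (psiDatum w) = PowerSeries.C (1 / w) * PowerSeries.X := by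
  rw [atZero, psiDatum, map_mul, PowerSeries.map_C, PowerSeries.map_X, PowerSeries.constantCoeff_C]

lemma coeff_succ_of_derivative_eq {c a : ℂ} {G : ℂ⟦X⟧}
    (h : (1 - PowerSeries.C c * PowerSeries.X) * PowerSeries.derivative ℂ G =
      PowerSeries.C a * G) (n : ℕ) :
    PowerSeries.coeff (n + 1) G * (n + 1) = (a + c * n) * PowerSeries.coeff n G := by
  have h1 := congrArg (PowerSeries.coeff n) h
  rw [sub_mul, one_mul, map_sub, mul_assoc, PowerSeries.coeff_C_mul, PowerSeries.coeff_C_mul,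
    PowerSeries.coeff_derivative] at h1
  cases n with
  | zero =>
    rw [PowerSeries.coeff_zero_X_mul] at h1
    simp only [Nat.cast_zero] at h1 ⊢
    linear_combination h1
  | succ n =>
    rw [PowerSeries.coeff_succ_X_mul, PowerSeries.coeff_derivative] at h1
    push_cast at h1 ⊢
    linear_combination h1

lemma ring_choose_succ (r : ℂ) (n : ℕ) :
    Ring.choose r (n + 1) * (n + 1) = (r - n) * Ring.choose r n := by
  have hn : ((n.factorial : ℕ) : ℂ) ≠ 0 := by exact_mod_cast n.factorial_ne_zero
  have hn1 : ((n : ℂ) + 1) ≠ 0 := Nat.cast_add_one_ne_zero n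
  rw [Ring.choose_eq_smul, Ring.choose_eq_smul, descPochhammer_succ_right,
    Polynomial.smeval_mul, Polynomial.smeval_sub, Polynomial.smeval_X, Polynomial.smeval_natCast,
    Nat.factorial_succ]
  simp only [smul_eq_mul, pow_one, pow_zero, nsmul_eq_mul, mul_one]
  push_cast
  field_simp

theorem spectralX_data {β w : ℂ} (hw : w ≠ 0) :
    spectralX (psiDatum w) (yDatum β w) =
      PowerSeries.X * PowerSeries.rescale (-(β * w)) (PowerSeries.binomialSeries ℂ (1 / w)) := by
  have hL : PowerSeries.HasSubst (logSeries (β * w)) :=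
    PowerSeries.HasSubst.of_constantCoeff_zero (constantCoeff_logSeries _)
  have h1 : PowerSeries.subst (logSeries (β * w)) (atZero (psiDatum w)) =
      PowerSeries.C (1 / w) * logSeries (β * w) := by
    rw [atZero_psiDatum, ← PowerSeries.smul_eq_C_mul, PowerSeries.subst_smul hL,
      PowerSeries.subst_X hL, PowerSeries.smul_eq_C_mul]
  set A : ℂ⟦X⟧ := -(PowerSeries.C (1 / w) * logSeries (β * w)) with hA
  have hA0 : PowerSeries.constantCoeff A = 0 := by
    rw [hA, map_neg, map_mul, constantCoeff_logSeries, mul_zero, neg_zero]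
  have hAs : PowerSeries.HasSubst A := PowerSeries.HasSubst.of_constantCoeff_zero hA0
  set G : ℂ⟦X⟧ := PowerSeries.subst A (PowerSeries.exp ℂ) with hG
  have hG1 : (1 - PowerSeries.C (β * w) * PowerSeries.X) * PowerSeries.derivative ℂ G =
      PowerSeries.C (-β) * G := by
    have hc : PowerSeries.C (1 / w) * PowerSeries.C (β * w) = (PowerSeries.C β : ℂ⟦X⟧) := by
      rw [← map_mul]
      congr 1
      field_simp
    have hD : PowerSeries.derivative ℂ A =
        -(PowerSeries.C (1 / w) * PowerSeries.derivative ℂ (logSeries (β * w))) := by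
      rw [hA, map_neg, ← PowerSeries.smul_eq_C_mul, Derivation.map_smul,
        PowerSeries.smul_eq_C_mul]
    rw [hG, PowerSeries.derivative_subst hAs, PowerSeries.derivative_exp, hD, map_neg, ← hc]
    linear_combination (-PowerSeries.subst A (PowerSeries.exp ℂ) * PowerSeries.C (1 / w)) *
      derivative_logSeries (β * w)
  have hG0 : PowerSeries.constantCoeff G = 1 := by
    have h2 : PowerSeries.exp ℂ = (PowerSeries.exp ℂ - 1) + 1 := (sub_add_cancel _ _).symm
    have h3 : PowerSeries.subst A (1 : ℂ⟦X⟧) = (1 : ℂ⟦X⟧) := by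
      rw [← PowerSeries.coe_substAlgHom hAs, map_one]
    rw [hG, h2, PowerSeries.subst_add hAs, h3, map_add, map_one]
    have h4 := PowerSeries.constantCoeff_subst_eq_zero hA0 (PowerSeries.exp ℂ - 1) (by simp)
    exact add_eq_right.2 h4
  rw [spectralX, atZero_yDatum, h1, ← hA, ← hG]
  congr 1
  ext n
  induction n with
  | zero =>
    rw [PowerSeries.coeff_zero_eq_constantCoeff_apply, hG0, PowerSeries.coeff_rescale]
    simp
  | succ n ih =>
    have h2 := coeff_succ_of_derivative_eq hG1 n
    have h3 := ring_choose_succ (1 / w) n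
    have hn1 : ((n : ℂ) + 1) ≠ 0 := Nat.cast_add_one_ne_zero n
    rw [ih] at h2
    refine mul_right_cancel₀ hn1 (h2.trans ?_)
    rw [PowerSeries.coeff_rescale, PowerSeries.coeff_rescale, PowerSeries.binomialSeries_coeff,
      PowerSeries.binomialSeries_coeff, smul_eq_mul, smul_eq_mul, mul_one, mul_one,
      mul_assoc ((-(β * w)) ^ (n + 1)), h3, pow_succ]
    field_simp
    ring

/-! ### Family II -/

/-- If `u * exp g` has vanishing logarithmic derivative near the end of a path and `g` stays finite
there, then `u` cannot tend to zero. -/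
lemma false_of_logDeriv_eq_zero {u g : ℝ → ℂ} {G : ℂ}
    (h : ∀ᶠ t in 𝓝[<] (1 : ℝ), u t ≠ 0 ∧ ∃ u' g' : ℂ, HasDerivAt u u' t ∧ HasDerivAt g g' t ∧
      u' + u t * g' = 0)
    (hu : Tendsto u (𝓝[<] 1) (𝓝 0)) (hg : Tendsto g (𝓝[<] 1) (𝓝 G)) : False := by
  obtain ⟨a, ha, hsub⟩ := mem_nhdsLT_iff_exists_Ioo_subset.1 h
  have hderiv : ∀ t ∈ Set.Ioo a 1, HasDerivAt (fun t => u t * Complex.exp (g t)) 0 t := by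
    intro t ht
    obtain ⟨-, u', g', h1, h2, h3⟩ := hsub ht
    refine (h1.mul h2.cexp).congr_deriv ?_
    linear_combination Complex.exp (g t) * h3
  have hb : (a + 1) / 2 ∈ Set.Ioo a 1 := by
    have : a < 1 := ha
    constructor <;> linarith
  have hconst : ∀ t ∈ Set.Ioo a 1, u t * Complex.exp (g t) =
      u ((a + 1) / 2) * Complex.exp (g ((a + 1) / 2)) := fun t ht =>
    isOpen_Ioo.is_const_of_deriv_eq_zero isPreconnected_Ioo
      (fun s hs => (hderiv s hs).differentiableAt.differentiableWithinAt)
      (fun s hs => (hderiv s hs).deriv) ht hb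
  have hlim : Tendsto (fun t => u t * Complex.exp (g t)) (𝓝[<] 1) (𝓝 (0 * Complex.exp G)) :=
    hu.mul ((Complex.continuous_exp.tendsto G).comp hg)
  have hev : (fun t => u t * Complex.exp (g t)) =ᶠ[𝓝[<] 1]
      fun _ => u ((a + 1) / 2) * Complex.exp (g ((a + 1) / 2)) :=
    Filter.mem_of_superset (Ioo_mem_nhdsLT ha) hconst
  have heq := tendsto_nhds_unique (hlim.congr' hev) tendsto_const_nhds
  rw [zero_mul] at heq
  exact mul_ne_zero (hsub hb).1 (Complex.exp_ne_zero _) heq.symm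

lemma eventually_mem_Ioo : ∀ᶠ t in 𝓝[<] (1 : ℝ), t ∈ Set.Ioo (0 : ℝ) 1 :=
  Ioo_mem_nhdsLT one_pos

lemma not_tendsto_of_finite_pole {β w : ℂ} (hβ : β ≠ 0) (hw : w ≠ 0) {γ x : ℝ → ℂ} {v : ℂ}
    (h : ∀ t ∈ Set.Ioo (0 : ℝ) 1, γ t ≠ 0 ∧ 1 - β * w * γ t ≠ 0 ∧ ∃ γ' : ℂ, HasDerivAt γ γ' t ∧
      HasDerivAt x ((1 / γ t - β / (1 - β * w * γ t)) * γ') t)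
    (hγ : Tendsto γ (𝓝[<] 1) (𝓝 (β * w)⁻¹)) (hx : Tendsto x (𝓝[<] 1) (𝓝 v)) : False := by
  have hc : β * w ≠ 0 := mul_ne_zero hβ hw
  have h1 : Tendsto (fun t => β * w * γ t) (𝓝[<] 1) (𝓝 1) := by
    have := hγ.const_mul (β * w)
    rwa [mul_inv_cancel₀ hc] at this
  have hslit : (1 : ℂ) ∈ Complex.slitPlane := Complex.one_mem_slitPlane
  refine false_of_logDeriv_eq_zero (u := fun t => 1 - β * w * γ t)
    (g := fun t => w * (Complex.log (β * w * γ t) - x t)) (G := w * (Complex.log 1 - v)) ?_ ?_ ?_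
  · filter_upwards [eventually_mem_Ioo,
      h1.eventually (Complex.isOpen_slitPlane.mem_nhds hslit)] with t ht hs
    obtain ⟨h0, h1, γ', h2, h3⟩ := h t ht
    refine ⟨h1, _, _, (h2.const_mul (β * w)).const_sub 1,
      (((h2.const_mul (β * w)).clog_real hs).sub h3).const_mul w, ?_⟩
    field_simp
    ring
  · simpa using h1.const_sub 1
  · exact ((((continuousAt_clog hslit).tendsto).comp h1).sub hx).const_mul w

lemma not_tendsto_of_infinite_pole {β w : ℂ} (hβ : β ≠ 0) (hw : w ≠ 0) (hw1 : w + 1 ≠ 0)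
    {γ x : ℝ → ℂ} {v : ℂ}
    (h : ∀ t ∈ Set.Ioo (0 : ℝ) 1, γ t ≠ 0 ∧ 1 - β * w * γ t ≠ 0 ∧ ∃ γ' : ℂ, HasDerivAt γ γ' t ∧
      HasDerivAt x ((1 / γ t - β / (1 - β * w * γ t)) * γ') t)
    (hγ : Tendsto (fun t => (γ t)⁻¹) (𝓝[<] 1) (𝓝 0)) (hx : Tendsto x (𝓝[<] 1) (𝓝 v)) :
    False := by
  have hc : β * w ≠ 0 := mul_ne_zero hβ hw
  have h1 : Tendsto (fun t => 1 - (β * w)⁻¹ * (γ t)⁻¹) (𝓝[<] 1) (𝓝 1) := by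
    simpa using (hγ.const_mul (β * w)⁻¹).const_sub 1
  have hslit : (1 : ℂ) ∈ Complex.slitPlane := Complex.one_mem_slitPlane
  refine false_of_logDeriv_eq_zero (u := fun t => (γ t)⁻¹)
    (g := fun t => (w * x t - Complex.log (1 - (β * w)⁻¹ * (γ t)⁻¹)) / (w + 1))
    (G := (w * v - Complex.log 1) / (w + 1)) ?_ hγ ?_
  · filter_upwards [eventually_mem_Ioo,
      h1.eventually (Complex.isOpen_slitPlane.mem_nhds hslit)] with t ht hs
    obtain ⟨h0, h1, γ', h2, h3⟩ := h t ht
    refine ⟨inv_ne_zero h0, _, _, h2.fun_inv h0, ((h3.const_mul w).sub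
      (((h2.fun_inv h0).const_mul (β * w)⁻¹).const_sub 1 |>.clog_real hs)).div_const (w + 1), ?_⟩
    have h4 : 1 - (β * w)⁻¹ * (γ t)⁻¹ = -(1 - β * w * γ t) / (β * w * γ t) := by
      field_simp
      ring
    rw [h4]
    generalize hD : 1 - β * w * γ t = D at h1 ⊢
    field_simp
    rw [← hD]
    ring
  · exact ((hx.const_mul w).sub (((continuousAt_clog hslit).tendsto).comp h1)).div_const (w + 1)

section Curve

open Polynomial

lemma natDegree_one_sub_C_mul_X {c : ℂ} (hc : c ≠ 0) : (1 - C c * X : ℂ[X]).natDegree = 1 := by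
  have : (1 - C c * X : ℂ[X]) = C (-c) * X + C 1 := by
    rw [map_neg, map_one]
    ring
  rw [this, natDegree_linear (neg_ne_zero.2 hc)]

lemma one_sub_C_mul_X_ne_zero (c : ℂ) : (1 - C c * X : ℂ[X]) ≠ 0 := by
  intro h
  have := congrArg (eval 0) h
  simp at this

lemma rationalDeriv_eq (c : ℂ) :
    rationalDeriv 0 1 1 (1 - C c * X) =
      algebraMap ℂ[X] (RatFunc ℂ) (C c) / algebraMap ℂ[X] (RatFunc ℂ) (1 - C c * X) := by
  have h : (1 - C c * X : ℂ[X]).derivative = -C c := by simp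
  simp only [rationalDeriv, h, derivative_one, map_zero, map_neg]
  simp only [map_one, zero_mul, sub_zero, zero_div, zero_add, mul_zero]
  ring

lemma dx_eq {β w : ℂ} (hw : w ≠ 0) :
    1 / RatFunc.X - RatFunc.C (1 / w) * rationalDeriv 0 1 1 (1 - C (β * w) * X) =
      algebraMap ℂ[X] (RatFunc ℂ) (1 - C (β * (w + 1)) * X) /
        algebraMap ℂ[X] (RatFunc ℂ) (X * (1 - C (β * w) * X)) := by
  have hinj := RatFunc.algebraMap_injective ℂ
  have h1 : algebraMap ℂ[X] (RatFunc ℂ) X ≠ 0 := (map_ne_zero_iff _ hinj).2 X_ne_zero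
  have h2 : algebraMap ℂ[X] (RatFunc ℂ) (1 - C (β * w) * X) ≠ 0 :=
    (map_ne_zero_iff _ hinj).2 (one_sub_C_mul_X_ne_zero _)
  rw [rationalDeriv_eq, ← RatFunc.algebraMap_X, ← RatFunc.algebraMap_C, ← mul_div_assoc,
    ← map_mul, ← C_mul, div_sub_div _ _ h1 h2, ← map_mul]
  refine congrArg₂ _ ?_ (map_mul _ _ _).symm
  rw [one_mul, ← map_sub]
  congr 1
  have : 1 / w * (β * w) = β := by field_simp
  rw [this, mul_add, mul_one, C_add]
  ring

lemma eval_ratFunc {f : RatFunc ℂ} {n d : ℂ[X]} (hd : d ≠ 0)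
    (hf : f = algebraMap ℂ[X] (RatFunc ℂ) n / algebraMap ℂ[X] (RatFunc ℂ) d) {z : ℂ}
    (hz : f.denom.eval z ≠ 0) (hn : d.eval z = 0 → n.eval z ≠ 0) :
    d.eval z ≠ 0 ∧ f.eval (RingHom.id ℂ) z = n.eval z / d.eval z := by
  have h := congrArg (eval z) ((RatFunc.num_mul_eq_mul_denom_iff hd).2 hf)
  rw [eval_mul, eval_mul] at h
  have hdz : d.eval z ≠ 0 := by
    intro h0
    rw [h0, mul_zero] at h
    exact mul_ne_zero (hn h0) hz h.symm
  refine ⟨hdz, ?_⟩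
  rw [RatFunc.eval, ← eval, ← eval, div_eq_div_iff hz hdz, h]

theorem isFamilyII_data {β w : ℂ} (hβ : β ≠ 0) (hw : w ≠ 0) :
    IsFamilyII (psiDatum w) (yDatum β w) := by
  have hc : β * w ≠ 0 := mul_ne_zero hβ hw
  refine ⟨1 / w, 0, 1, 1, 1 - C (β * w) * X, logSeries (β * w), one_div_ne_zero hw, by simp,
    by simp, by simp, ⟨?_, ?_⟩, rfl, ?_, ?_, ?_, ?_, ?_, ?_⟩
  · rw [constantCoeff_logSeries]
    simp
  · have := derivative_logSeries (β * w)
    simpa using this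
  · rw [yDatum_eq_invS]
    simp
  · rw [atZero_psiDatum]
    refine mul_ne_zero (fun h => ?_) PowerSeries.X_ne_zero
    simpa [hw] using congrArg PowerSeries.constantCoeff h
  · rw [atZero_psiDatum]
    simp
  · rw [atZero_yDatum]
    intro h
    have := congrArg (PowerSeries.coeff 1) h
    rw [logSeries, PowerSeries.coeff_mk] at this
    simp [hβ, hw] at this
  · rw [atZero_yDatum, constantCoeff_logSeries]
  intro P Q hP hQ hPQ
  have hd : (X * (1 - C (β * w) * X) : ℂ[X]) ≠ 0 :=
    mul_ne_zero X_ne_zero (one_sub_C_mul_X_ne_zero _)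
  rw [dx_eq hw] at hP hPQ
  have hw1 : w + 1 ≠ 0 := by
    intro hw1
    rw [hw1, mul_zero, C_0, zero_mul, sub_zero] at hP
    induction P using OnePoint.rec with
    | infty =>
      rcases hP with h | h
      · exact div_ne_zero (by simp) ((map_ne_zero_iff _ (RatFunc.algebraMap_injective ℂ)).2 hd) h
      · rw [RatFunc.intDegree_div (by simp)
          ((map_ne_zero_iff _ (RatFunc.algebraMap_injective ℂ)).2 hd),
          RatFunc.intDegree_polynomial, RatFunc.intDegree_polynomial,
          natDegree_mul X_ne_zero (one_sub_C_mul_X_ne_zero _), natDegree_X,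
          natDegree_one_sub_C_mul_X hc] at h
        simp at h
    | coe z =>
      have h : IsRoot (1 : ℂ[X]) z := IsRoot.dvd hP (RatFunc.num_div_dvd _ hd)
      simp [IsRoot] at h
  obtain ⟨γ, x, v, hγ, -, hγ1, -, hx1⟩ := hPQ
  have hpath : ∀ t ∈ Set.Ioo (0 : ℝ) 1, γ t ≠ 0 ∧ 1 - β * w * γ t ≠ 0 ∧ ∃ γ' : ℂ,
      HasDerivAt γ γ' t ∧ HasDerivAt x ((1 / γ t - β / (1 - β * w * γ t)) * γ') t := by
    intro t ht
    obtain ⟨h1, γ', h2, h3⟩ := hγ t ht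
    obtain ⟨h4, h5⟩ := eval_ratFunc hd rfl h1 (by
      intro h0 h6
      simp only [eval_mul, eval_X, eval_sub, eval_one, eval_C, mul_eq_zero] at h0 h6
      rcases h0 with h0 | h0
      · rw [h0] at h6
        simp at h6
      · have h7 : β * γ t = 0 := by linear_combination h0 - h6
        rcases mul_eq_zero.1 h7 with h7 | h7
        · exact hβ h7
        · rw [h7] at h0
          simp at h0)
    simp only [eval_mul, eval_X, eval_sub, eval_one, eval_C] at h4 h5
    have h6 := left_ne_zero_of_mul h4
    have h7 := right_ne_zero_of_mul h4
    refine ⟨h6, h7, γ', h2, h3.congr_deriv ?_⟩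
    rw [h5, div_sub_div _ _ h6 h7]
    congr 2
    ring
  induction Q using OnePoint.rec with
  | infty =>
    refine not_tendsto_of_infinite_pole hβ hw hw1 hpath ?_ hx1
    refine Filter.tendsto_inv₀_cobounded.comp ?_
    rw [Metric.cobounded_eq_cocompact, ← Filter.coclosedCompact_eq_cocompact,
      ← OnePoint.comap_coe_nhds_infty]
    exact Filter.tendsto_comap_iff.2 hγ1
  | coe z =>
    have h : IsRoot (1 - C (β * w) * X : ℂ[X]) z := by
      rw [rationalDeriv_eq] at hQ
      exact IsRoot.dvd hQ (RatFunc.denom_div_dvd _ _)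
    have hz : z = (β * w)⁻¹ := by
      simp only [IsRoot, eval_mul, eval_X, eval_sub, eval_one, eval_C] at h
      refine eq_inv_of_mul_eq_one_left ?_
      linear_combination -h
    refine not_tendsto_of_finite_pole hβ hw hpath ?_ hx1
    rw [← hz]
    exact OnePoint.isOpenEmbedding_coe.tendsto_nhds_iff.2 hγ1

end Curve

end MarinoVafa

end

theorem mainTheorem6 (β w : ℂ) (hβ : β ≠ 0) (hw : w ≠ 0) :
    (∀ I : ℕ → Multiset ℕ → ℂ,
      MarinoVafa.relabel β w (MarinoVafa.fockExp (MarinoVafa.exponent w I)) =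
        MarinoVafa.fockExp (MarinoVafa.relabelledExponent β w I)) ∧
    MarinoVafa.relabel β w (MarinoVafa.rightSide w) = MarinoVafa.relabelledRightSide β w ∧
    MarinoVafa.IsDatum (MarinoVafa.psiDatum w) ∧
    MarinoVafa.IsDatum (MarinoVafa.yDatum β w) ∧
    MarinoVafa.relabelledRightSide β w =
      MarinoVafa.hypergeometricTau (MarinoVafa.psiDatum w) (MarinoVafa.yDatum β w) ∧
    MarinoVafa.spectralX (MarinoVafa.psiDatum w) (MarinoVafa.yDatum β w) =
      PowerSeries.X *
        PowerSeries.rescale (-(β * w)) (PowerSeries.binomialSeries ℂ (1 / w)) ∧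
    MarinoVafa.IsFamilyII (MarinoVafa.psiDatum w) (MarinoVafa.yDatum β w) := by
  exact ⟨fun I => by
      rw [MarinoVafa.relabel_fockExp hβ hw (MarinoVafa.constantCoeff_exponent w I),
        MarinoVafa.relabel_exponent hβ hw],
    MarinoVafa.relabel_rightSide hβ hw, MarinoVafa.isDatum_psiDatum w,
    MarinoVafa.isDatum_yDatum β w, MarinoVafa.relabelledRightSide_eq_hypergeometricTau hβ hw,
    MarinoVafa.spectralX_data hw, MarinoVafa.isFamilyII_data hβ hw⟩
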